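/- Let $S=\{a_0,a_1,a_2,b,c,d\}$. Put $e_n=\{b,c\},\{d,b\},\{c,d\}$ for $n\equiv 0,1,2 \pmod 3$, respectively, and define finite sequences ("segments") of subsets of $S$ by \[I_1=\{a_2\}\{b,c\}\{a_0\},\quad J_1=\{a_2\}\{b,c\}\{a_1\},\qquad I_{n+1}=J_n e_n J_n^{-1},\quad J_{n+1}=J_n e_n I_n^{-1}\quad(n\ge 1),\] where $X^{-1}$ is $X$ written backwards. Let $\mathcal S$ be the set of all $w=(A_n)_{n\in\mathbb Z}$ each of whose finite segments is a segment of some $I_n$ or $J_n$, $n\ge 1$. For $w\in\mathcal S$ let $\Gamma_w$ be the graph with vertex set $\mathbb Z$ in which $n$ and $n+1$ are connected by edges labeled by the elements of $A_n$; a label $h\in S$ acts on it by $h(n)=n+1$ if $h\in A_n$, $h(n)=n-1$ if $h\in A_{n-1}$, and $h(n)=n$ otherwise. Let $\widehat G$ be the group of permutations of the disjoint union of the vertex sets of all $\Gamma_w$, $w\in\mathcal S$, generated by $S$. A segment with $k$ terms is also seen as a labeled chain with $k+1$ vertices. For $n\ge 2$ let $H_n\le\widehat G$ be the subgroup of those $g$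 such that: every copy of $I_n$ or $J_n$ in every $\Gamma_w$ (in either direction) is $g$-invariant; $g$ commutes with all isomorphisms between copies of $I_n$ and with all isomorphisms between copies of $J_n$; and $g$ leaves invariant both halves $J_{n-1}$, $J_{n-1}^{-1}$ of every copy of $I_n$. Let $H_\infty=\bigcup_{n\ge 2}H_n$ (an increasing union), and let $A$ be the normal closure in $\widehat G$ of the derived subgroup $H_\infty'$. **Theorem.** The group $\widehat G$ is virtually simple, i.e. it has a simple subgroup of finite index. More precisely, $A$ is simple and has finite index in $\widehat G$. Moreover, let $K=\{1,b,c,d\}$ be the Klein four-group, let $J_\infty$ be the one-sided infinite chain with vertices $0,1,2,\dots$ that is the limit of the $J_n$ embedded as the beginnings of $J_{n+1}$, and let $\Xi$ be the labeled graph consisting of four copies $(J_\infty,x)$, $x\in K$, of $J_\infty$ with an edge labeled $y$ between the left ends $(0,x)$ and $(0,xy)$ for all $x\in K$ and $y\in\{b,c,d\}$ (labels without an edge at a vertex fix that vertex). Then the action of the labels on the vertices of $\Xi$ extends to an action of $\widehat G$; if $\tau_g(v)\in K$ denotes the index of the copy of $J_\infty$ to which $g\in\widehat G$ moves the vertex $(v,1)$,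 and $g(v)$ the vertex of $J_\infty$ to which it moves, then for every $g$ we have $\tau_g(v)=1$ for all but finitely many $v$, the cocycle identity $\tau_{gh}(v)=\tau_g(h(v))\,\tau_h(v)$ holds, and $\phi(g)=\prod_{v}\tau_g(v)$ is a homomorphism from $\widehat G$ onto $K$ with $\phi(b)=b$, $\phi(c)=c$, $\phi(d)=d$, whose kernel contains $H_\infty$ and $A$. -/

import Mathlib

namespace SegGroup

/-- The set `S = {a₀, a₁, a₂, b, c, d}` of labels. -/
inductive Gen : Type
  | a0 | a1 | a2 | b | c | d
  deriving DecidableEq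

open Gen

/-- The connectors: `e_n = {b, c}, {d, b}, {c, d}` for `n ≡ 0, 1, 2 (mod 3)`. -/
def conn (n : ℕ) : Finset Gen :=
  if n % 3 = 0 then {b, c} else if n % 3 = 1 then {d, b} else {c, d}

/-- The pair of segments `(I_n, J_n)`, for `n ≥ 1`. The value at `0` is never used. -/
def segs : ℕ → List (Finset Gen) × List (Finset Gen)
  | 0 => ([], [])
  | 1 => ([{a2}, {b, c}, {a0}], [{a2}, {b, c}, {a1}])
  | n + 2 =>
      ((segs (n + 1)).2 ++ conn (n + 1) :: (segs (n + 1)).2.reverse,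
        (segs (n + 1)).2 ++ conn (n + 1) :: (segs (n + 1)).1.reverse)

/-- The segment `I_n`, `n ≥ 1`. -/
def segI (n : ℕ) : List (Finset Gen) := (segs n).1

/-- The segment `J_n`, `n ≥ 1`. -/
def segJ (n : ℕ) : List (Finset Gen) := (segs n).2

/-- The subshift generated by a set `W` of finite sequences: all two-sided sequences each of whose
finite segments is a segment of an element of `W`. -/
def subshift (W : Set (List (Finset Gen))) : Set (ℤ → Finset Gen) :=
  {w | ∀ (i : ℤ) (k : ℕ), ∃ L ∈ W, (List.ofFn fun j : Fin k => w (i + (j : ℤ))) <:+: L}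

/-- The set of segments `I_n`, `J_n`, `n ≥ 1`. -/
def segments : Set (List (Finset Gen)) := {L | ∃ n : ℕ, 1 ≤ n ∧ (L = segI n ∨ L = segJ n)}

/-- The subshift generated by the segments `I_n`, `J_n`. -/
def shiftS : Set (ℤ → Finset Gen) := subshift segments

/-- Admissible sequences: non-empty sets of labels, consecutive ones disjoint. -/
def Admissible (w : ℤ → Finset Gen) : Prop :=
  (∀ n, (w n).Nonempty) ∧ ∀ n, Disjoint (w n) (w (n + 1))

/-- The action of the label `s` on the vertex set `ℤ` of the graph `Γ_w`, in which the edges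
between `n` and `n + 1` are labeled by the elements of `w n`. -/
def step (w : ℤ → Finset Gen) (s : Gen) (n : ℤ) : ℤ :=
  if s ∈ w n then n + 1 else if s ∈ w (n - 1) then n - 1 else n

theorem step_step {w : ℤ → Finset Gen} (hw : Admissible w) (s : Gen) (n : ℤ) :
    step w s (step w s n) = n := by
  have key : ∀ m, s ∈ w m → s ∉ w (m + 1) := fun m h h' =>
    (Finset.disjoint_left.1 (hw.2 m)) h h'
  unfold step
  by_cases h : s ∈ w n
  · simp [h, key n h]
  · by_cases h' : s ∈ w (n - 1)
    · simp [h, h']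
    · simp [h, h']

theorem conn_nonempty (n : ℕ) : (conn n).Nonempty := by
  unfold conn; split_ifs <;> simp

theorem disjoint_conn {A : Finset Gen} (hA : A = {a0} ∨ A = {a1} ∨ A = {a2}) (n : ℕ) :
    Disjoint A (conn n) := by
  unfold conn
  rcases hA with rfl | rfl | rfl <;> split_ifs <;> decide

/-- A finite admissible sequence that begins and ends with one of `{a₀}`, `{a₁}`, `{a₂}`. -/
def Good (L : List (Finset Gen)) : Prop :=
  (∀ A ∈ L, A.Nonempty) ∧ L.IsChain Disjoint ∧
    (∀ A ∈ L.head?, A = {a0} ∨ A = {a1} ∨ A = {a2}) ∧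
    (∀ A ∈ L.getLast?, A = {a0} ∨ A = {a1} ∨ A = {a2})

theorem Good.reverse {L : List (Finset Gen)} (h : Good L) : Good L.reverse := by
  obtain ⟨h1, h2, h3, h4⟩ := h
  refine ⟨by simpa using h1, ?_, by simpa using h4, by simpa using h3⟩
  rw [List.isChain_reverse]
  exact h2.imp fun _ _ h => h.symm

theorem Good.join {L M : List (Finset Gen)} (hL : Good L) (hM : Good M) (hM0 : M ≠ [])
    (hL0 : L ≠ []) (n : ℕ) : Good (L ++ conn n :: M) := by
  obtain ⟨h1, h2, h3, h4⟩ := hL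
  obtain ⟨k1, k2, k3, k4⟩ := hM
  refine ⟨?_, ?_, ?_, ?_⟩
  · intro A hA
    simp only [List.mem_append, List.mem_cons] at hA
    rcases hA with hA | rfl | hA
    · exact h1 A hA
    · exact conn_nonempty n
    · exact k1 A hA
  · rw [List.isChain_append, List.isChain_cons]
    refine ⟨h2, ⟨fun A hA => (disjoint_conn (k3 A hA) n).symm, k2⟩, ?_⟩
    intro A hA B hB
    simp only [List.head?_cons, Option.mem_def, Option.some.injEq] at hB
    subst hB
    exact disjoint_conn (h4 A hA) n
  · cases L with
    | nil => exact absurd rfl hL0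
    | cons x L => simpa using h3
  · intro A hA
    apply k4
    rw [List.getLast?_append, List.getLast?_cons] at hA
    cases hM' : M.getLast? with
    | none => exact absurd (List.getLast?_eq_none_iff.1 hM') hM0
    | some x => simpa [hM'] using hA

theorem good_segs (n : ℕ) :
    (Good (segs (n + 1)).1 ∧ (segs (n + 1)).1 ≠ []) ∧
      (Good (segs (n + 1)).2 ∧ (segs (n + 1)).2 ≠ []) := by
  induction n with
  | zero =>
    refine ⟨⟨⟨?_, ?_, ?_, ?_⟩, ?_⟩, ⟨⟨?_, ?_, ?_, ?_⟩, ?_⟩⟩ <;> simp [segs]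
  | succ n ih =>
    obtain ⟨⟨hI, hI0⟩, hJ, hJ0⟩ := ih
    refine ⟨⟨?_, by simp [segs]⟩, ⟨?_, by simp [segs]⟩⟩
    · exact hJ.join hJ.reverse (by simpa using hJ0) hJ0 _
    · exact hJ.join hI.reverse (by simpa using hI0) hJ0 _

theorem good_of_mem {L : List (Finset Gen)} (hL : L ∈ segments) : Good L := by
  obtain ⟨n, hn, h⟩ := hL
  obtain ⟨n, rfl⟩ := Nat.exists_eq_add_of_le' hn
  rcases h with rfl | rfl
  · exact (good_segs n).1.1
  · exact (good_segs n).2.1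

/-- The sequences of the subshift are admissible. -/
theorem admissible_of_mem {w : ℤ → Finset Gen} (hw : w ∈ shiftS) : Admissible w := by
  have key : ∀ n : ℤ, (w n).Nonempty ∧ Disjoint (w n) (w (n + 1)) := by
    intro n
    obtain ⟨L, hL, h⟩ := hw n 2
    have hg := good_of_mem hL
    simp only [List.ofFn_succ, List.ofFn_zero] at h
    refine ⟨hg.1 _ (h.subset (by simp)), ?_⟩
    have := hg.2.1.infix h
    simpa using this
  exact ⟨fun n => (key n).1, fun n => (key n).2⟩

/-- The vertices of the disjoint union of the graphs `Γ_w`, `w` in the subshift: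
`(w, n)` is the vertex `n` of `Γ_w`. -/
abbrev Vertex : Type := shiftS × ℤ

/-- The permutation of the vertices of all graphs `Γ_w` defined by the label `s`. -/
def genPerm (s : Gen) : Equiv.Perm Vertex where
  toFun v := (v.1, step v.1.1 s v.2)
  invFun v := (v.1, step v.1.1 s v.2)
  left_inv v := by simp [step_step (admissible_of_mem v.1.2)]
  right_inv v := by simp [step_step (admissible_of_mem v.1.2)]

/-- The group defined by the subshift. -/
def Ghat : Subgroup (Equiv.Perm Vertex) := Subgroup.closure (Set.range genPerm)

/-- The generators as elements of the group. -/
def gen (s : Gen) : Ghat := ⟨genPerm s, Subgroup.subset_closure ⟨s, rfl⟩⟩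

/-- An isomorphism of the segment `X`, seen as a graph with vertices `0, …, X.length` in which the
edges between `i` and `i + 1` are labeled by the elements of `X[i]`, onto a copy of `X` in `Γ_w`.
The vertex `i` goes to `start + sign * i`; so the copy may be written in either direction. -/
structure Copy (X : List (Finset Gen)) where
  w : shiftS
  start : ℤ
  sign : ℤˣ
  label : ∀ (i : ℕ) (hi : i < X.length),
    w.1 (min (start + sign * (i : ℤ)) (start + sign * ((i : ℤ) + 1))) = X[i]

/-- The vertex of the copy that corresponds to the vertex `i` of the segment. -/
def Copy.vertex {X : List (Finset Gen)} (φ : Copy X) (i : ℕ) : Vertex :=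
  (φ.w, φ.start + φ.sign * (i : ℤ))

/-- The vertices of the copy that correspond to the vertices of the segment numbered
`k, …, l`. -/
def Copy.part {X : List (Finset Gen)} (φ : Copy X) (k l : ℕ) : Set Vertex :=
  φ.vertex '' Set.Icc k l

/-- The set of vertices of the copy. -/
def Copy.verts {X : List (Finset Gen)} (φ : Copy X) : Set Vertex := φ.part 0 X.length

/-- Every copy of the segment `X` is `g`-invariant, and `g` commutes with the isomorphisms between
copies of `X` (these are the maps `φ.vertex i ↦ ψ.vertex i`). -/
def Respects (g : Equiv.Perm Vertex) (X : List (Finset Gen)) : Prop :=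
  (∀ φ : Copy X, g '' φ.verts = φ.verts) ∧
    ∀ φ ψ : Copy X, ∀ i ≤ X.length, ∀ j ≤ X.length,
      g (φ.vertex i) = φ.vertex j → g (ψ.vertex i) = ψ.vertex j

theorem Respects.one (X : List (Finset Gen)) : Respects 1 X := by
  refine ⟨fun φ => by simp, fun φ ψ i _ j _ h => ?_⟩
  have : i = j := by
    have h2 := congrArg Prod.snd h
    simpa [Copy.vertex] using h2
  simp [this]

theorem Respects.mul {g h : Equiv.Perm Vertex} {X : List (Finset Gen)} (hg : Respects g X)
    (hh : Respects h X) : Respects (g * h) X := by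
  refine ⟨fun φ => ?_, fun φ ψ i hi j hj e => ?_⟩
  · rw [Equiv.Perm.coe_mul, Set.image_comp, hh.1, hg.1]
  · have : h (φ.vertex i) ∈ φ.verts := by
      rw [← hh.1 φ]
      exact ⟨_, ⟨i, ⟨Nat.zero_le _, hi⟩, rfl⟩, rfl⟩
    obtain ⟨k, ⟨-, hk⟩, e'⟩ := this
    rw [Equiv.Perm.mul_apply, ← e'] at e
    rw [Equiv.Perm.mul_apply, hh.2 φ ψ i hi k hk e'.symm]
    exact hg.2 φ ψ k hk j hj e

theorem image_inv_of_image {g : Equiv.Perm Vertex} {s : Set Vertex} (h : g '' s = s) :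
    (g⁻¹ : Equiv.Perm Vertex) '' s = s := by
  conv_lhs => rw [← h]
  rw [← Set.image_comp, ← Equiv.Perm.coe_mul]
  simp

theorem Respects.inv {g : Equiv.Perm Vertex} {X : List (Finset Gen)} (hg : Respects g X) :
    Respects g⁻¹ X := by
  refine ⟨fun φ => image_inv_of_image (hg.1 φ), fun φ ψ i hi j hj e => ?_⟩
  rw [Equiv.Perm.inv_eq_iff_eq] at e ⊢
  exact (hg.2 φ ψ j hj i hi e.symm).symm

/-- The group `H_n` (for `n ≥ 2`): the elements of the group that leave every copy of `I_n` and
`J_n` invariant, commute with the isomorphisms between copies of `I_n` and with the isomorphisms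
between copies of `J_n`, and leave invariant both halves `J_{n-1}`, `J_{n-1}⁻¹` of every copy
of `I_n`. -/
def H (n : ℕ) : Subgroup Ghat where
  carrier := {g | Respects g (segI n) ∧ Respects g (segJ n) ∧
    ∀ φ : Copy (segI n),
      (g : Equiv.Perm Vertex) '' φ.part 0 (segJ (n - 1)).length
          = φ.part 0 (segJ (n - 1)).length ∧
        (g : Equiv.Perm Vertex) '' φ.part ((segJ (n - 1)).length + 1) (segI n).length
          = φ.part ((segJ (n - 1)).length + 1) (segI n).length}
  one_mem' := ⟨Respects.one _, Respects.one _, fun φ => by simp⟩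
  mul_mem' := by
    rintro g h ⟨g1, g2, g3⟩ ⟨h1, h2, h3⟩
    refine ⟨g1.mul h1, g2.mul h2, fun φ => ⟨?_, ?_⟩⟩
    · rw [Subgroup.coe_mul, Equiv.Perm.coe_mul, Set.image_comp, (h3 φ).1, (g3 φ).1]
    · rw [Subgroup.coe_mul, Equiv.Perm.coe_mul, Set.image_comp, (h3 φ).2, (g3 φ).2]
  inv_mem' := by
    rintro g ⟨g1, g2, g3⟩
    exact ⟨g1.inv, g2.inv, fun φ =>
      ⟨image_inv_of_image (g3 φ).1, image_inv_of_image (g3 φ).2⟩⟩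

/-- The copy of `L` at the beginning of a copy of `L e M⁻¹`. -/
def Copy.left {L M : List (Finset Gen)} {e : Finset Gen} (φ : Copy (L ++ e :: M.reverse)) :
    Copy L where
  w := φ.w
  start := φ.start
  sign := φ.sign
  label i hi := by
    rw [φ.label i (by simp; omega), List.getElem_append_left hi]

/-- The copy of `M`, written backwards, at the end of a copy of `L e M⁻¹`. -/
def Copy.right {L M : List (Finset Gen)} {e : Finset Gen} (φ : Copy (L ++ e :: M.reverse)) :
    Copy M where
  w := φ.w
  start := φ.start + φ.sign * ((L.length + 1 + M.length : ℕ) : ℤ)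
  sign := -φ.sign
  label i hi := by
    have h := φ.label (L.length + 1 + (M.length - 1 - i)) (by simp; omega)
    rw [List.getElem_append_right (by omega)] at h
    have e1 : L.length + 1 + (M.length - 1 - i) - L.length = (M.length - 1 - i) + 1 := by omega
    simp only [e1, List.getElem_cons_succ, List.getElem_reverse] at h
    have e2 : M.length - 1 - (M.length - 1 - i) = i := by omega
    simp only [e2] at h
    rw [← h, min_comm]
    have e3 : ((L.length + 1 + (M.length - 1 - i) : ℕ) : ℤ)
        = ((L.length + 1 + M.length : ℕ) : ℤ) - 1 - i := by omega
    rw [e3]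
    push_cast
    ring_nf

theorem Copy.vertex_inj {X : List (Finset Gen)} (φ : Copy X) {i j : ℕ}
    (h : φ.vertex i = φ.vertex j) : i = j := by
  simpa [Copy.vertex] using congrArg Prod.snd h

theorem Copy.right_vertex {L M : List (Finset Gen)} {e : Finset Gen}
    (φ : Copy (L ++ e :: M.reverse)) {i : ℕ} (hi : i ≤ M.length) :
    φ.right.vertex i = φ.vertex (L.length + 1 + M.length - i) := by
  unfold Copy.vertex Copy.right
  rw [Nat.cast_sub (by omega)]
  push_cast
  congr 1
  ring

theorem Copy.left_verts {L M : List (Finset Gen)} {e : Finset Gen}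
    (φ : Copy (L ++ e :: M.reverse)) : φ.left.verts = φ.part 0 L.length := rfl

theorem Copy.right_verts {L M : List (Finset Gen)} {e : Finset Gen}
    (φ : Copy (L ++ e :: M.reverse)) :
    φ.right.verts = φ.part (L.length + 1) (L ++ e :: M.reverse).length := by
  ext v
  constructor
  · rintro ⟨i, ⟨-, hi⟩, rfl⟩
    exact ⟨_, ⟨by omega, by simp; omega⟩, (φ.right_vertex hi).symm⟩
  · rintro ⟨i, ⟨hi, hi'⟩, rfl⟩
    simp only [List.length_append, List.length_cons, List.length_reverse] at hi'
    refine ⟨L.length + 1 + M.length - i, ⟨by omega, by omega⟩, ?_⟩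
    rw [φ.right_vertex (by omega)]
    congr 1
    omega

theorem Respects.join {g : Equiv.Perm Vertex} {L M : List (Finset Gen)} (hL : Respects g L)
    (hM : Respects g M) (e : Finset Gen) : Respects g (L ++ e :: M.reverse) := by
  refine ⟨fun φ => ?_, fun φ ψ i hi j hj E => ?_⟩
  · have hu : φ.verts = φ.left.verts ∪ φ.right.verts := by
      rw [φ.left_verts, φ.right_verts, Copy.part, Copy.part, ← Set.image_union, Copy.verts,
        Copy.part]
      congr 1
      ext i
      simp only [Set.mem_Icc, Set.mem_union, List.length_append, List.length_cons]
      omega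
    rw [hu, Set.image_union, hL.1, hM.1]
  · simp only [List.length_append, List.length_cons, List.length_reverse] at hi hj
    rcases Nat.lt_or_ge L.length i with h | h
    · have hi0 : i = L.length + 1 + M.length - (L.length + 1 + M.length - i) := by omega
      have hle : L.length + 1 + M.length - i ≤ M.length := by omega
      have hmem : g (φ.vertex i) ∈ φ.right.verts := by
        rw [← hM.1 φ.right]
        refine ⟨_, ⟨_, ⟨Nat.zero_le _, hle⟩, rfl⟩, ?_⟩
        rw [φ.right_vertex hle, ← hi0]
      obtain ⟨k, ⟨-, hk⟩, hk'⟩ := hmem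
      rw [E, φ.right_vertex hk] at hk'
      have hj0 := φ.vertex_inj hk'
      have := hM.2 φ.right ψ.right _ hle k hk (by
        rw [φ.right_vertex hle, φ.right_vertex hk, ← hi0, hj0, E])
      rwa [ψ.right_vertex hle, ψ.right_vertex hk, ← hi0, hj0] at this
    · have hmem : g (φ.vertex i) ∈ φ.left.verts := by
        rw [← hL.1 φ.left]
        exact ⟨_, ⟨i, ⟨Nat.zero_le _, h⟩, rfl⟩, rfl⟩
      obtain ⟨k, ⟨-, hk⟩, hk'⟩ := hmem
      rw [E] at hk'
      have hj0 : k = j := φ.vertex_inj hk'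
      subst hj0
      exact hL.2 φ.left ψ.left i h k hk E

theorem H_le_succ (n : ℕ) : H (n + 1) ≤ H (n + 2) := by
  rintro g ⟨g1, g2, -⟩
  refine ⟨g2.join g2 _, g2.join g1 _, fun φ => ?_⟩
  let ψ : Copy (segJ (n + 1) ++ conn (n + 1) :: (segJ (n + 1)).reverse) := φ
  exact ⟨g2.1 ψ.left, by
    have := g2.1 ψ.right
    rwa [Copy.right_verts] at this⟩

theorem H_mono {m n : ℕ} (hm : 1 ≤ m) (h : m ≤ n) : H m ≤ H n := by
  induction n, h using Nat.le_induction with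
  | base => exact le_rfl
  | succ k hk ih =>
    obtain ⟨k, rfl⟩ := Nat.exists_eq_add_of_le' (hm.trans hk)
    exact ih.trans (H_le_succ k)

/-- The group `H_∞`, the union of the groups `H_n`, `n ≥ 2`. -/
def Hinf : Subgroup Ghat where
  carrier := {g | ∃ n, 2 ≤ n ∧ g ∈ H n}
  one_mem' := ⟨2, le_rfl, one_mem _⟩
  mul_mem' := by
    rintro g h ⟨m, hm, hg⟩ ⟨n, hn, hh⟩
    exact ⟨max m n, hm.trans (le_max_left _ _),
      mul_mem (H_mono (by omega) (le_max_left m n) hg) (H_mono (by omega) (le_max_right m n) hh)⟩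
  inv_mem' := by
    rintro g ⟨m, hm, hg⟩
    exact ⟨m, hm, inv_mem hg⟩

/-- The normal closure in the whole group of the derived subgroup of `H_∞`. -/
def A : Subgroup Ghat := Subgroup.normalClosure ((⁅Hinf, Hinf⁆ : Subgroup Ghat) : Set Ghat)

/-- A group is virtually simple if it has a simple subgroup of finite index. -/
def VirtuallySimple (G : Type*) [Group G] : Prop :=
  ∃ N : Subgroup G, N.FiniteIndex ∧ IsSimpleGroup N

/-- The Klein four-group `{1, b, c, d}`. -/
abbrev Klein : Type := Multiplicative (ZMod 2 × ZMod 2)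

/-- The elements `b`, `c`, `d` of the Klein four-group; the labels `a₀`, `a₁`, `a₂` go to `1`. -/
def klein : Gen → Klein
  | b => Multiplicative.ofAdd (1, 0)
  | c => Multiplicative.ofAdd (0, 1)
  | d => Multiplicative.ofAdd (1, 1)
  | _ => 1

/-- The one-sided sequence `J_∞`, the limit of the `J_n` with respect to the embeddings of `J_n`
as the beginning of `J_{n+1}` (the segment `J_{v+1}` has more than `v` terms). -/
def Jinf (v : ℕ) : Finset Gen := (segJ (v + 1)).getD v ∅

/-- The action of the label `s` on the vertices of the graph `Ξ`: four copies `(J_∞, x)`, `x` in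
the Klein four-group, of the graph `J_∞` with vertices `0, 1, 2, …`, whose left ends `(0, x)` are
connected by edges labeled `y ∈ {b, c, d}` from `(0, x)` to `(0, x y)`. -/
def xiStep (s : Gen) : ℕ × Klein → ℕ × Klein
  | (0, x) => if s ∈ Jinf 0 then (1, x) else (0, x * klein s)
  | (v + 1, x) =>
      if s ∈ Jinf (v + 1) then (v + 2, x) else if s ∈ Jinf v then (v, x) else (v + 1, x)

end SegGroup

/-!
Each sequence of the subshift is, for every `n`, a concatenation of copies of `I_n` and `J_n`,
written alternately forwards and backwards and joined by single connectors (`exists_tiling`). These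
tilings form a hierarchy, and they are *recognizable*: `J_n` occurs only as a tile
(`Tiling.occ_segJ`), so that the copies of `I_n` and `J_n` partition the vertices if `n ≥ 2`. Hence
a permutation of the vertices that acts on all copies of `J_n` by one permutation `s` and on all
copies of `I_n` by one permutation `t`, as expressed by `Acts n g s t`, is determined by the pair
`(s, t)`, and such permutations are multiplied, inverted and conjugated like the pairs.

The first step (`evenOn_le_perms`) is that for `n ≥ 2` the group realizes every even permutation of
the copies of `J_n` that leaves the copies of `I_n` fixed. For `n = 2` this is a computation with
commutators of labels. In the inductive step one conjugates a three-cycle of the copies of `J_n`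
that moves their last vertex by a label of the connector, which carries that vertex across to the
neighboring tile. The commutator of the result with an element that acts on the copies of `I_n`
alone is a three-cycle of the copies of `J_{n+1} = J_n e_n I_n⁻¹` that leaves the copies of `I_{n+1}
= J_n e_n J_n⁻¹` fixed. Conjugation then yields all three-cycles. Since three-cycles are commutators
of three-cycles, `A` contains these even permutations as well, and every element that acts on the
tiles of some level `n ≥ 2` by even permutations lies in `A` (`mem_A_of_acts_even`).

*Simplicity.* A non-trivial element `g` moves some vertex of `J_n` to another one, in the same way
in all copies of `J_n`, for some `n`, because its action is local (`exists_moved`). Let `B` be a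
subgroup normalized by `A` that contains `g`. The copies of `J_{n+2}` contain three disjoint copies
of `J_n`, so `g` conjugates a three-cycle of the copies of `J_{n+2}` to another such cycle, and two
more commutators produce a three-cycle in `B`. Thus `B` contains all even permutations of the copies
of `J_m` for all large `m`, therefore the derived subgroup of `H_∞`; as this also applies to the
conjugates of `B`, it contains `A` (`A_le`).

*Finite index.* Commutators of labels act on the tiles of level 2 by even permutations, or else the
labels commute, possibly after one of them is modified by an element of `A`. So the quotient by `A`
is an abelian group generated by six involutions (`A_finiteIndex`).

*The action on `Ξ`.* A relation between the labels has to be shown to hold on `Ξ`. For a non-trivial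
character `χ` of the Klein four-group, map the copy `(J_∞, x)` to the right half of the sequence
`J_∞⁻¹ e J_∞` if `χ x` is trivial and to the left half otherwise, where `e` is the set of those
labels among `b`, `c`, `d` on which `χ` is non-trivial. This sequence belongs to the subshift
(`limSeq_mem`), the map commutes with the labels (`genPerm_xiVertex`), and the maps for two
different characters separate the vertices of `Ξ`. So the action of the group on the vertices of the
subshift determines an action on `Ξ` (`exists_xiPerm`). Elements of `H_∞` preserve arbitrarily long
beginnings of the halves of these sequences, which makes the cocycle trivial on them.
-/

namespace SegGroup
open Gen
open scoped commutatorElement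

/-! ### Three-cycles and even permutations of initial segments of `ℕ` -/

/-- The three-cycle `a ↦ b ↦ c ↦ a`. -/
def c3 {α : Type*} [DecidableEq α] (a b c : α) : Equiv.Perm α :=
  Equiv.swap a b * Equiv.swap b c

section c3
variable {α : Type*} [DecidableEq α] {a b c d x y z : α}

theorem c3_apply_left (h1 : a ≠ b) (h2 : a ≠ c) : c3 a b c a = b := by
  simp [c3, Equiv.swap_apply_of_ne_of_ne h1 h2]

theorem c3_apply_mid (h1 : a ≠ c) (h2 : b ≠ c) : c3 a b c b = c := by
  simp [c3, Equiv.swap_apply_of_ne_of_ne h1.symm h2.symm]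

theorem c3_apply_right : c3 a b c c = a := by
  simp [c3]

theorem c3_apply_of_ne (h1 : x ≠ a) (h2 : x ≠ b) (h3 : x ≠ c) : c3 a b c x = x := by
  simp [c3, Equiv.swap_apply_of_ne_of_ne h2 h3, Equiv.swap_apply_of_ne_of_ne h1 h2]

theorem c3_conj (g : Equiv.Perm α) (a b c : α) :
    g * c3 a b c * g⁻¹ = c3 (g a) (g b) (g c) := by
  simp only [c3, Equiv.swap_apply_apply]
  group

theorem c3_inv (a b c : α) : (c3 a b c)⁻¹ = c3 c b a := by
  simp [c3, Equiv.swap_comm]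

theorem c3_rotate (h1 : a ≠ b) (h2 : a ≠ c) (h3 : b ≠ c) : c3 a b c = c3 b c a := by
  ext t
  by_cases ha : t = a
  · subst ha; rw [c3_apply_left h1 h2, c3_apply_right]
  by_cases hb : t = b
  · subst hb; rw [c3_apply_mid h2 h3, c3_apply_left h3 h1.symm]
  by_cases hc : t = c
  · subst hc; rw [c3_apply_right, c3_apply_mid h1.symm h2.symm]
  rw [c3_apply_of_ne ha hb hc, c3_apply_of_ne hb hc ha]

/-- The quotient of two three-cycles that differ in one point is a three-cycle. -/
theorem c3_mul_inv (hab : a ≠ b) (hax : a ≠ x) (hay : a ≠ y) (hbx : b ≠ x) (hby : b ≠ y)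
    (hxy : x ≠ y) : c3 a x y * (c3 b x y)⁻¹ = c3 a x b := by
  rw [c3_inv]
  ext t
  rw [Equiv.Perm.mul_apply]
  by_cases ha : t = a
  · subst ha; rw [c3_apply_of_ne hay hax hab, c3_apply_left hax hay, c3_apply_left hax hab]
  by_cases hb : t = b
  · subst hb; rw [c3_apply_right, c3_apply_right, c3_apply_right]
  by_cases hx : t = x
  · subst hx
    rw [c3_apply_mid hby.symm hbx.symm, c3_apply_of_ne hab.symm hbx hby,
      c3_apply_mid hab hbx.symm]
  by_cases hy : t = y
  · subst hy
    rw [c3_apply_left hxy.symm hby.symm, c3_apply_mid hay hxy, c3_apply_of_ne hay.symm hx hb]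
  rw [c3_apply_of_ne hy hx hb, c3_apply_of_ne ha hx hy, c3_apply_of_ne ha hx hb]

/-- The set `U` is full for the subgroup `W` if `W` contains all three-cycles on `U`. -/
def FullOn (W : Subgroup (Equiv.Perm α)) (U : Set α) : Prop :=
  ∀ a ∈ U, ∀ b ∈ U, ∀ c ∈ U, a ≠ b → a ≠ c → b ≠ c → c3 a b c ∈ W

/-- The three-cycles on `U` are generated by those that contain two given points `x`, `y`. -/
theorem fullOn_of_star {W : Subgroup (Equiv.Perm α)} {U : Set α} (hxy : x ≠ y)
    (h : ∀ z ∈ U, z ≠ x → z ≠ y → c3 x y z ∈ W) : FullOn W U := by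
  -- three-cycles through exactly one of the points `x`, `y`, and through none of them
  have hy : ∀ a ∈ U, ∀ b ∈ U, a ≠ x → a ≠ y → b ≠ x → b ≠ y → a ≠ b → c3 y a b ∈ W := by
    intro a ha b hb hax hay hbx hby hab
    have h1 := W.mul_mem (W.mul_mem (h a ha hax hay) (h b hb hbx hby))
      (W.inv_mem (h a ha hax hay))
    rwa [c3_conj, c3_apply_left hxy hax.symm, c3_apply_mid hax.symm hay.symm,
      c3_apply_of_ne hbx hby hab.symm] at h1
  have hx : ∀ a ∈ U, ∀ b ∈ U, a ≠ x → a ≠ y → b ≠ x → b ≠ y → a ≠ b → c3 x a b ∈ W := by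
    intro a ha b hb hax hay hbx hby hab
    have h1 := W.mul_mem (W.mul_mem (W.inv_mem (h a ha hax hay)) (h b hb hbx hby))
      (h a ha hax hay)
    have h2 := c3_conj (c3 x y a)⁻¹ x y b
    rw [inv_inv] at h2
    rw [h2, c3_inv, c3_apply_right, c3_apply_mid hax hxy.symm,
      c3_apply_of_ne hab.symm hby hbx] at h1
    have h3 := W.inv_mem h1
    rwa [c3_inv, c3_rotate hbx hab.symm hax.symm] at h3
  have h0 : ∀ a ∈ U, ∀ b ∈ U, ∀ c ∈ U, a ≠ x → a ≠ y → b ≠ x → b ≠ y → c ≠ x → c ≠ y →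
      a ≠ b → a ≠ c → b ≠ c → c3 a b c ∈ W := by
    intro a ha b hb c hc hax hay hbx hby hcx hcy hab hac hbc
    have h1 := W.mul_mem (W.mul_mem (h a ha hax hay) (hy b hb c hc hbx hby hcx hcy hbc))
      (W.inv_mem (h a ha hax hay))
    rwa [c3_conj, c3_apply_mid hax.symm hay.symm, c3_apply_of_ne hbx hby hab.symm,
      c3_apply_of_ne hcx hcy hac.symm] at h1
  have hyx : ∀ z ∈ U, z ≠ x → z ≠ y → c3 y x z ∈ W := by
    intro z hz hzx hzy
    have := W.inv_mem (h z hz hzx hzy)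
    rwa [c3_inv, c3_rotate hzy hzx hxy.symm] at this
  intro a ha b hb c hc hab hac hbc
  by_cases hax : a = x
  · subst hax
    by_cases hby : b = y
    · subst hby; exact h c hc hac.symm hbc.symm
    by_cases hcy : c = y
    · subst hcy
      rw [c3_rotate hab hac hbc, c3_rotate hbc hab.symm hac.symm]
      exact hyx b hb hab.symm hbc
    exact hx b hb c hc hab.symm hby hac.symm hcy hbc
  by_cases hay : a = y
  · subst hay
    by_cases hbx : b = x
    · subst hbx; exact hyx c hc hbc.symm hac.symm
    by_cases hcx : c = x
    · subst hcx
      rw [c3_rotate hab hac hbc, c3_rotate hbc hab.symm hac.symm]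
      exact h b hb hbx hab.symm
    exact hy b hb c hc hbx hab.symm hcx hac.symm hbc
  by_cases hbx : b = x
  · subst hbx
    rw [c3_rotate hab hac hbc]
    by_cases hcy : c = y
    · subst hcy; exact h a ha hab hac
    exact hx c hc a ha hbc.symm hcy hab hay hac.symm
  by_cases hby : b = y
  · subst hby
    rw [c3_rotate hab hac hbc]
    by_cases hcx : c = x
    · subst hcx; exact hyx a ha hac hab
    exact hy c hc a ha hcx hbc.symm hax hab hac.symm
  by_cases hcx : c = x
  · subst hcx
    rw [c3_rotate hab hac hbc, c3_rotate hbc hab.symm hac.symm]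
    exact hx a ha b hb hac hay hbx hby hab
  by_cases hcy : c = y
  · subst hcy
    rw [c3_rotate hab hac hbc, c3_rotate hbc hab.symm hac.symm]
    exact hy a ha b hb hax hac hbx hby hab
  exact h0 a ha b hb c hc hax hay hbx hby hcx hcy hab hac hbc

end c3

/-- The permutations of `ℕ` supported on `{0, …, N - 1}`. -/
def symOn (N : ℕ) : Subgroup (Equiv.Perm ℕ) where
  carrier := {s | ∀ i, N ≤ i → s i = i}
  one_mem' := fun _ _ => rfl
  mul_mem' := fun {s t} hs ht i hi => by rw [Equiv.Perm.mul_apply, ht i hi, hs i hi]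
  inv_mem' := fun {s} hs i hi => by rw [Equiv.Perm.inv_eq_iff_eq, hs i hi]

theorem symOn_lt {N : ℕ} {s : Equiv.Perm ℕ} (hs : s ∈ symOn N) {i : ℕ} (hi : i < N) :
    s i < N := by
  by_contra h
  have h1 := hs _ (not_lt.1 h)
  have := s.injective h1
  omega

theorem symOn_mono {M N : ℕ} (h : M ≤ N) : symOn M ≤ symOn N :=
  fun _ hs i hi => hs i (h.trans hi)

theorem swap_mem_symOn {N a b : ℕ} (ha : a < N) (hb : b < N) : Equiv.swap a b ∈ symOn N :=
  fun i hi => Equiv.swap_apply_of_ne_of_ne (by omega) (by omega)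

theorem c3_mem_symOn {N a b c : ℕ} (ha : a < N) (hb : b < N) (hc : c < N) :
    c3 a b c ∈ symOn N :=
  mul_mem (swap_mem_symOn ha hb) (swap_mem_symOn hb hc)

/-- The even permutations of `ℕ` supported on `{0, …, N - 1}`, as the group generated by
the three-cycles. -/
def evenOn (N : ℕ) : Subgroup (Equiv.Perm ℕ) :=
  Subgroup.closure {s | ∃ a b c, a < N ∧ b < N ∧ c < N ∧ a ≠ b ∧ a ≠ c ∧ b ≠ c ∧ s = c3 a b c}

theorem c3_mem_evenOn {N a b c : ℕ} (ha : a < N) (hb : b < N) (hc : c < N) (hab : a ≠ b)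
    (hac : a ≠ c) (hbc : b ≠ c) : c3 a b c ∈ evenOn N :=
  Subgroup.subset_closure ⟨a, b, c, ha, hb, hc, hab, hac, hbc, rfl⟩

theorem evenOn_le_of_fullOn {N : ℕ} {W : Subgroup (Equiv.Perm ℕ)} (h : FullOn W (Set.Iio N)) :
    evenOn N ≤ W := by
  rw [evenOn, Subgroup.closure_le]
  rintro _ ⟨a, b, c, ha, hb, hc, hab, hac, hbc, rfl⟩
  exact h a ha b hb c hc hab hac hbc

theorem evenOn_le_symOn (N : ℕ) : evenOn N ≤ symOn N := by
  rw [evenOn, Subgroup.closure_le]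
  rintro _ ⟨a, b, c, ha, hb, hc, -, -, -, rfl⟩
  exact c3_mem_symOn ha hb hc

theorem evenOn_mono {M N : ℕ} (h : M ≤ N) : evenOn M ≤ evenOn N := by
  rw [evenOn, Subgroup.closure_le]
  rintro _ ⟨a, b, c, ha, hb, hc, hab, hac, hbc, rfl⟩
  exact c3_mem_evenOn (ha.trans_le h) (hb.trans_le h) (hc.trans_le h) hab hac hbc

theorem conj_mem_evenOn {N : ℕ} {p s : Equiv.Perm ℕ} (hp : p ∈ symOn N) (hs : s ∈ evenOn N) :
    p * s * p⁻¹ ∈ evenOn N := by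
  have : evenOn N ≤ (evenOn N).comap (MulAut.conj p).toMonoidHom := by
    conv_lhs => rw [evenOn]
    rw [Subgroup.closure_le]
    rintro _ ⟨a, b, c, ha, hb, hc, hab, hac, hbc, rfl⟩
    simp only [Subgroup.coe_comap, Set.mem_preimage, MulEquiv.toMonoidHom_eq_coe,
      MonoidHom.coe_coe, MulAut.conj_apply, SetLike.mem_coe]
    rw [c3_conj]
    exact c3_mem_evenOn (symOn_lt hp ha) (symOn_lt hp hb) (symOn_lt hp hc)
      (p.injective.ne hab) (p.injective.ne hac) (p.injective.ne hbc)
  exact this hs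

/-- Even permutations in the sense of the sign are generated by three-cycles. -/
theorem ofSubtype_mem_evenOn {N : ℕ} {s : Equiv.Perm {i // i ∈ Finset.range N}}
    (hs : s ∈ alternatingGroup {i // i ∈ Finset.range N}) : Equiv.Perm.ofSubtype s ∈ evenOn N := by
  rw [← Equiv.Perm.closure_three_cycles_eq_alternating] at hs
  have : Subgroup.closure {σ : Equiv.Perm {i // i ∈ Finset.range N} | σ.IsThreeCycle} ≤
      (evenOn N).comap Equiv.Perm.ofSubtype := by
    rw [Subgroup.closure_le]
    intro σ hσ
    have hσ : σ.IsThreeCycle := hσ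
    obtain ⟨a, ha⟩ : σ.support.Nonempty := Finset.card_pos.1 (by rw [hσ.card_support]; norm_num)
    have hnd := hσ.nodup_iff_mem_support.2 ha
    rw [hσ.eq_swap_mul_swap_iff_mem_support.2 ha]
    simp only [List.nodup_cons, List.mem_cons, List.not_mem_nil, or_false, not_or, Subtype.ext_iff]
      at hnd
    change Equiv.Perm.ofSubtype _ ∈ evenOn N
    rw [map_mul, Equiv.Perm.ofSubtype_swap_eq, Equiv.Perm.ofSubtype_swap_eq]
    exact c3_mem_evenOn (Finset.mem_range.1 a.2) (Finset.mem_range.1 (σ a).2)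
      (Finset.mem_range.1 (σ (σ a)).2) hnd.1.1 hnd.1.2 hnd.2.1
  exact this hs

theorem exists_ofSubtype {N : ℕ} {s : Equiv.Perm ℕ} (hs : s ∈ symOn N) :
    ∃ e : Equiv.Perm {i // i ∈ Finset.range N}, Equiv.Perm.ofSubtype e = s := by
  refine ⟨s.subtypePerm fun i => ⟨fun h => ?_, fun h => ?_⟩,
    Equiv.Perm.ofSubtype_subtypePerm _ fun i hi => ?_⟩
  · have := symOn_lt (inv_mem hs) (Finset.mem_range.1 h)
    simpa using this
  · exact Finset.mem_range.2 (symOn_lt hs (Finset.mem_range.1 h))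
  · by_contra h
    exact hi (hs i (by simpa using h))

theorem commutator_mem_evenOn {N : ℕ} {s t : Equiv.Perm ℕ} (hs : s ∈ symOn N)
    (ht : t ∈ symOn N) : s * t * s⁻¹ * t⁻¹ ∈ evenOn N := by
  obtain ⟨s, rfl⟩ := exists_ofSubtype hs
  obtain ⟨t, rfl⟩ := exists_ofSubtype ht
  rw [← map_inv, ← map_inv, ← map_mul, ← map_mul, ← map_mul]
  apply ofSubtype_mem_evenOn
  rw [Equiv.Perm.mem_alternatingGroup]
  simp only [map_mul, map_inv]
  rw [mul_right_comm (Equiv.Perm.sign s)]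
  simp

theorem exists_notMem_four {N : ℕ} (hN : 5 ≤ N) (a b c d : ℕ) :
    ∃ w < N, w ≠ a ∧ w ≠ b ∧ w ≠ c ∧ w ≠ d := by
  obtain ⟨w, hw, hwn⟩ : ∃ w ∈ Finset.range N, w ∉ ({a, b, c, d} : Finset ℕ) := by
    apply Finset.exists_mem_notMem_of_card_lt_card
    have := Finset.card_le_four (a := a) (b := b) (c := c) (d := d)
    rw [Finset.card_range]
    omega
  simp only [Finset.mem_insert, Finset.mem_singleton, not_or] at hwn
  exact ⟨w, Finset.mem_range.1 hw, hwn⟩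

/-- A subgroup that is normalized by the even permutations of at least five points contains
all of them as soon as it contains one three-cycle. -/
theorem evenOn_le_of_c3_mem {N : ℕ} (hN : 5 ≤ N) {W : Subgroup (Equiv.Perm ℕ)}
    (hW : ∀ e ∈ evenOn N, ∀ s ∈ W, e * s * e⁻¹ ∈ W) {a b c : ℕ} (hc : c < N)
    (hab : a ≠ b) (hac : a ≠ c) (hbc : b ≠ c) (h : c3 a b c ∈ W) :
    evenOn N ≤ W := by
  refine evenOn_le_of_fullOn (fullOn_of_star hab fun z hz hza hzb => ?_)
  by_cases hzc : z = c
  · rwa [hzc]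
  obtain ⟨w, hw, hwa, hwb, hwc, hwz⟩ := exists_notMem_four hN a b c z
  have := hW _ (c3_mem_evenOn hc hz hw (Ne.symm hzc) (Ne.symm hwc)
    (Ne.symm hwz)) _ h
  rwa [c3_conj, c3_apply_of_ne hac (Ne.symm hza) (Ne.symm hwa),
    c3_apply_of_ne hbc (Ne.symm hzb) (Ne.symm hwb), c3_apply_left (Ne.symm hzc) (Ne.symm hwc)]
    at this

/-! ### The hierarchy of tilings of the sequences of the subshift -/

/-- The number of vertices of the segments `I_n`, `J_n`, `n ≥ 1`. -/
def nv (n : ℕ) : ℕ := 2 ^ (n + 1)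

theorem nv_succ (n : ℕ) : nv (n + 1) = 2 * nv n := by
  simp [nv, pow_succ]; ring

theorem nv_pos (n : ℕ) : 0 < nv n := by simp [nv]

theorem four_le_nv {n : ℕ} (hn : 1 ≤ n) : 4 ≤ nv n := by
  obtain ⟨n, rfl⟩ := Nat.exists_eq_add_of_le' hn
  rw [nv_succ, nv, pow_succ]
  have := Nat.two_pow_pos n
  omega

theorem eight_le_nv {n : ℕ} (hn : 2 ≤ n) : 8 ≤ nv n := by
  obtain ⟨n, rfl⟩ := Nat.exists_eq_add_of_le' hn
  have := four_le_nv (n := n + 1) (by omega)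
  rw [nv_succ]
  omega

theorem lt_nv (n : ℕ) : n < nv n := by
  have := Nat.lt_two_pow_self (n := n + 1)
  rw [nv]; omega

theorem nv_mono {m n : ℕ} (h : m ≤ n) : nv m ≤ nv n :=
  Nat.pow_le_pow_right (by norm_num) (by omega)

theorem segI_succ (n : ℕ) :
    segI (n + 2) = segJ (n + 1) ++ conn (n + 1) :: (segJ (n + 1)).reverse := rfl

theorem segJ_succ (n : ℕ) :
    segJ (n + 2) = segJ (n + 1) ++ conn (n + 1) :: (segI (n + 1)).reverse := rfl

theorem seg_length (n : ℕ) :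
    (segI (n + 1)).length + 1 = nv (n + 1) ∧ (segJ (n + 1)).length + 1 = nv (n + 1) := by
  induction n with
  | zero => exact ⟨rfl, rfl⟩
  | succ n ih =>
    rw [nv_succ, segI_succ, segJ_succ]
    simp only [List.length_append, List.length_cons, List.length_reverse]
    omega

theorem segI_length {n : ℕ} (hn : 1 ≤ n) : (segI n).length + 1 = nv n := by
  obtain ⟨n, rfl⟩ := Nat.exists_eq_add_of_le' hn
  exact (seg_length n).1

theorem segJ_length {n : ℕ} (hn : 1 ≤ n) : (segJ n).length + 1 = nv n := by
  obtain ⟨n, rfl⟩ := Nat.exists_eq_add_of_le' hn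
  exact (seg_length n).2

theorem segI_ne_segJ (n : ℕ) : segI (n + 1) ≠ segJ (n + 1) := by
  induction n with
  | zero => simp [segI, segJ, segs]
  | succ n ih =>
    rw [segI_succ, segJ_succ]
    intro h
    have := List.append_cancel_left h
    simp only [List.cons.injEq, List.reverse_inj, true_and] at this
    exact ih this.symm

theorem segI_reverse (n : ℕ) : (segI (n + 2)).reverse = segI (n + 2) := by
  simp [segI_succ]

theorem segJ_reverse_ne (n : ℕ) : (segJ (n + 2)).reverse ≠ segJ (n + 2) := by
  rw [segJ_succ]
  intro h
  simp only [List.reverse_append, List.reverse_cons, List.reverse_reverse, List.append_assoc,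
    List.singleton_append] at h
  have := List.append_inj_left h (by have := seg_length n; omega)
  exact segI_ne_segJ n this

/-- `X` is one of the two segments `I_n`, `J_n`. -/
def IsSeg (n : ℕ) (X : List (Finset Gen)) : Prop := X = segI n ∨ X = segJ n

theorem IsSeg.length {n : ℕ} {X : List (Finset Gen)} (h : IsSeg n X) (hn : 1 ≤ n) :
    X.length + 1 = nv n := by
  rcases h with rfl | rfl
  · exact segI_length hn
  · exact segJ_length hn

/-- Both segments of level `n + 1` are of the form `J_n e_n X⁻¹` with `X` of level `n`. -/
theorem IsSeg.exists_eq {n : ℕ} {X : List (Finset Gen)} (h : IsSeg (n + 2) X) :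
    ∃ Y, IsSeg (n + 1) Y ∧ X = segJ (n + 1) ++ conn (n + 1) :: Y.reverse := by
  rcases h with rfl | rfl
  · exact ⟨_, Or.inr rfl, rfl⟩
  · exact ⟨_, Or.inl rfl, rfl⟩

/-- The segment `X` is written in `w`, beginning at the vertex `s`, in the direction `ε`. -/
def Occ (w : ℤ → Finset Gen) (X : List (Finset Gen)) (s : ℤ) (ε : ℤˣ) : Prop :=
  ∀ (i : ℕ) (hi : i < X.length), w (min (s + ε * (i : ℤ)) (s + ε * ((i : ℤ) + 1))) = X[i]

theorem Copy.occ {X : List (Finset Gen)} (φ : Copy X) : Occ φ.w.1 X φ.start φ.sign := φ.label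

theorem occ_one_iff {w : ℤ → Finset Gen} {X : List (Finset Gen)} {s : ℤ} :
    Occ w X s 1 ↔ ∀ (i : ℕ) (hi : i < X.length), w (s + i) = X[i] := by
  have : ∀ i : ℕ, min (s + ((1 : ℤˣ) : ℤ) * (i : ℤ)) (s + ((1 : ℤˣ) : ℤ) * ((i : ℤ) + 1)) = s + i := by
    intro i; rw [Units.val_one]; omega
  simp only [Occ, this]

theorem occ_neg_one_iff {w : ℤ → Finset Gen} {X : List (Finset Gen)} {s : ℤ} :
    Occ w X s (-1) ↔ ∀ (i : ℕ) (hi : i < X.length), w (s - 1 - i) = X[i] := by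
  have : ∀ i : ℕ, min (s + ((-1 : ℤˣ) : ℤ) * (i : ℤ)) (s + ((-1 : ℤˣ) : ℤ) * ((i : ℤ) + 1))
      = s - 1 - i := by
    intro i; rw [Units.val_neg, Units.val_one]; omega
  simp only [Occ, this]

theorem Occ.left {w : ℤ → Finset Gen} {L M : List (Finset Gen)} {e : Finset Gen} {s : ℤ} {ε : ℤˣ}
    (h : Occ w (L ++ e :: M) s ε) : Occ w L s ε := by
  intro i hi
  rw [h i (by simp; omega), List.getElem_append_left hi]

theorem Occ.mid {w : ℤ → Finset Gen} {L M : List (Finset Gen)} {e : Finset Gen} {s : ℤ} {ε : ℤˣ}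
    (h : Occ w (L ++ e :: M) s ε) :
    w (min (s + ε * (L.length : ℤ)) (s + ε * ((L.length : ℤ) + 1))) = e := by
  rw [h L.length (by simp)]
  simp

theorem Occ.reverse {w : ℤ → Finset Gen} {X : List (Finset Gen)} {s : ℤ} {ε : ℤˣ}
    (h : Occ w X s ε) : Occ w X.reverse (s + ε * (X.length : ℤ)) (-ε) := by
  intro i hi
  rw [List.length_reverse] at hi
  rw [List.getElem_reverse, ← h (X.length - 1 - i) (by omega), min_comm]
  have e3 : ((X.length - 1 - i : ℕ) : ℤ) = (X.length : ℤ) - 1 - i := by omega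
  rw [e3, Units.val_neg]
  congr 2 <;> ring

theorem Occ.right {w : ℤ → Finset Gen} {L M : List (Finset Gen)} {e : Finset Gen} {s : ℤ} {ε : ℤˣ}
    (h : Occ w (L ++ e :: M.reverse) s ε) :
    Occ w M (s + ε * ((L.length : ℤ) + 1 + M.length)) (-ε) := by
  have := h.reverse
  simp only [List.reverse_append, List.reverse_cons, List.reverse_reverse, List.append_assoc,
    List.singleton_append, List.length_append, List.length_cons, List.length_reverse] at this
  have := this.left
  convert this using 2
  push_cast
  ring

theorem Occ.eq {w : ℤ → Finset Gen} {X Y : List (Finset Gen)} {s : ℤ} {ε : ℤˣ}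
    (hX : Occ w X s ε) (hY : Occ w Y s ε) (h : X.length = Y.length) : X = Y :=
  List.ext_getElem h fun i h1 h2 => by rw [← hX i h1, ← hY i h2]

/-- The first vertex of the tiles in direction `ε`: those in the positive direction begin at `r`
modulo the period, those in the negative direction at `r - 1`. -/
def base (r : ℤ) (ε : ℤˣ) : ℤ := if ε = 1 then r else r - 1

@[simp] theorem base_one (r : ℤ) : base r 1 = r := if_pos rfl

@[simp] theorem base_neg_one (r : ℤ) : base r (-1) = r - 1 := if_neg (by decide)

/-- The sequence `w` is tiled by copies of `I_n`, `J_n`, written alternately in the positive and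
the negative direction and separated by connectors; `r` is the first vertex of a tile that is
written in the positive direction. -/
structure Tiling (n : ℕ) (w : ℤ → Finset Gen) (r : ℤ) : Prop where
  tile : ∀ (ε : ℤˣ) (k : ℤ), ∃ X, IsSeg n X ∧ Occ w X (base r ε + 2 * nv n * k) ε
  conn : ∀ k : ℤ, ∃ m, w (r - 1 + nv n * k) = conn m

theorem Tiling.down {n : ℕ} {w : ℤ → Finset Gen} {r : ℤ} (h : Tiling (n + 2) w r) :
    Tiling (n + 1) w r := by
  have hN : (nv (n + 2) : ℤ) = 2 * nv (n + 1) := by rw [nv_succ]; push_cast; rfl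
  have hJ : ((segJ (n + 1)).length : ℤ) = nv (n + 1) - 1 := by
    have := (seg_length n).2; omega
  refine ⟨fun ε k => ?_, fun k => ?_⟩
  · rcases Int.even_or_odd' k with ⟨k, rfl | rfl⟩
    · obtain ⟨X, hX, hocc⟩ := h.tile ε k
      obtain ⟨Y, -, rfl⟩ := hX.exists_eq
      refine ⟨_, Or.inr rfl, ?_⟩
      convert hocc.left using 1
      rw [hN]; ring
    · obtain ⟨X, hX, hocc⟩ := h.tile (-ε) (if ε = 1 then k + 1 else k)
      obtain ⟨Y, hY, rfl⟩ := hX.exists_eq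
      refine ⟨Y, hY, ?_⟩
      have hY' : (Y.length : ℤ) = nv (n + 1) - 1 := by
        have := hY.length (by omega); omega
      convert hocc.right using 1
      · rw [hJ, hY', hN]
        rcases Int.units_eq_one_or ε with rfl | rfl
        · simp; ring
        · simp; ring
      · simp
  · rcases Int.even_or_odd' k with ⟨k, rfl | rfl⟩
    · obtain ⟨m, hm⟩ := h.conn k
      refine ⟨m, ?_⟩
      rw [← hm, hN]
      congr 1; ring
    · rcases Int.even_or_odd' k with ⟨k, rfl | rfl⟩
      · obtain ⟨X, hX, hocc⟩ := h.tile 1 k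
        obtain ⟨Y, hY, rfl⟩ := hX.exists_eq
        refine ⟨n + 1, ?_⟩
        rw [← hocc.mid, hJ, hN]
        congr 1
        rw [base_one, Units.val_one, min_eq_left (by omega)]
        ring
      · obtain ⟨X, hX, hocc⟩ := h.tile (-1) (k + 1)
        obtain ⟨Y, hY, rfl⟩ := hX.exists_eq
        refine ⟨n + 1, ?_⟩
        rw [← hocc.mid, hJ, hN]
        congr 1
        rw [base_neg_one, Units.val_neg, Units.val_one, min_eq_right (by omega)]
        ring

theorem Tiling.of_le {m n : ℕ} {w : ℤ → Finset Gen} {r : ℤ} (hn : 1 ≤ n) (hnm : n ≤ m)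
    (h : Tiling m w r) : Tiling n w r := by
  induction m, hnm using Nat.le_induction with
  | base => exact h
  | succ m hm ih =>
    obtain ⟨m, rfl⟩ := Nat.exists_eq_add_of_le' (hn.trans hm)
    exact ih h.down

theorem Tiling.congr {n : ℕ} {w : ℤ → Finset Gen} {r r' : ℤ} (h : Tiling n w r) {q : ℤ}
    (hr : r' = r + 2 * nv n * q) : Tiling n w r' := by
  subst hr
  refine ⟨fun ε k => ?_, fun k => ?_⟩
  · obtain ⟨X, hX, hocc⟩ := h.tile ε (q + k)
    refine ⟨X, hX, ?_⟩
    convert hocc using 1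
    rcases Int.units_eq_one_or ε with rfl | rfl <;> simp <;> ring
  · obtain ⟨m, hm⟩ := h.conn (2 * q + k)
    refine ⟨m, ?_⟩
    rw [← hm]; congr 1; ring

/-- The periodic sequence `… X e X⁻¹ e X e X⁻¹ e …`, with a copy of `X` that begins at `0`. -/
def perSeq (X : List (Finset Gen)) (e : Finset Gen) (k : ℤ) : Finset Gen :=
  let P : ℤ := X.length + 1
  let x := k % (2 * P)
  if x < P - 1 then X.getD x.toNat ∅
  else if x = P - 1 ∨ x = 2 * P - 1 then e else X.getD (2 * P - 2 - x).toNat ∅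

theorem tiling_perSeq {n : ℕ} (hn : 1 ≤ n) {X : List (Finset Gen)} (hX : IsSeg n X) :
    Tiling n (perSeq X (conn 0)) 0 := by
  have hP : (nv n : ℤ) = X.length + 1 := by have := hX.length hn; omega
  refine ⟨fun ε k => ⟨X, hX, ?_⟩, fun k => ⟨0, ?_⟩⟩
  · rcases Int.units_eq_one_or ε with rfl | rfl
    · rw [occ_one_iff]
      intro i hi
      have : (base 0 1 + 2 * (nv n : ℤ) * k + i) % (2 * ((X.length : ℤ) + 1)) = i := by
        rw [base_one, hP, zero_add, add_comm, Int.add_mul_emod_self_left]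
        exact Int.emod_eq_of_lt (by omega) (by omega)
      simp only [perSeq, this]
      rw [if_pos (by omega)]
      simp [hi]
    · rw [occ_neg_one_iff]
      intro i hi
      have : (base 0 (-1) + 2 * (nv n : ℤ) * k - 1 - i) % (2 * ((X.length : ℤ) + 1))
          = 2 * ((X.length : ℤ) + 1) - 2 - i := by
        have e : base 0 (-1) + 2 * (nv n : ℤ) * k - 1 - i
          = (2 * ((X.length : ℤ) + 1) - 2 - i) + 2 * ((X.length : ℤ) + 1) * (k - 1) := by
          rw [base_neg_one, hP]; ring
        rw [e, Int.add_mul_emod_self_left]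
        exact Int.emod_eq_of_lt (by omega) (by omega)
      simp only [perSeq, this]
      rw [if_neg (by omega), if_neg (by omega)]
      have e2 : (2 * ((X.length : ℤ) + 1) - 2 - (2 * ((X.length : ℤ) + 1) - 2 - i)).toNat = i := by
        omega
      rw [e2]
      simp [hi]
  · rcases Int.even_or_odd' k with ⟨k, rfl | rfl⟩
    · have : (0 - 1 + (nv n : ℤ) * (2 * k)) % (2 * ((X.length : ℤ) + 1))
          = 2 * ((X.length : ℤ) + 1) - 1 := by
        have e : (0 - 1 + (nv n : ℤ) * (2 * k))
          = (2 * ((X.length : ℤ) + 1) - 1) + 2 * ((X.length : ℤ) + 1) * (k - 1) := by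
          rw [hP]; ring
        rw [e, Int.add_mul_emod_self_left]
        exact Int.emod_eq_of_lt (by omega) (by omega)
      simp only [perSeq, this]
      rw [if_neg (by omega), if_pos (by simp)]
    · have : (0 - 1 + (nv n : ℤ) * (2 * k + 1)) % (2 * ((X.length : ℤ) + 1))
          = ((X.length : ℤ) + 1) - 1 := by
        have e : (0 - 1 + (nv n : ℤ) * (2 * k + 1))
          = (((X.length : ℤ) + 1) - 1) + 2 * ((X.length : ℤ) + 1) * k := by
          rw [hP]; ring
        rw [e, Int.add_mul_emod_self_left]
        exact Int.emod_eq_of_lt (by omega) (by omega)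
      simp only [perSeq, this]
      rw [if_neg (by omega), if_pos (by simp)]

theorem perSeq_eq {X : List (Finset Gen)} {e : Finset Gen} {i : ℕ} (hi : i < X.length) :
    perSeq X e i = X[i] := by
  have : ((i : ℤ)) % (2 * ((X.length : ℤ) + 1)) = i := Int.emod_eq_of_lt (by omega) (by omega)
  simp only [perSeq, this]
  rw [if_pos (by omega)]
  simp [hi]

/-- Every finite window of a sequence of the subshift is contained in a sequence with a tiling. -/
theorem exists_tiling_window {w : ℤ → Finset Gen} (hw : w ∈ shiftS) {n : ℕ} (hn : 1 ≤ n)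
    (K : ℕ) : ∃ w' : ℤ → Finset Gen, ∃ r : ℤ, 0 ≤ r ∧ r < 2 * nv n ∧ Tiling n w' r ∧
      ∀ j : ℤ, -K ≤ j → j ≤ K → w j = w' j := by
  obtain ⟨L, ⟨m, hm, hL⟩, A, B, hAB⟩ := hw (-K) (2 * K + 1 + nv n)
  have hL' : IsSeg m L := hL
  have hlen : A.length + (2 * K + 1 + nv n) + B.length = L.length := by
    rw [← hAB]; simp [add_assoc]
  have hmn : n ≤ m := by
    by_contra h
    have := hL'.length hm
    have := nv_mono (not_le.1 h).le
    omega
  have hT := (tiling_perSeq hm hL').of_le hn hmn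
  set c : ℤ := A.length + K with hc
  have hT' : Tiling n (fun j => perSeq L (conn 0) (j + c)) (-c) := by
    refine ⟨fun ε k => ?_, fun k => ?_⟩
    · obtain ⟨X, hX, h⟩ := hT.tile ε k
      refine ⟨X, hX, fun i hi => ?_⟩
      simp only [← h i hi]
      congr 1
      rcases Int.units_eq_one_or ε with rfl | rfl <;> simp <;> omega
    · obtain ⟨m, h⟩ := hT.conn k
      refine ⟨m, ?_⟩
      simp only [← h]
      congr 1; ring
  have hpos : (0 : ℤ) < 2 * nv n := by have := nv_pos n; omega
  refine ⟨_, (-c) % (2 * nv n), Int.emod_nonneg _ hpos.ne', Int.emod_lt_of_pos _ hpos,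
    hT'.congr (q := -((-c) / (2 * nv n))) ?_, fun j h1 h2 => ?_⟩
  · have := Int.emod_add_mul_ediv (-c) (2 * nv n)
    linarith
  · obtain ⟨i, hi⟩ := Int.eq_ofNat_of_zero_le (a := j + K) (by omega)
    have e : j + c = ((A.length + i : ℕ) : ℤ) := by rw [hc]; push_cast; linarith
    simp only [e]
    rw [perSeq_eq (by omega)]
    subst hAB
    rw [List.getElem_append_left (by simp; omega), List.getElem_append_right (by omega)]
    simp only [List.getElem_ofFn, Nat.add_sub_cancel_left]
    congr 1
    omega

/-- The part of a tiling near the origin. -/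
def TilingNear (n : ℕ) (w : ℤ → Finset Gen) (r : ℤ) (K : ℕ) : Prop :=
  (∀ (ε : ℤˣ) (k : ℤ), |base r ε + 2 * nv n * k| ≤ K →
    ∃ X, IsSeg n X ∧ Occ w X (base r ε + 2 * nv n * k) ε) ∧
  ∀ k : ℤ, |r - 1 + nv n * k| ≤ K → ∃ m, w (r - 1 + nv n * k) = conn m

theorem exists_tilingNear {w : ℤ → Finset Gen} (hw : w ∈ shiftS) {n : ℕ} (hn : 1 ≤ n) (K : ℕ) :
    ∃ r ∈ Finset.Ico (0 : ℤ) (2 * nv n), TilingNear n w r K := by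
  obtain ⟨w', r, h0, h1, hT, hw'⟩ := exists_tiling_window hw hn (K + nv n)
  refine ⟨r, Finset.mem_Ico.2 ⟨h0, h1⟩, fun ε k hk => ?_, fun k hk => ?_⟩
  · obtain ⟨X, hX, h⟩ := hT.tile ε k
    refine ⟨X, hX, fun i hi => ?_⟩
    have := hX.length hn
    rw [abs_le] at hk
    rw [← h i hi]
    apply hw' <;> rcases Int.units_eq_one_or ε with rfl | rfl <;>
      simp only [base_one, base_neg_one, Units.val_neg, Units.val_one] at * <;> push_cast <;> omega
  · obtain ⟨m, h⟩ := hT.conn k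
    rw [abs_le] at hk
    exact ⟨m, by rw [← h]; apply hw' <;> push_cast <;> omega⟩

/-- All sequences of the subshift have tilings of all levels, by compactness. -/
theorem exists_tiling {w : ℤ → Finset Gen} (hw : w ∈ shiftS) {n : ℕ} (hn : 1 ≤ n) :
    ∃ r, Tiling n w r := by
  suffices ∃ r, ∀ K, TilingNear n w r K by
    obtain ⟨r, hr⟩ := this
    refine ⟨r, fun ε k => (hr (base r ε + 2 * nv n * k).natAbs).1 ε k ?_,
      fun k => (hr (r - 1 + nv n * k).natAbs).2 k ?_⟩ <;> rw [Int.natCast_natAbs]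
  by_contra! hcon
  choose K hK using hcon
  obtain ⟨r, hr, hT⟩ := exists_tilingNear hw hn ((Finset.Ico (0 : ℤ) (2 * nv n)).sup K)
  have hle := Finset.le_sup (f := K) hr
  exact hK r ⟨fun ε k hk => hT.1 ε k (hk.trans (by exact_mod_cast hle)),
    fun k hk => hT.2 k (hk.trans (by exact_mod_cast hle))⟩

/-- The labels of the edges in terms of the tiling of level `1`. -/
theorem Tiling.labels {w : ℤ → Finset Gen} {r : ℤ} (h : Tiling 1 w r) (k : ℤ) :
    w (r + 8 * k) = {a2} ∧ w (r + 8 * k + 1) = {b, c} ∧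
      (w (r + 8 * k + 2) = {a0} ∨ w (r + 8 * k + 2) = {a1}) ∧
      (∃ m, w (r + 8 * k + 3) = SegGroup.conn m) ∧
      (w (r + 8 * k + 4) = {a0} ∨ w (r + 8 * k + 4) = {a1}) ∧
      w (r + 8 * k + 5) = {b, c} ∧ w (r + 8 * k + 6) = {a2} ∧
      ∃ m, w (r + 8 * k + 7) = SegGroup.conn m := by
  have hnv : (nv 1 : ℤ) = 4 := rfl
  have c1 := h.conn (2 * k + 1)
  have c2 := h.conn (2 * k + 2)
  obtain ⟨X, hX, h1⟩ := h.tile 1 k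
  obtain ⟨Y, hY, h2⟩ := h.tile (-1) (k + 1)
  have hX3 := hX.length le_rfl
  have hY3 := hY.length le_rfl
  rw [occ_one_iff] at h1
  rw [occ_neg_one_iff] at h2
  have e0 := h1 0 (by simp [nv] at hX3; omega)
  have e1 := h1 1 (by simp [nv] at hX3; omega)
  have e2 := h1 2 (by simp [nv] at hX3; omega)
  have f0 := h2 0 (by simp [nv] at hY3; omega)
  have f1 := h2 1 (by simp [nv] at hY3; omega)
  have f2 := h2 2 (by simp [nv] at hY3; omega)
  simp only [hnv, base_one, base_neg_one] at *
  refine ⟨?_, ?_, ?_, ?_, ?_, ?_, ?_, ?_⟩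
  · rw [show r + 8 * k = r + 2 * 4 * k + (0 : ℕ) by push_cast; ring, e0]
    rcases hX with rfl | rfl <;> rfl
  · rw [show r + 8 * k + 1 = r + 2 * 4 * k + (1 : ℕ) by push_cast; ring, e1]
    rcases hX with rfl | rfl <;> rfl
  · rw [show r + 8 * k + 2 = r + 2 * 4 * k + (2 : ℕ) by push_cast; ring, e2]
    rcases hX with rfl | rfl
    · exact Or.inl rfl
    · exact Or.inr rfl
  · rw [show r + 8 * k + 3 = r - 1 + 4 * (2 * k + 1) by ring]; exact c1
  · rw [show r + 8 * k + 4 = r - 1 + 2 * 4 * (k + 1) - 1 - (2 : ℕ) by push_cast; ring, f2]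
    rcases hY with rfl | rfl
    · exact Or.inl rfl
    · exact Or.inr rfl
  · rw [show r + 8 * k + 5 = r - 1 + 2 * 4 * (k + 1) - 1 - (1 : ℕ) by push_cast; ring, f1]
    rcases hY with rfl | rfl <;> rfl
  · rw [show r + 8 * k + 6 = r - 1 + 2 * 4 * (k + 1) - 1 - (0 : ℕ) by push_cast; ring, f0]
    rcases hY with rfl | rfl <;> rfl
  · rw [show r + 8 * k + 7 = r - 1 + 4 * (2 * k + 2) by ring]; exact c2

theorem conn_ne (m : ℕ) : conn m ≠ {a0} ∧ conn m ≠ {a1} ∧ conn m ≠ {a2} := by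
  unfold conn; split_ifs <;> decide

/-- The segment `J_n` occurs in a tiled sequence only as a tile. -/
theorem Tiling.occ_segJ {n : ℕ} {w : ℤ → Finset Gen} {r s : ℤ} {ε : ℤˣ} (h : Tiling (n + 1) w r)
    (hs : Occ w (segJ (n + 1)) s ε) : ∃ k, s = base r ε + 2 * nv (n + 1) * k := by
  induction n with
  | zero =>
    have hnv : (nv 1 : ℤ) = 4 := rfl
    have hl := h.labels ((s - r) / 8)
    have hl' := h.labels ((s - r) / 8 - 1)
    have hl'' := h.labels ((s - r) / 8 + 1)
    have hne : ({a2} : Finset Gen) ≠ {a1} ∧ ({a2} : Finset Gen) ≠ {b, c} ∧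
      ({a2} : Finset Gen) ≠ {a0} := by decide
    obtain ⟨q, hq⟩ : ∃ q, (s - r) / 8 = q := ⟨_, rfl⟩
    rw [hq] at hl hl' hl''
    obtain ⟨l0, l1, l2, ⟨m3, l3⟩, l4, l5, l6, m7, l7⟩ := hl
    obtain ⟨-, -, -, -, l4', l5', l6', m7', l7'⟩ := hl'
    obtain ⟨l0'', -⟩ := hl''
    have hx : s = r + 8 * q + 0 ∨ s = r + 8 * q + 1 ∨ s = r + 8 * q + 2 ∨ s = r + 8 * q + 3 ∨
      s = r + 8 * q + 4 ∨ s = r + 8 * q + 5 ∨ s = r + 8 * q + 6 ∨ s = r + 8 * q + 7 := by omega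
    have c3 := conn_ne m3
    have c7 := conn_ne m7
    have c7' := conn_ne m7'
    rcases Int.units_eq_one_or ε with rfl | rfl
    · refine ⟨q, ?_⟩
      rw [occ_one_iff] at hs
      have e0 : w (s + (0 : ℕ)) = {a2} := hs 0 (by simp [segJ, segs])
      have e2 : w (s + (2 : ℕ)) = {a1} := hs 2 (by simp [segJ, segs])
      simp only [zero_add, hnv, base_one, Nat.cast_zero, add_zero, Nat.cast_ofNat] at *
      rcases hx with rfl | rfl | rfl | rfl | rfl | rfl | rfl | rfl
      · ring
      · rw [e0] at l1; exact absurd l1 hne.2.1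
      · rw [e0] at l2; rcases l2 with l | l
        · exact absurd l hne.2.2
        · exact absurd l hne.1
      · rw [l3] at e0; exact absurd e0 c3.2.2
      · rw [e0] at l4; rcases l4 with l | l
        · exact absurd l hne.2.2
        · exact absurd l hne.1
      · rw [e0] at l5; exact absurd l5 hne.2.1
      · rw [show r + 8 * q + 6 + 2 = r + 8 * (q + 1) by ring, l0''] at e2
        exact absurd e2 hne.1
      · rw [l7] at e0; exact absurd e0 c7.2.2
    · refine ⟨q + 1, ?_⟩
      rw [occ_neg_one_iff] at hs
      have e0 : w (s - 1 - (0 : ℕ)) = {a2} := hs 0 (by simp [segJ, segs])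
      have e2 : w (s - 1 - (2 : ℕ)) = {a1} := hs 2 (by simp [segJ, segs])
      simp only [zero_add, hnv, base_neg_one, Nat.cast_zero, Nat.cast_ofNat, sub_zero] at *
      rcases hx with rfl | rfl | rfl | rfl | rfl | rfl | rfl | rfl
      · rw [show r + 8 * q + 0 - 1 = r + 8 * (q - 1) + 7 by ring, l7'] at e0
        exact absurd e0 c7'.2.2
      · rw [show r + 8 * q + 1 - 1 - 2 = r + 8 * (q - 1) + 6 by ring, l6'] at e2
        exact absurd e2 hne.1
      · rw [show r + 8 * q + 2 - 1 = r + 8 * q + 1 by ring] at e0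
        rw [e0] at l1; exact absurd l1 hne.2.1
      · rw [show r + 8 * q + 3 - 1 = r + 8 * q + 2 by ring] at e0
        rw [e0] at l2; rcases l2 with l | l
        · exact absurd l hne.2.2
        · exact absurd l hne.1
      · rw [show r + 8 * q + 4 - 1 = r + 8 * q + 3 by ring, l3] at e0
        exact absurd e0 c3.2.2
      · rw [show r + 8 * q + 5 - 1 = r + 8 * q + 4 by ring] at e0
        rw [e0] at l4; rcases l4 with l | l
        · exact absurd l hne.2.2
        · exact absurd l hne.1
      · rw [show r + 8 * q + 6 - 1 = r + 8 * q + 5 by ring] at e0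
        rw [e0] at l5; exact absurd l5 hne.2.1
      · ring
  | succ n ih =>
    have hN : (nv (n + 2) : ℤ) = 2 * nv (n + 1) := by rw [nv_succ]; push_cast; rfl
    have hJ : ((segJ (n + 1)).length : ℤ) = nv (n + 1) - 1 := by
      have := (seg_length n).2; omega
    have hI : ((segI (n + 1)).length : ℤ) = nv (n + 1) - 1 := by
      have := (seg_length n).1; omega
    have hlen : (segI (n + 1)).length = (segJ (n + 1)).length := by
      have := seg_length n; omega
    rw [segJ_succ] at hs
    obtain ⟨k, hk⟩ := ih h.down hs.left
    rcases Int.even_or_odd' k with ⟨k, rfl | rfl⟩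
    · exact ⟨k, by rw [hk, hN]; ring⟩
    · exfalso
      -- the tile of the next level that ends with the given copy of `J_n`
      obtain ⟨X, hX, hocc⟩ := h.tile (-ε) (if ε = 1 then k + 1 else k)
      have hstart : base r (-ε) + 2 * nv (n + 2) * (if ε = 1 then k + 1 else k)
          = s + ε * (2 * nv (n + 1) - 1) := by
        rw [hk, hN]
        rcases Int.units_eq_one_or ε with rfl | rfl
        · simp; ring
        · simp; ring
      rw [hstart] at hocc
      rcases hX with rfl | rfl
      · have h1 := hocc.left
        have h2 := hs.right
        rw [hJ, hI, show (nv (n + 1) : ℤ) - 1 + 1 + (nv (n + 1) - 1) = 2 * nv (n + 1) - 1 by ring]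
          at h2
        exact segI_ne_segJ n (h2.eq h1 hlen)
      · rw [segJ_succ] at hocc
        have h1 := hocc.right
        rw [hJ, hI, neg_neg, Units.val_neg, show s + ε * (2 * (nv (n + 1) : ℤ) - 1)
          + -ε * ((nv (n + 1) : ℤ) - 1 + 1 + (nv (n + 1) - 1)) = s by ring] at h1
        exact segI_ne_segJ n (h1.eq hs.left hlen)

theorem Tiling.occ_seg {n : ℕ} {w : ℤ → Finset Gen} {r s : ℤ} {ε : ℤˣ} (h : Tiling (n + 2) w r)
    {X : List (Finset Gen)} (hX : IsSeg (n + 2) X) (hs : Occ w X s ε) :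
    ∃ k, s = base r ε + nv (n + 2) * k := by
  obtain ⟨Y, -, rfl⟩ := hX.exists_eq
  obtain ⟨k, hk⟩ := h.down.occ_segJ hs.left
  exact ⟨k, by rw [hk, nv_succ (n + 1)]; push_cast; rfl⟩

/-- Every vertex belongs to a copy of `I_n` or `J_n`. -/
theorem exists_copy {n : ℕ} (hn : 1 ≤ n) (v : Vertex) :
    (∃ φ : Copy (segI n), ∃ i < nv n, φ.vertex i = v) ∨
      ∃ φ : Copy (segJ n), ∃ i < nv n, φ.vertex i = v := by
  obtain ⟨⟨w, hw⟩, x⟩ := v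
  obtain ⟨r, hr⟩ := exists_tiling hw hn
  have hpos : (0 : ℤ) < nv n := by exact_mod_cast nv_pos n
  obtain ⟨X, hX, φ, i, hi, hφ⟩ : ∃ X, IsSeg n X ∧ ∃ φ : Copy X, ∃ i < nv n,
      φ.vertex i = (⟨⟨w, hw⟩, x⟩ : Vertex) := by
    have h1 := Int.emod_add_mul_ediv (x - r) (nv n)
    have h2 := Int.emod_nonneg (x - r) hpos.ne'
    have h3 := Int.emod_lt_of_pos (x - r) hpos
    obtain ⟨j, hj⟩ := Int.eq_ofNat_of_zero_le h2
    rw [hj] at h1 h3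
    rcases Int.even_or_odd' ((x - r) / nv n) with ⟨k, hk | hk⟩
    · obtain ⟨X, hX, hocc⟩ := hr.tile 1 k
      refine ⟨X, hX, ⟨⟨w, hw⟩, _, 1, hocc⟩, j, by omega, ?_⟩
      simp only [Copy.vertex, base_one, Units.val_one]
      congr 1
      rw [hk] at h1
      linarith
    · obtain ⟨X, hX, hocc⟩ := hr.tile (-1) (k + 1)
      refine ⟨X, hX, ⟨⟨w, hw⟩, _, -1, hocc⟩, nv n - 1 - j, by omega, ?_⟩
      simp only [Copy.vertex, base_neg_one, Units.val_neg, Units.val_one]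
      congr 1
      rw [hk] at h1
      have : ((nv n - 1 - j : ℕ) : ℤ) = nv n - 1 - j := by omega
      rw [this]
      linarith
  rcases hX with rfl | rfl
  · exact Or.inl ⟨φ, i, hi, hφ⟩
  · exact Or.inr ⟨φ, i, hi, hφ⟩

/-- Two copies of segments of level `n ≥ 2` that have a common vertex coincide, up to the symmetry
of the palindrome `I_n`. -/
theorem copy_meet {n : ℕ} {X Y : List (Finset Gen)} (hX : IsSeg (n + 2) X)
    (hY : IsSeg (n + 2) Y) (φ : Copy X) (ψ : Copy Y) {i j : ℕ} (hi : i < nv (n + 2))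
    (hj : j < nv (n + 2)) (h : φ.vertex i = ψ.vertex j) :
    (X = Y ∧ i = j ∧ ∀ k, φ.vertex k = ψ.vertex k) ∨
      (X = segI (n + 2) ∧ Y = segI (n + 2) ∧ i + j + 1 = nv (n + 2) ∧
        ∀ k, k < nv (n + 2) → φ.vertex k = ψ.vertex (nv (n + 2) - 1 - k)) := by
  have hw : φ.w = ψ.w := congrArg Prod.fst h
  have hx : φ.start + φ.sign * (i : ℤ) = ψ.start + ψ.sign * (j : ℤ) := congrArg Prod.snd h
  obtain ⟨r, hr⟩ := exists_tiling φ.w.2 (n := n + 2) (by omega)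
  obtain ⟨k, hk⟩ := hr.occ_seg hX φ.occ
  have hψ := ψ.occ
  rw [← hw] at hψ
  obtain ⟨l, hl⟩ := hr.occ_seg hY hψ
  have hXl := hX.length (by omega)
  have hYl := hY.length (by omega)
  have hφ := φ.occ
  unfold Copy.vertex
  rw [hw] at *
  generalize φ.sign = ε at *
  generalize ψ.sign = δ at *
  generalize φ.start = s at *
  generalize ψ.start = t at *
  generalize hN : nv (n + 2) = N at *
  by_cases hεδ : ε = δ
  · subst hεδ
    left
    have hd : (N : ℤ) * (l - k) = ε * (i - j) := by
      have : (t : ℤ) - s = N * (l - k) := by rw [hk, hl]; ring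
      rw [← this]; linarith
    have hkl : l - k = 0 := by
      have hlt : |(N : ℤ) * (l - k)| < N := by
        rw [hd, abs_mul]
        have : |((ε : ℤˣ) : ℤ)| = 1 := by rcases Int.units_eq_one_or ε with rfl | rfl <;> simp
        rw [this, one_mul, abs_lt]
        omega
      rw [abs_mul, Nat.abs_cast] at hlt
      by_contra h0
      have := Int.one_le_abs h0
      nlinarith
    have hst : s = t := by rw [hk, hl, show l = k by omega]
    subst hst
    have hij : i = j := by
      rw [hkl, mul_zero] at hd
      have := (mul_eq_zero.1 hd.symm).resolve_left (Units.ne_zero ε)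
      omega
    exact ⟨hφ.eq hψ (by omega), hij, fun k => rfl⟩
  · right
    have hδ : δ = -ε := by
      rcases Int.units_eq_one_or ε with rfl | rfl <;> rcases Int.units_eq_one_or δ with rfl | rfl <;>
        first | rfl | exact absurd rfl hεδ
    subst hδ
    have hb : base r (-ε) = base r ε - ε := by
      rcases Int.units_eq_one_or ε with rfl | rfl <;> simp
    have hε2 : (ε : ℤ) * ε = 1 := by
      rcases Int.units_eq_one_or ε with rfl | rfl <;> simp
    have hd : (N : ℤ) * (ε * (l - k)) = i + j + 1 := by
      have h1 : (t : ℤ) - s = N * (l - k) - ε := by rw [hk, hl, hb]; ring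
      have h2 : (t : ℤ) - s = ε * (i + j) := by
        push_cast at hx
        linarith
      have : (ε : ℤ) * (N * (l - k)) = ε * (ε * (i + j) + ε) := by rw [← h2, h1]; ring
      calc (N : ℤ) * (ε * (l - k)) = ε * (N * (l - k)) := by ring
        _ = (ε * ε) * (i + j + 1) := by rw [this]; ring
        _ = _ := by rw [hε2, one_mul]
    have hq : ε * (l - k) = 1 := by
      generalize (ε : ℤ) * (l - k) = q at hd
      have h1 : 0 < q := by
        by_contra h0
        have : (N : ℤ) * q ≤ 0 := mul_nonpos_of_nonneg_of_nonpos (by omega) (by omega)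
        omega
      have h2 : q < 2 := by
        by_contra h0
        have : (N : ℤ) * 2 ≤ N * q := by gcongr; omega
        omega
      omega
    rw [hq, mul_one] at hd
    have hst : t = s + ε * (X.length : ℤ) := by
      have : (X.length : ℤ) = i + j := by omega
      rw [this]
      push_cast at hx
      linarith
    have hYX : X.reverse = Y := by
      have := hφ.reverse
      rw [← hst] at this
      exact this.eq hψ (by simp; omega)
    have hXI : X = segI (n + 2) ∧ Y = segI (n + 2) := by
      rcases hX with rfl | rfl <;> rcases hY with rfl | rfl
      · exact ⟨rfl, rfl⟩
      · rw [segI_reverse] at hYX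
        exact absurd hYX (segI_ne_segJ _)
      · rw [List.reverse_eq_iff, segI_reverse] at hYX
        exact absurd hYX.symm (segI_ne_segJ _)
      · exact absurd hYX (segJ_reverse_ne _)
    refine ⟨hXI.1, hXI.2, by omega, fun k hk => ?_⟩
    have : ((N - 1 - k : ℕ) : ℤ) = X.length - k := by omega
    rw [this, hst]
    congr 1
    push_cast
    ring

theorem copyJ_meet {n : ℕ} (hn : 2 ≤ n) (φ ψ : Copy (segJ n)) {i j : ℕ} (hi : i < nv n)
    (hj : j < nv n) (h : φ.vertex i = ψ.vertex j) : i = j := by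
  obtain ⟨n, rfl⟩ := Nat.exists_eq_add_of_le' hn
  rcases copy_meet (Or.inr rfl) (Or.inr rfl) φ ψ hi hj h with h | h
  · exact h.2.1
  · exact absurd h.1.symm (segI_ne_segJ _)

theorem copyIJ_meet {n : ℕ} (hn : 2 ≤ n) (φ : Copy (segI n)) (ψ : Copy (segJ n)) {i j : ℕ}
    (hi : i < nv n) (hj : j < nv n) : φ.vertex i ≠ ψ.vertex j := by
  obtain ⟨n, rfl⟩ := Nat.exists_eq_add_of_le' hn
  intro h
  rcases copy_meet (Or.inl rfl) (Or.inr rfl) φ ψ hi hj h with h | h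
  · exact absurd h.1 (segI_ne_segJ _)
  · exact absurd h.2.1.symm (segI_ne_segJ _)

theorem copyI_meet {n : ℕ} (hn : 2 ≤ n) (φ ψ : Copy (segI n)) {i j : ℕ} (hi : i < nv n)
    (hj : j < nv n) (h : φ.vertex i = ψ.vertex j) :
    (∀ k, k < nv n → φ.vertex k = ψ.vertex k) ∨
      ∀ k, k < nv n → φ.vertex k = ψ.vertex (nv n - 1 - k) := by
  obtain ⟨n, rfl⟩ := Nat.exists_eq_add_of_le' hn
  rcases copy_meet (Or.inl rfl) (Or.inl rfl) φ ψ hi hj h with h | h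
  · exact Or.inl fun k _ => h.2.2 k
  · exact Or.inr h.2.2.2

/-! ### The labels on copies of segments -/

/-- In the sequences of the subshift the sets `{a_i}` alternate with the connectors. -/
theorem label_alternate {w : ℤ → Finset Gen} (hw : w ∈ shiftS) (k : ℤ) :
    ((w k = {a0} ∨ w k = {a1} ∨ w k = {a2}) ∧ ∃ m, w (k + 1) = conn m) ∨
      ((∃ m, w k = conn m) ∧ (w (k + 1) = {a0} ∨ w (k + 1) = {a1} ∨ w (k + 1) = {a2})) := by
  obtain ⟨r, hr⟩ := exists_tiling hw le_rfl
  obtain ⟨q, hq⟩ : ∃ q, (k - r) / 8 = q := ⟨_, rfl⟩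
  obtain ⟨l0, l1, l2, l3, l4, l5, l6, l7⟩ := hr.labels q
  obtain ⟨l8, -⟩ := hr.labels (q + 1)
  have hbc : ({b, c} : Finset Gen) = conn 0 := rfl
  have hx : k = r + 8 * q ∨ k = r + 8 * q + 1 ∨ k = r + 8 * q + 2 ∨ k = r + 8 * q + 3 ∨
      k = r + 8 * q + 4 ∨ k = r + 8 * q + 5 ∨ k = r + 8 * q + 6 ∨ k = r + 8 * q + 7 := by omega
  rcases hx with rfl | rfl | rfl | rfl | rfl | rfl | rfl | rfl
  · exact Or.inl ⟨Or.inr (Or.inr l0), 0, l1.trans hbc⟩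
  · refine Or.inr ⟨⟨0, l1.trans hbc⟩, ?_⟩
    rw [show r + 8 * q + 1 + 1 = r + 8 * q + 2 by ring]; tauto
  · refine Or.inl ⟨by tauto, ?_⟩
    rwa [show r + 8 * q + 2 + 1 = r + 8 * q + 3 by ring]
  · refine Or.inr ⟨l3, ?_⟩
    rw [show r + 8 * q + 3 + 1 = r + 8 * q + 4 by ring]; tauto
  · refine Or.inl ⟨by tauto, 0, ?_⟩
    rw [show r + 8 * q + 4 + 1 = r + 8 * q + 5 by ring, l5, hbc]
  · refine Or.inr ⟨⟨0, l5.trans hbc⟩, ?_⟩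
    rw [show r + 8 * q + 5 + 1 = r + 8 * q + 6 by ring]; tauto
  · refine Or.inl ⟨by tauto, ?_⟩
    rwa [show r + 8 * q + 6 + 1 = r + 8 * q + 7 by ring]
  · refine Or.inr ⟨l7, ?_⟩
    rw [show r + 8 * q + 7 + 1 = r + 8 * (q + 1) by ring]; tauto

theorem step_eq {w : ℤ → Finset Gen} (hw : Admissible w) (h : Gen) (v : ℤ) (ε : ℤˣ) :
    step w h v = if h ∈ w (min v (v + ε)) then v + ε
      else if h ∈ w (min v (v - ε)) then v - ε else v := by
  rcases Int.units_eq_one_or ε with rfl | rfl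
  · rw [Units.val_one, min_eq_left (by omega), min_eq_right (by omega)]
    rfl
  · rw [Units.val_neg, Units.val_one, min_eq_right (by omega), min_eq_left (by omega)]
    have h1 := hw.2 (v - 1)
    rw [sub_add_cancel] at h1
    have h2 : h ∈ w v → h ∉ w (v - 1) := fun h3 h4 => Finset.disjoint_left.1 h1 h4 h3
    unfold step
    rw [← sub_eq_add_neg, sub_neg_eq_add]
    split_ifs <;> tauto

/-- The action of the label `h` on the vertices of the segment `X`, seen as a labeled chain. -/
def chainStep (X : List (Finset Gen)) (h : Gen) (i : ℕ) : ℕ :=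
  if h ∈ X.getD i ∅ then i + 1 else if 0 < i ∧ h ∈ X.getD (i - 1) ∅ then i - 1 else i

theorem Copy.genPerm_vertex {X : List (Finset Gen)} (φ : Copy X) (h : Gen) {i : ℕ} (h0 : 0 < i)
    (hi : i < X.length) : genPerm h (φ.vertex i) = φ.vertex (chainStep X h i) := by
  have e1 := φ.label i hi
  have e2 := φ.label (i - 1) (by omega)
  have hc : ((i - 1 : ℕ) : ℤ) = i - 1 := by omega
  change (φ.w, step φ.w.1 h (φ.start + φ.sign * (i : ℤ))) = _
  rw [step_eq (admissible_of_mem φ.w.2) h _ φ.sign]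
  have e1' : φ.w.1 (min (φ.start + φ.sign * (i : ℤ)) (φ.start + φ.sign * (i : ℤ) + φ.sign))
      = X.getD i ∅ := by
    rw [add_assoc, show (φ.sign : ℤ) * i + φ.sign = φ.sign * (i + 1) by ring, e1]
    simp [hi]
  have e2' : φ.w.1 (min (φ.start + φ.sign * (i : ℤ)) (φ.start + φ.sign * (i : ℤ) - φ.sign))
      = X.getD (i - 1) ∅ := by
    rw [min_comm, add_sub_assoc, show (φ.sign : ℤ) * i - φ.sign = φ.sign * ((i - 1 : ℕ) : ℤ) by
      rw [hc]; ring, show (φ.sign : ℤ) * i = φ.sign * (((i - 1 : ℕ) : ℤ) + 1) by rw [hc]; ring, e2]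
    simp [show i - 1 < X.length by omega]
  rw [e1', e2']
  unfold Copy.vertex chainStep
  split_ifs <;> simp_all <;> ring

/-- The labels `a_i` leave invariant the copies of a segment that begins and ends
with some `{a_i}`. -/
theorem Copy.genPerm_vertex_of_good {X : List (Finset Gen)} (φ : Copy X) (hX : Good X)
    (hX0 : X ≠ []) {h : Gen} (ha : h = a0 ∨ h = a1 ∨ h = a2) {i : ℕ} (hi : i ≤ X.length) :
    genPerm h (φ.vertex i) = φ.vertex (chainStep X h i) := by
  have hlen : 0 < X.length := List.length_pos_of_ne_nil hX0
  have hconn : ∀ m, h ∉ conn m := by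
    intro m
    unfold conn
    rcases ha with rfl | rfl | rfl <;> split_ifs <;> decide
  -- a connector is next to each `{a_i}`
  have halt : ∀ k, (φ.w.1 k = {a0} ∨ φ.w.1 k = {a1} ∨ φ.w.1 k = {a2}) →
      h ∉ φ.w.1 (k + 1) ∧ h ∉ φ.w.1 (k - 1) := by
    intro k hk
    have hne : ∀ m, φ.w.1 k ≠ conn m := by
      intro m hm
      have := conn_ne m
      rw [← hm] at this
      tauto
    constructor
    · rcases label_alternate φ.w.2 k with h1 | h1
      · obtain ⟨m, hm⟩ := h1.2; rw [hm]; exact hconn m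
      · obtain ⟨m, hm⟩ := h1.1; exact absurd hm (hne m)
    · rcases label_alternate φ.w.2 (k - 1) with h1 | h1
      · obtain ⟨m, hm⟩ := h1.2; rw [sub_add_cancel] at hm; exact absurd hm (hne m)
      · obtain ⟨m, hm⟩ := h1.1; rw [hm]; exact hconn m
  rcases Nat.eq_zero_or_pos i with rfl | h0
  · have e1 := φ.label 0 hlen
    have hA : X[0] = {a0} ∨ X[0] = {a1} ∨ X[0] = {a2} := hX.2.2.1 _ (by
      rw [List.head?_eq_getElem?]; simp [hlen])
    simp only [Nat.cast_zero, mul_zero, add_zero, zero_add, mul_one] at e1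
    change (φ.w, step φ.w.1 h (φ.start + φ.sign * ((0 : ℕ) : ℤ))) = _
    rw [step_eq (admissible_of_mem φ.w.2) h _ φ.sign]
    simp only [Nat.cast_zero, mul_zero, add_zero]
    have hn : h ∉ φ.w.1 (min φ.start (φ.start - φ.sign)) := by
      have := halt (min φ.start (φ.start + φ.sign)) (by rwa [e1])
      rcases Int.units_eq_one_or φ.sign with hs | hs <;> rw [hs] at this ⊢ <;>
        simp only [Units.val_neg, Units.val_one] at this ⊢
      · rw [min_eq_left (by omega)] at this; rw [min_eq_right (by omega)]; exact this.2
      · rw [min_eq_right (by omega)] at this; rw [min_eq_left (by omega)]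
        simpa using this.1
    rw [e1, if_neg hn]
    unfold Copy.vertex chainStep
    simp only [List.getD_eq_getElem?_getD, hlen, List.getElem?_eq_getElem, Option.getD_some]
    split_ifs <;> simp_all
  rcases hi.lt_or_eq with hi | rfl
  · exact φ.genPerm_vertex h h0 hi
  · have e1 := φ.label (X.length - 1) (by omega)
    have hA : X[X.length - 1] = {a0} ∨ X[X.length - 1] = {a1} ∨ X[X.length - 1] = {a2} :=
      hX.2.2.2 _ (by rw [List.getLast?_eq_getElem?]; simp [hlen])
    have hc : ((X.length - 1 : ℕ) : ℤ) = X.length - 1 := by omega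
    rw [hc, sub_add_cancel, show φ.start + φ.sign * ((X.length : ℤ) - 1)
      = φ.start + φ.sign * (X.length : ℤ) - φ.sign by ring] at e1
    change (φ.w, step φ.w.1 h (φ.start + φ.sign * (X.length : ℤ))) = _
    rw [step_eq (admissible_of_mem φ.w.2) h _ φ.sign]
    have hv : φ.vertex (X.length - 1) = (φ.w, φ.start + φ.sign * (X.length : ℤ) - φ.sign) := by
      unfold Copy.vertex; rw [hc]; congr 1; ring
    have hv' : φ.vertex X.length = (φ.w, φ.start + φ.sign * (X.length : ℤ)) := rfl
    generalize φ.start + φ.sign * (X.length : ℤ) = v at *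
    have hn : h ∉ φ.w.1 (min v (v + φ.sign)) := by
      have := halt (min (v - φ.sign) v) (by rwa [e1])
      rcases Int.units_eq_one_or φ.sign with hs | hs <;> rw [hs] at this ⊢ <;>
        simp only [Units.val_neg, Units.val_one] at this ⊢
      · rw [min_eq_left (by omega)] at this; rw [min_eq_left (by omega)]
        simpa using this.1
      · rw [min_eq_right (by omega)] at this; rw [min_eq_right (by omega)]; exact this.2
    rw [min_comm (v - _) v] at e1
    rw [if_neg hn, e1]
    have hlt : X.length - 1 < X.length := by omega
    unfold chainStep
    simp only [List.getD_eq_getElem?_getD, hlt, hlen, List.getElem?_eq_getElem, Option.getD_some,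
      le_refl, List.getElem?_eq_none, Option.getD_none, Finset.notMem_empty, if_false, true_and]
    split_ifs
    · exact hv.symm
    · exact hv'.symm

theorem perm_inv_apply {α : Type*} (f : Equiv.Perm α) (x : α) : f⁻¹ (f x) = x :=
  f.symm_apply_apply x

/-! ### Permutations that act on the tiles of a level -/

/-- The reversal of `{0, …, N - 1}`. -/
def revOn (N : ℕ) : Equiv.Perm ℕ where
  toFun i := if i < N then N - 1 - i else i
  invFun i := if i < N then N - 1 - i else i
  left_inv i := by dsimp only; split_ifs <;> omega
  right_inv i := by dsimp only; split_ifs <;> omega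

theorem revOn_of_lt {N i : ℕ} (h : i < N) : revOn N i = N - 1 - i := if_pos h

theorem revOn_of_le {N i : ℕ} (h : N ≤ i) : revOn N i = i := if_neg (not_lt.2 h)

theorem revOn_mem_symOn (N : ℕ) : revOn N ∈ symOn N := fun _ => revOn_of_le

/-- The permutation `t` transported by the reversal of `{0, …, N - 1}`. -/
def flipOn (N : ℕ) : Equiv.Perm ℕ →* Equiv.Perm ℕ := (MulAut.conj (revOn N)).toMonoidHom

theorem flipOn_eq (N : ℕ) (t : Equiv.Perm ℕ) :
    flipOn N t = revOn N * t * (revOn N)⁻¹ := rfl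

theorem flipOn_apply (N : ℕ) (t : Equiv.Perm ℕ) (i : ℕ) :
    flipOn N t i = revOn N (t (revOn N i)) := rfl

theorem flipOn_mem_symOn {N : ℕ} {t : Equiv.Perm ℕ} (ht : t ∈ symOn N) : flipOn N t ∈ symOn N :=
  mul_mem (mul_mem (revOn_mem_symOn N) ht) (inv_mem (revOn_mem_symOn N))

theorem flipOn_mem_evenOn {N : ℕ} {t : Equiv.Perm ℕ} (ht : t ∈ evenOn N) :
    flipOn N t ∈ evenOn N :=
  conj_mem_evenOn (revOn_mem_symOn N) ht

theorem flipOn_of_lt {N i : ℕ} {t : Equiv.Perm ℕ} (ht : t ∈ symOn N) (hi : i < N) :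
    flipOn (2 * N) t i = i := by
  have h1 : revOn (2 * N) i = 2 * N - 1 - i := revOn_of_lt (by omega)
  rw [flipOn_apply, h1, ht _ (by omega), revOn_of_lt (by omega)]
  omega

theorem flipOn_of_ge {N i : ℕ} {t : Equiv.Perm ℕ} (ht : t ∈ symOn N) (hi : N ≤ i)
    (hi' : i < 2 * N) : flipOn (2 * N) t i = 2 * N - 1 - t (2 * N - 1 - i) := by
  rw [flipOn_apply, revOn_of_lt hi', revOn_of_lt]
  have := symOn_lt ht (i := 2 * N - 1 - i) (by omega)
  omega

theorem flipOn_c3 {N a b c : ℕ} (ha : a < N) (hb : b < N) (hc : c < N) :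
    flipOn N (c3 a b c) = c3 (N - 1 - a) (N - 1 - b) (N - 1 - c) := by
  rw [flipOn_eq, c3_conj, revOn_of_lt ha, revOn_of_lt hb, revOn_of_lt hc]

/-- Permutations supported on the two halves of `{0, …, 2N - 1}` commute. -/
theorem flipOn_comm {N : ℕ} {s t : Equiv.Perm ℕ} (hs : s ∈ symOn N) (ht : t ∈ symOn N) :
    flipOn (2 * N) t * s = s * flipOn (2 * N) t := by
  ext i
  rw [Equiv.Perm.mul_apply, Equiv.Perm.mul_apply]
  rcases lt_or_ge i N with h | h
  · rw [flipOn_of_lt ht h, flipOn_of_lt ht (symOn_lt hs h)]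
  rcases lt_or_ge i (2 * N) with h' | h'
  · rw [hs i h, hs]
    rw [flipOn_of_ge ht h h']
    have := symOn_lt ht (i := 2 * N - 1 - i) (by omega)
    omega
  · have := flipOn_mem_symOn (symOn_mono (by omega : N ≤ 2 * N) ht)
    rw [hs i h, this i h', hs i h]

/-- The permutation `g` of the vertices acts on the copies of `J_n` by the permutation `s` of the
vertices of `J_n`, and on the copies of `I_n` by the permutation `t` of the vertices of `I_n`. -/
structure Acts (n : ℕ) (g : Equiv.Perm Vertex) (s t : Equiv.Perm ℕ) : Prop where
  symJ : s ∈ symOn (nv n)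
  symI : t ∈ symOn (nv n)
  actJ : ∀ φ : Copy (segJ n), ∀ i < nv n, g (φ.vertex i) = φ.vertex (s i)
  actI : ∀ φ : Copy (segI n), ∀ i < nv n, g (φ.vertex i) = φ.vertex (t i)

section Acts
variable {n : ℕ} {g h : Equiv.Perm Vertex} {s t s' t' p q : Equiv.Perm ℕ}

theorem Acts.one (n : ℕ) : Acts n 1 1 1 :=
  ⟨one_mem _, one_mem _, fun _ _ _ => rfl, fun _ _ _ => rfl⟩

theorem Acts.mul (hg : Acts n g s t) (hh : Acts n h s' t') : Acts n (g * h) (s * s') (t * t') := by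
  refine ⟨mul_mem hg.symJ hh.symJ, mul_mem hg.symI hh.symI, fun φ i hi => ?_, fun φ i hi => ?_⟩
  · rw [Equiv.Perm.mul_apply, hh.actJ φ i hi, hg.actJ φ _ (symOn_lt hh.symJ hi)]; rfl
  · rw [Equiv.Perm.mul_apply, hh.actI φ i hi, hg.actI φ _ (symOn_lt hh.symI hi)]; rfl

theorem Acts.inv (hg : Acts n g s t) : Acts n g⁻¹ s⁻¹ t⁻¹ := by
  refine ⟨inv_mem hg.symJ, inv_mem hg.symI, fun φ i hi => ?_, fun φ i hi => ?_⟩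
  · rw [Equiv.Perm.inv_eq_iff_eq, hg.actJ φ _ (symOn_lt (inv_mem hg.symJ) hi)]; simp
  · rw [Equiv.Perm.inv_eq_iff_eq, hg.actI φ _ (symOn_lt (inv_mem hg.symI) hi)]; simp

theorem Acts.comm (hg : Acts n g s t) (hh : Acts n h s' t') :
    Acts n (g * h * g⁻¹ * h⁻¹) (s * s' * s⁻¹ * s'⁻¹) (t * t' * t⁻¹ * t'⁻¹) :=
  ((hg.mul hh).mul hg.inv).mul hh.inv

/-- A permutation is determined by its action on the copies of `I_n` and `J_n`. -/
theorem Acts.unique (hn : 1 ≤ n) (hg : Acts n g s t) (hh : Acts n h s t) : g = h := by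
  ext1 v
  rcases exists_copy hn v with ⟨φ, i, hi, rfl⟩ | ⟨φ, i, hi, rfl⟩
  · rw [hg.actI φ i hi, hh.actI φ i hi]
  · rw [hg.actJ φ i hi, hh.actJ φ i hi]

theorem act_join {L M : List (Finset Gen)} {e : Finset Gen} {N : ℕ} (hL : L.length + 1 = N)
    (hM : M.length + 1 = N) (hs : s ∈ symOn N) (ht : t ∈ symOn N)
    (h1 : ∀ φ : Copy L, ∀ i < N, g (φ.vertex i) = φ.vertex (s i))
    (h2 : ∀ φ : Copy M, ∀ i < N, g (φ.vertex i) = φ.vertex (t i))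
    (φ : Copy (L ++ e :: M.reverse)) {i : ℕ} (hi : i < 2 * N) :
    g (φ.vertex i) = φ.vertex ((s * flipOn (2 * N) t) i) := by
  rw [Equiv.Perm.mul_apply]
  rcases lt_or_ge i N with h | h
  · rw [flipOn_of_lt ht h]
    exact h1 φ.left i h
  · have hlt := symOn_lt ht (i := 2 * N - 1 - i) (by omega)
    rw [flipOn_of_ge ht h hi, hs _ (by omega)]
    have e1 := h2 φ.right (2 * N - 1 - i) (by omega)
    rw [φ.right_vertex (by omega), φ.right_vertex (by omega)] at e1
    convert e1 using 3 <;> omega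

/-- A permutation that acts on the tiles of some level acts on the tiles of the next level. -/
theorem Acts.up (hn : 1 ≤ n) (hg : Acts n g s t) :
    Acts (n + 1) g (s * flipOn (nv (n + 1)) t) (s * flipOn (nv (n + 1)) s) := by
  obtain ⟨n, rfl⟩ := Nat.exists_eq_add_of_le' hn
  have hle : nv (n + 1) ≤ nv (n + 1 + 1) := nv_mono (by omega)
  have hs := symOn_mono hle hg.symJ
  have ht := symOn_mono hle hg.symI
  refine ⟨mul_mem hs (flipOn_mem_symOn ht), mul_mem hs (flipOn_mem_symOn hs), ?_, ?_⟩
  · intro φ i hi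
    rw [nv_succ (n + 1)] at hi ⊢
    exact act_join (seg_length n).2 (seg_length n).1 hg.symJ hg.symI hg.actJ hg.actI φ hi
  · intro φ i hi
    rw [nv_succ (n + 1)] at hi ⊢
    exact act_join (seg_length n).2 (seg_length n).2 hg.symJ hg.symJ hg.actJ hg.actJ φ hi

/-- Conjugation: if `g` moves the vertices of the copies of `J_n` that are in the support of `s` as
`p` does, and the vertices of the copies of `I_n` that are in the support of `t` as `q` does, then
the conjugate by `g` of a permutation that acts by `s` and `t` acts by the conjugates of `s` by `p`
and of `t` by `q`. The permutation `g` itself need not leave the copies invariant. -/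
theorem Acts.conj (hn : 2 ≤ n) (ha : Acts n h s t) (hp : p ∈ symOn (nv n))
    (hq : q ∈ symOn (nv n))
    (hJ : ∀ φ : Copy (segJ n), ∀ i < nv n, s i ≠ i → g (φ.vertex i) = φ.vertex (p i))
    (hI : ∀ φ : Copy (segI n), ∀ i < nv n, t i ≠ i → g (φ.vertex i) = φ.vertex (q i)) :
    Acts n (g * h * g⁻¹) (p * s * p⁻¹) (q * t * q⁻¹) := by
  -- a vertex moved by `h` is in the support of `s` or of `t`
  have hmove : ∀ v, h v ≠ v →
      (∃ φ : Copy (segI n), ∃ i < nv n, t i ≠ i ∧ φ.vertex i = v) ∨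
        ∃ φ : Copy (segJ n), ∃ i < nv n, s i ≠ i ∧ φ.vertex i = v := by
    intro v hv
    rcases exists_copy (n := n) (by omega) v with ⟨φ, i, hi, rfl⟩ | ⟨φ, i, hi, rfl⟩
    · refine Or.inl ⟨φ, i, hi, fun h0 => hv ?_, rfl⟩
      rw [ha.actI φ i hi, h0]
    · refine Or.inr ⟨φ, i, hi, fun h0 => hv ?_, rfl⟩
      rw [ha.actJ φ i hi, h0]
  refine ⟨mul_mem (mul_mem hp ha.symJ) (inv_mem hp), mul_mem (mul_mem hq ha.symI) (inv_mem hq),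
    fun ψ j hj => ?_, fun ψ j hj => ?_⟩
  · simp only [Equiv.Perm.mul_apply]
    obtain ⟨i, rfl⟩ := p.surjective j
    have hi : i < nv n := by simpa using symOn_lt (inv_mem hp) hj
    simp only [perm_inv_apply]
    by_cases hsi : s i = i
    · rw [hsi]
      by_contra hcon
      have hmv : h (g⁻¹ (ψ.vertex (p i))) ≠ g⁻¹ (ψ.vertex (p i)) := fun h0 => hcon (by
        rw [h0]; simp)
      rcases hmove _ hmv with ⟨φ, k, hk, hk', e⟩ | ⟨φ, k, hk, hk', e⟩
      · rw [Equiv.Perm.eq_inv_iff_eq] at e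
        rw [hI φ k hk hk'] at e
        exact copyIJ_meet hn φ ψ (symOn_lt hq hk) hj e
      · rw [Equiv.Perm.eq_inv_iff_eq] at e
        rw [hJ φ k hk hk'] at e
        have := p.injective (copyJ_meet hn φ ψ (symOn_lt hp hk) hj e)
        rw [this] at hk'
        exact hk' hsi
    · have hsi' : s (s i) ≠ s i := fun h0 => hsi (s.injective h0)
      rw [← hJ ψ i hi hsi, perm_inv_apply, ha.actJ ψ i hi,
        hJ ψ (s i) (symOn_lt ha.symJ hi) hsi']
  · simp only [Equiv.Perm.mul_apply]
    obtain ⟨i, rfl⟩ := q.surjective j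
    have hi : i < nv n := by simpa using symOn_lt (inv_mem hq) hj
    simp only [perm_inv_apply]
    by_cases hti : t i = i
    · rw [hti]
      by_contra hcon
      have hmv : h (g⁻¹ (ψ.vertex (q i))) ≠ g⁻¹ (ψ.vertex (q i)) := fun h0 => hcon (by
        rw [h0]; simp)
      rcases hmove _ hmv with ⟨φ, k, hk, hk', e⟩ | ⟨φ, k, hk, hk', e⟩
      · have e0 := e
        rw [Equiv.Perm.eq_inv_iff_eq] at e
        rw [hI φ k hk hk'] at e
        -- the copies `φ` and `ψ` coincide up to the flip, so `ψ` may be used instead of `φ`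
        have key : ∀ l < nv n, φ.vertex k = ψ.vertex l → False := by
          intro l hl hkl
          have htl : t l ≠ l := fun h0 => hmv (by rw [← e0, hkl, ha.actI ψ l hl, h0])
          have e1 := hI ψ l hl htl
          rw [← hkl, hI φ k hk hk', e] at e1
          have := q.injective (ψ.vertex_inj e1)
          rw [this] at hti
          exact htl hti
        rcases copyI_meet hn φ ψ (symOn_lt hq hk) hj e with h1 | h1
        · exact key k hk (h1 k hk)
        · exact key _ (by omega) (h1 k hk)
      · rw [Equiv.Perm.eq_inv_iff_eq] at e
        rw [hJ φ k hk hk'] at e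
        exact copyIJ_meet hn ψ φ hj (symOn_lt hp hk) e.symm
    · have hti' : t (t i) ≠ t i := fun h0 => hti (t.injective h0)
      rw [← hI ψ i hi hti, perm_inv_apply, ha.actI ψ i hi,
        hI ψ (t i) (symOn_lt ha.symI hi) hti']

end Acts

/-- The permutations `s` of the vertices of `J_n` such that some element of `B` acts by `s` on the
copies of `J_n` and trivially on the copies of `I_n`. -/
def permsJ (n : ℕ) (B : Subgroup Ghat) : Subgroup (Equiv.Perm ℕ) where
  carrier := {s | ∃ g ∈ B, Acts n (g : Equiv.Perm Vertex) s 1}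
  one_mem' := ⟨1, one_mem _, Acts.one n⟩
  mul_mem' := by
    rintro s t ⟨g, hg, h1⟩ ⟨h, hh, h2⟩
    exact ⟨g * h, mul_mem hg hh, h1.mul h2⟩
  inv_mem' := by
    rintro s ⟨g, hg, h1⟩
    exact ⟨g⁻¹, inv_mem hg, by simpa using h1.inv⟩

/-- The permutations `t` of the vertices of `I_n` such that some element of `B` acts by `t` on the
copies of `I_n` and trivially on the copies of `J_n`. -/
def permsI (n : ℕ) (B : Subgroup Ghat) : Subgroup (Equiv.Perm ℕ) where
  carrier := {t | ∃ g ∈ B, Acts n (g : Equiv.Perm Vertex) 1 t}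
  one_mem' := ⟨1, one_mem _, Acts.one n⟩
  mul_mem' := by
    rintro s t ⟨g, hg, h1⟩ ⟨h, hh, h2⟩
    exact ⟨g * h, mul_mem hg hh, h1.mul h2⟩
  inv_mem' := by
    rintro s ⟨g, hg, h1⟩
    exact ⟨g⁻¹, inv_mem hg, by simpa using h1.inv⟩

theorem permsJ_conj {n : ℕ} (hn : 2 ≤ n) {B : Subgroup Ghat} {g : Ghat}
    (hB : ∀ x ∈ B, g * x * g⁻¹ ∈ B) {s p : Equiv.Perm ℕ} (hs : s ∈ permsJ n B)
    (hp : p ∈ symOn (nv n))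
    (h : ∀ φ : Copy (segJ n), ∀ i < nv n, s i ≠ i →
      (g : Equiv.Perm Vertex) (φ.vertex i) = φ.vertex (p i)) :
    p * s * p⁻¹ ∈ permsJ n B := by
  obtain ⟨a, ha, h1⟩ := hs
  refine ⟨_, hB a ha, ?_⟩
  have := h1.conj (q := 1) hn hp (one_mem _) h (fun _ _ _ h0 => absurd rfl h0)
  simpa using this

theorem permsJ_conj_acts {n : ℕ} {B : Subgroup Ghat} {g : Ghat}
    (hB : ∀ x ∈ B, g * x * g⁻¹ ∈ B) {s p q : Equiv.Perm ℕ} (hs : s ∈ permsJ n B)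
    (hg : Acts n (g : Equiv.Perm Vertex) p q) : p * s * p⁻¹ ∈ permsJ n B := by
  obtain ⟨a, ha, h1⟩ := hs
  refine ⟨_, hB a ha, ?_⟩
  have := (hg.mul h1).mul hg.inv
  simpa using this

theorem permsI_conj_acts {n : ℕ} {B : Subgroup Ghat} {g : Ghat}
    (hB : ∀ x ∈ B, g * x * g⁻¹ ∈ B) {t p q : Equiv.Perm ℕ} (ht : t ∈ permsI n B)
    (hg : Acts n (g : Equiv.Perm Vertex) p q) : q * t * q⁻¹ ∈ permsI n B := by
  obtain ⟨a, ha, h1⟩ := ht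
  refine ⟨_, hB a ha, ?_⟩
  have := (hg.mul h1).mul hg.inv
  simpa using this

/-! ### Realization of the even permutations of the tiles -/

theorem symOn_ext {N : ℕ} {s t : Equiv.Perm ℕ} (hs : s ∈ symOn N) (ht : t ∈ symOn N)
    (h : ∀ i < N, s i = t i) : s = t := by
  ext i
  rcases lt_or_ge i N with hi | hi
  · rw [h i hi]
  · rw [hs i hi, ht i hi]

theorem coe_gen (s : Gen) : ((gen s : Ghat) : Equiv.Perm Vertex) = genPerm s := rfl

theorem genPerm_apply_apply (s : Gen) (v : Vertex) : genPerm s (genPerm s v) = v :=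
  (genPerm s).left_inv v

theorem segJ_two :
    segJ 2 = [{a2}, {b, c}, {a1}, {d, b}, {a0}, {b, c}, {a2}] := by decide

theorem segI_two :
    segI 2 = [{a2}, {b, c}, {a1}, {d, b}, {a1}, {b, c}, {a2}] := by decide

theorem acts_two_of_chainStep {h : Gen} (ha : h = a0 ∨ h = a1 ∨ h = a2) {s t : Equiv.Perm ℕ}
    (hs : s ∈ symOn 8) (ht : t ∈ symOn 8) (h1 : ∀ i < 8, chainStep (segJ 2) h i = s i)
    (h2 : ∀ i < 8, chainStep (segI 2) h i = t i) : Acts 2 (genPerm h) s t := by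
  refine ⟨hs, ht, fun φ i hi => ?_, fun φ i hi => ?_⟩
  · rw [φ.genPerm_vertex_of_good (good_segs 1).2.1 (good_segs 1).2.2 ha, h1 i hi]
    have := segJ_length (n := 2) (by omega)
    omega
  · rw [φ.genPerm_vertex_of_good (good_segs 1).1.1 (good_segs 1).1.2 ha, h2 i hi]
    have := segI_length (n := 2) (by omega)
    omega

theorem acts_a0 : Acts 2 (genPerm a0) (Equiv.swap 4 5) 1 := by
  refine acts_two_of_chainStep (by simp) (swap_mem_symOn (by omega) (by omega)) (one_mem _) ?_ ?_
  · rw [segJ_two]; decide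
  · rw [segI_two]; decide

theorem acts_a1 : Acts 2 (genPerm a1) (Equiv.swap 2 3) (Equiv.swap 2 3 * Equiv.swap 4 5) := by
  refine acts_two_of_chainStep (by simp) (swap_mem_symOn (by omega) (by omega))
    (mul_mem (swap_mem_symOn (by omega) (by omega)) (swap_mem_symOn (by omega) (by omega))) ?_ ?_
  · rw [segJ_two]; decide
  · rw [segI_two]; decide

theorem acts_a2 : Acts 2 (genPerm a2) (Equiv.swap 0 1 * Equiv.swap 6 7)
    (Equiv.swap 0 1 * Equiv.swap 6 7) := by
  refine acts_two_of_chainStep (by simp)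
    (mul_mem (swap_mem_symOn (by omega) (by omega)) (swap_mem_symOn (by omega) (by omega)))
    (mul_mem (swap_mem_symOn (by omega) (by omega)) (swap_mem_symOn (by omega) (by omega))) ?_ ?_
  · rw [segJ_two]; decide
  · rw [segI_two]; decide

/-- The action of the labels `b`, `c`, `d` on the inner vertices `1, …, 6` of `I_2`, `J_2`. -/
def innerPerm : Gen → Equiv.Perm ℕ
  | b => Equiv.swap 1 2 * Equiv.swap 3 4 * Equiv.swap 5 6
  | c => Equiv.swap 1 2 * Equiv.swap 5 6
  | d => Equiv.swap 3 4
  | _ => 1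

theorem innerPerm_mem_symOn (x : Gen) : innerPerm x ∈ symOn 8 := by
  cases x <;> simp only [innerPerm] <;>
    first
    | exact one_mem _
    | exact swap_mem_symOn (by omega) (by omega)
    | exact mul_mem (swap_mem_symOn (by omega) (by omega)) (swap_mem_symOn (by omega) (by omega))
    | exact mul_mem (mul_mem (swap_mem_symOn (by omega) (by omega))
        (swap_mem_symOn (by omega) (by omega))) (swap_mem_symOn (by omega) (by omega))

theorem genPerm_inner {x : Gen} (hx : x = b ∨ x = c ∨ x = d) (n : ℕ) :
    (∀ φ : Copy (segI (n + 2)), ∀ i, 1 ≤ i → i ≤ 6 →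
      genPerm x (φ.vertex i) = φ.vertex (innerPerm x i)) ∧
    ∀ φ : Copy (segJ (n + 2)), ∀ i, 1 ≤ i → i ≤ 6 →
      genPerm x (φ.vertex i) = φ.vertex (innerPerm x i) := by
  induction n with
  | zero =>
    have h1 : ∀ i < 7, 1 ≤ i → chainStep (segI 2) x i = innerPerm x i := by
      rw [segI_two]; rcases hx with rfl | rfl | rfl <;> decide
    have h2 : ∀ i < 7, 1 ≤ i → chainStep (segJ 2) x i = innerPerm x i := by
      rw [segJ_two]; rcases hx with rfl | rfl | rfl <;> decide
    have h3 : (segI 2).length = 7 := by rw [segI_two]; rfl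
    have h4 : (segJ 2).length = 7 := by rw [segJ_two]; rfl
    refine ⟨fun φ i hi hi' => ?_, fun φ i hi hi' => ?_⟩
    · rw [φ.genPerm_vertex x hi (by rw [h3]; omega), h1 i (by omega) hi]
    · rw [φ.genPerm_vertex x hi (by rw [h4]; omega), h2 i (by omega) hi]
  | succ n ih =>
    refine ⟨fun φ i hi hi' => ?_, fun φ i hi hi' => ?_⟩
    · let ψ : Copy (segJ (n + 2) ++ conn (n + 2) :: (segJ (n + 2)).reverse) := φ
      exact ih.2 ψ.left i hi hi'
    · let ψ : Copy (segJ (n + 2) ++ conn (n + 2) :: (segI (n + 2)).reverse) := φ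
      exact ih.2 ψ.left i hi hi'

/-- The labels of the middle edge of a segment exchange its ends. -/
theorem Copy.genPerm_mid {L M : List (Finset Gen)} {e : Finset Gen} (φ : Copy (L ++ e :: M))
    (hL : L ≠ []) {h : Gen} (hh : h ∈ e) :
    genPerm h (φ.vertex L.length) = φ.vertex (L.length + 1) := by
  rw [φ.genPerm_vertex h (List.length_pos_of_ne_nil hL) (by simp)]
  simp [chainStep, hh]

/-- Every connector contains a label that fixes two given inner vertices of all tiles. -/
theorem exists_label (k : ℕ) : ∃ (h : Gen) (x y : ℕ), h ∈ conn k ∧ (h = b ∨ h = c ∨ h = d) ∧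
    1 ≤ x ∧ x < y ∧ y ≤ 4 ∧ innerPerm h x = x ∧ innerPerm h y = y := by
  unfold conn
  split_ifs
  · exact ⟨c, 3, 4, by decide, by decide, by decide, by decide, by decide, by decide, by decide⟩
  · exact ⟨d, 1, 2, by decide, by decide, by decide, by decide, by decide, by decide, by decide⟩
  · exact ⟨c, 3, 4, by decide, by decide, by decide, by decide, by decide, by decide, by decide⟩

/-- The permutations `e` of `{0, …, N - 1}` such that `W` contains the permutation that acts by `e`
on both halves of a palindrome with `2N` vertices. -/
def diagComap (N : ℕ) (W : Subgroup (Equiv.Perm ℕ)) : Subgroup (Equiv.Perm ℕ) where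
  carrier := {e | e ∈ symOn N ∧ e * flipOn (2 * N) e ∈ W}
  one_mem' := ⟨one_mem _, by simp⟩
  mul_mem' := by
    rintro e f ⟨he, he'⟩ ⟨hf, hf'⟩
    refine ⟨mul_mem he hf, ?_⟩
    have : e * f * flipOn (2 * N) (e * f)
        = e * flipOn (2 * N) e * (f * flipOn (2 * N) f) := by
      rw [map_mul, mul_assoc e f, ← mul_assoc f, ← flipOn_comm hf he]
      group
    rw [this]
    exact mul_mem he' hf'
  inv_mem' := by
    rintro e ⟨he, he'⟩
    refine ⟨inv_mem he, ?_⟩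
    have : e⁻¹ * flipOn (2 * N) e⁻¹ = (e * flipOn (2 * N) e)⁻¹ := by
      rw [← flipOn_comm he he, mul_inv_rev, map_inv]
    rw [this]
    exact inv_mem he'

theorem c3_star {W : Subgroup (Equiv.Perm ℕ)} {x y z : ℕ} (hxy : x ≠ y) (hxz : x ≠ z)
    (hyz : y ≠ z) (h : c3 x z y ∈ W) : c3 x y z ∈ W := by
  have := W.inv_mem h
  rwa [c3_inv, c3_rotate hyz hxy.symm hxz.symm, c3_rotate hxz.symm hyz.symm hxy] at this

theorem conj_comm_eq {G : Type*} [Group G] (g h : G) : g * h * g⁻¹ * h⁻¹ = g * (h * g * h⁻¹)⁻¹ := by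
  group

/-- The commutator of a label `a_i` and a label `x` that preserves the support of `a_i`. -/
theorem acts_two_comm {g : Equiv.Perm Vertex} {x : Gen} (hx : x = b ∨ x = c ∨ x = d)
    {s t : Equiv.Perm ℕ} (hg : Acts 2 g s t) (h0 : s 0 = 0) (h7 : s 7 = 7) (k0 : t 0 = 0)
    (k7 : t 7 = 7) :
    Acts 2 (g * genPerm x * g⁻¹ * (genPerm x)⁻¹)
      (s * innerPerm x * s⁻¹ * (innerPerm x)⁻¹) (t * innerPerm x * t⁻¹ * (innerPerm x)⁻¹) := by
  have hp := innerPerm_mem_symOn x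
  have := hg.conj (g := genPerm x) le_rfl hp hp
    (fun φ i hi hsi => by
      have : i < 8 := hi
      refine (genPerm_inner hx 0).2 φ i ?_ ?_
      · rcases Nat.eq_zero_or_pos i with rfl | h
        · exact absurd h0 hsi
        · exact h
      · by_contra h
        exact hsi (by rw [show i = 7 by omega, h7]))
    (fun φ i hi hsi => by
      have : i < 8 := hi
      refine (genPerm_inner hx 0).1 φ i ?_ ?_
      · rcases Nat.eq_zero_or_pos i with rfl | h
        · exact absurd k0 hsi
        · exact h
      · by_contra h
        exact hsi (by rw [show i = 7 by omega, k7]))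
  have := hg.mul this.inv
  rwa [← conj_comm_eq, ← conj_comm_eq, ← conj_comm_eq] at this

theorem evenOn_le_permsJ_two : evenOn (nv 2) ≤ permsJ 2 ⊤ := by
  set W := permsJ 2 ⊤ with hW
  have hn : ∀ g : Ghat, ∀ x ∈ (⊤ : Subgroup Ghat), g * x * g⁻¹ ∈ (⊤ : Subgroup Ghat) :=
    fun _ _ _ => trivial
  have hc1 : ∀ {p q r : ℕ}, p < 8 → q < 8 → r < 8 → c3 p q r ∈ symOn 8 := c3_mem_symOn
  have h456 : c3 5 4 6 ∈ W := by
    refine ⟨gen a0 * gen c * (gen a0)⁻¹ * (gen c)⁻¹, trivial, ?_⟩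
    have := acts_two_comm (x := c) (by simp) acts_a0 (by decide) (by decide) rfl rfl
    rw [show Equiv.swap 4 5 * innerPerm c * (Equiv.swap 4 5)⁻¹ * (innerPerm c)⁻¹ = c3 5 4 6 from
      symOn_ext this.symJ (hc1 (by omega) (by omega) (by omega)) (by decide)] at this
    simpa [coe_gen] using this
  have h345 : c3 4 5 3 ∈ W := by
    refine ⟨gen a0 * gen d * (gen a0)⁻¹ * (gen d)⁻¹, trivial, ?_⟩
    have := acts_two_comm (x := d) (by simp) acts_a0 (by decide) (by decide) rfl rfl
    rw [show Equiv.swap 4 5 * innerPerm d * (Equiv.swap 4 5)⁻¹ * (innerPerm d)⁻¹ = c3 4 5 3 from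
      symOn_ext this.symJ (hc1 (by omega) (by omega) (by omega)) (by decide)] at this
    simpa [coe_gen] using this
  have h452 : c3 4 5 2 ∈ W := by
    have := permsJ_conj_acts (hn (gen a1)) h345 acts_a1
    rwa [c3_conj] at this
  have h461 : c3 4 6 1 ∈ W := by
    have := permsJ_conj le_rfl (hn (gen c)) h452 (innerPerm_mem_symOn c) (fun φ i hi hsi => by
      refine (genPerm_inner (by simp) 0).2 φ i ?_ ?_
      · rcases Nat.eq_zero_or_pos i with rfl | h
        · exact absurd rfl hsi
        · exact h
      · by_contra h
        have : i < 8 := hi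
        exact hsi (by rw [show i = 7 by omega]; decide))
    rwa [c3_conj] at this
  have h470 : c3 4 7 0 ∈ W := by
    have := permsJ_conj_acts (hn (gen a2)) h461 acts_a2
    rwa [c3_conj] at this
  have h457 : c3 5 4 7 ∈ W := by
    have := permsJ_conj_acts (hn (gen a2)) h456 acts_a2
    rwa [c3_conj] at this
  have f1 : FullOn W {i | 2 ≤ i ∧ i < 8} := by
    refine fullOn_of_star (x := 4) (y := 5) (by omega) fun z hz hz4 hz5 => ?_
    obtain ⟨h1, h2⟩ := hz
    have : z = 2 ∨ z = 3 ∨ z = 6 ∨ z = 7 := by omega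
    rcases this with rfl | rfl | rfl | rfl
    · exact h452
    · exact h345
    · have := W.inv_mem h456
      rwa [c3_inv, c3_rotate (by omega) (by omega) (by omega)] at this
    · have := W.inv_mem h457
      rwa [c3_inv, c3_rotate (by omega) (by omega) (by omega)] at this
  have f2 : FullOn W {i | 1 ≤ i ∧ i < 8} := by
    refine fullOn_of_star (x := 4) (y := 6) (by omega) fun z hz hz4 hz5 => ?_
    obtain ⟨h1, h2⟩ := hz
    by_cases h : z = 1
    · rw [h]; exact h461
    · exact f1 _ ⟨by omega, by omega⟩ _ ⟨by omega, by omega⟩ _ ⟨by omega, by omega⟩ (by omega)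
        (by omega) (by omega)
  refine evenOn_le_of_fullOn ?_
  refine fullOn_of_star (x := 4) (y := 7) (by omega) fun z hz hz4 hz5 => ?_
  have hz' : z < 8 := hz
  by_cases h : z = 0
  · rw [h]; exact h470
  · exact f2 _ ⟨by omega, by omega⟩ _ ⟨by omega, by omega⟩ _ ⟨by omega, by omega⟩ (by omega)
      (by omega) (by omega)

theorem evenOn_le_diagComap_two : evenOn (nv 1) ≤ diagComap (nv 1) (permsI 2 ⊤) := by
  have hn : ∀ g : Ghat, ∀ x ∈ (⊤ : Subgroup Ghat), g * x * g⁻¹ ∈ (⊤ : Subgroup Ghat) :=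
    fun _ _ _ => trivial
  have hc1 : ∀ {p q r : ℕ}, p < 8 → q < 8 → r < 8 → c3 p q r ∈ symOn 8 := c3_mem_symOn
  have hd : ∀ {p q r : ℕ}, p < 4 → q < 4 → r < 4 →
      flipOn (2 * 4) (c3 p q r) = c3 (7 - p) (7 - q) (7 - r) := by
    intro p q r hp hq hr
    rw [flipOn_c3 (by omega) (by omega) (by omega)]
  have h1 : c3 2 3 1 * c3 5 4 6 ∈ permsI 2 ⊤ := by
    have h := acts_two_comm (x := c) (by simp) acts_a1 (by decide) (by decide) (by decide)
      (by decide)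
    rw [show Equiv.swap 2 3 * innerPerm c * (Equiv.swap 2 3)⁻¹ * (innerPerm c)⁻¹ = c3 2 3 1 from
      symOn_ext h.symJ (hc1 (by omega) (by omega) (by omega)) (by decide),
      show Equiv.swap 2 3 * Equiv.swap 4 5 * innerPerm c * (Equiv.swap 2 3 * Equiv.swap 4 5)⁻¹ *
        (innerPerm c)⁻¹ = c3 2 3 1 * c3 5 4 6 from
      symOn_ext h.symI (mul_mem (hc1 (by omega) (by omega) (by omega))
        (hc1 (by omega) (by omega) (by omega))) (by decide)] at h
    have hJ := c3_mem_evenOn (N := nv 2) (a := 2) (b := 3) (c := 1) (by decide) (by decide)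
      (by decide) (by omega) (by omega) (by omega)
    obtain ⟨g, -, hg⟩ := evenOn_le_permsJ_two hJ
    refine ⟨gen a1 * gen c * (gen a1)⁻¹ * (gen c)⁻¹ * g⁻¹, trivial, ?_⟩
    have := h.mul hg.inv
    rw [mul_inv_cancel, inv_one, mul_one] at this
    simpa [coe_gen] using this
  have h0 : c3 2 3 0 * c3 5 4 7 ∈ permsI 2 ⊤ := by
    have := permsI_conj_acts (hn (gen a2)) h1 acts_a2
    rw [← MulAut.conj_apply, map_mul, MulAut.conj_apply, MulAut.conj_apply, c3_conj, c3_conj]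
      at this
    exact this
  refine evenOn_le_of_fullOn (fullOn_of_star (x := 2) (y := 3) (by omega) fun z hz h2 h3 => ?_)
  have hz' : z < 4 := hz
  refine ⟨c3_mem_symOn (N := 4) (by omega) (by omega) hz', ?_⟩
  change c3 2 3 z * flipOn (2 * 4) (c3 2 3 z) ∈ _
  rw [hd (by omega) (by omega) hz']
  have : z = 0 ∨ z = 1 := by omega
  rcases this with rfl | rfl
  · exact h0
  · exact h1

/-- Even permutations of the halves of `I_{n+1}` are obtained by comparing the action of a
permutation of `J_n` on `I_{n+1}` and on `J_{n+1}`. -/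
theorem evenOn_le_diagComap {n : ℕ} (hn : 1 ≤ n) {B : Subgroup Ghat}
    (h1 : evenOn (nv n) ≤ permsJ n B) (h2 : evenOn (nv (n + 1)) ≤ permsJ (n + 1) B) :
    evenOn (nv n) ≤ diagComap (nv n) (permsI (n + 1) B) := by
  intro e he
  refine ⟨evenOn_le_symOn _ he, ?_⟩
  obtain ⟨g, hg, hg'⟩ := h1 he
  obtain ⟨k, hk, hk'⟩ := h2 (evenOn_mono (nv_mono (by omega)) he)
  refine ⟨k⁻¹ * g, mul_mem (inv_mem hk) hg, ?_⟩
  have := hk'.inv.mul (hg'.up hn)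
  rw [map_one, mul_one, inv_mul_cancel, inv_one, one_mul, nv_succ] at this
  exact this

/-- The action of a permutation of the halves of `I_{n+1}` on the second half of `J_{n+2}`. -/
theorem flipOn_diag {M : ℕ} {e : Equiv.Perm ℕ} (he : e ∈ symOn M) :
    (∀ z < 2 * M, flipOn (2 * (2 * M)) (e * flipOn (2 * M) e) z = z) ∧
    (∀ j < M, flipOn (2 * (2 * M)) (e * flipOn (2 * M) e) (2 * M + j) = 2 * M + e j) ∧
    ∀ j < M, flipOn (2 * (2 * M)) (e * flipOn (2 * M) e) (4 * M - 1 - j) = 4 * M - 1 - e j := by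
  have hM := symOn_mono (by omega : M ≤ 2 * M) he
  have ht : e * flipOn (2 * M) e ∈ symOn (2 * M) := mul_mem hM (flipOn_mem_symOn hM)
  refine ⟨fun z hz => flipOn_of_lt ht hz, fun j hj => ?_, fun j hj => ?_⟩
  · have hlt := symOn_lt he hj
    have e1 : 2 * M - 1 - (2 * M - 1 - j) = j := by omega
    rw [flipOn_of_ge ht (by omega) (by omega), Equiv.Perm.mul_apply,
      show 2 * (2 * M) - 1 - (2 * M + j) = 2 * M - 1 - j by omega,
      flipOn_of_ge he (by omega) (by omega), e1, he _ (by omega)]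
    omega
  · have hlt := symOn_lt he hj
    rw [flipOn_of_ge ht (by omega) (by omega), Equiv.Perm.mul_apply,
      show 2 * (2 * M) - 1 - (4 * M - 1 - j) = j by omega, flipOn_of_lt he hj]
    omega

theorem exists_evenOn_apply {M x z : ℕ} (hM : 4 ≤ M) (hx : x < M) (hz : z < M) :
    ∃ e ∈ evenOn M, e x = z := by
  by_cases h : x = z
  · exact ⟨1, one_mem _, h⟩
  obtain ⟨w, hw, hwx, hwz⟩ : ∃ w < M, w ≠ x ∧ w ≠ z := by
    by_cases h0 : x ≠ 0 ∧ z ≠ 0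
    · exact ⟨0, by omega, by omega, by omega⟩
    by_cases h1 : x ≠ 1 ∧ z ≠ 1
    · exact ⟨1, by omega, by omega, by omega⟩
    exact ⟨2, by omega, by omega, by omega⟩
  exact ⟨c3 x z w, c3_mem_evenOn hx hz hw h hwx.symm hwz.symm, c3_apply_left h hwx.symm⟩

/-- The inductive step. A label of the middle edge of `J_{n+2}` moves a three-cycle of `J_{n+1}`
across that edge; its commutator with a permutation of the second half `I_{n+1}` is a three-cycle
that acts on the copies of `J_{n+2}` alone. All other three-cycles are generated from this one by
conjugation. -/
theorem evenOn_le_permsJ_succ {n : ℕ} (hn : 1 ≤ n) (h1 : evenOn (nv (n + 1)) ≤ permsJ (n + 1) ⊤)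
    (h2 : evenOn (nv n) ≤ diagComap (nv n) (permsI (n + 1) ⊤)) :
    evenOn (nv (n + 2)) ≤ permsJ (n + 2) ⊤ := by
  obtain ⟨n, rfl⟩ := Nat.exists_eq_add_of_le' hn
  have htop : ∀ g : Ghat, ∀ x ∈ (⊤ : Subgroup Ghat), g * x * g⁻¹ ∈ (⊤ : Subgroup Ghat) :=
    fun _ _ _ => trivial
  set W := permsJ (n + 1 + 2) ⊤ with hW
  obtain ⟨M, hM⟩ : ∃ M, nv (n + 1) = M := ⟨_, rfl⟩
  have hM4 : 4 ≤ M := hM ▸ four_le_nv (by omega)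
  have hN : nv (n + 1 + 1) = 2 * M := by rw [nv_succ, hM]
  have hNN : nv (n + 1 + 2) = 2 * (2 * M) := by rw [nv_succ, hN]
  rw [hM] at h2
  rw [hN] at h1
  rw [hNN]
  -- even permutations of the first half of `J_{n+2}`, and of the halves of its second half
  have hleft : ∀ e ∈ evenOn (2 * M), ∀ s ∈ W, e * s * e⁻¹ ∈ W := by
    intro e he s hs
    obtain ⟨g, -, hg⟩ := h1 he
    have := hg.up (by omega)
    rw [map_one, mul_one] at this
    exact permsJ_conj_acts (htop g) hs this
  have hright : ∀ e ∈ evenOn M, ∃ g : Ghat, Acts (n + 1 + 2) (g : Equiv.Perm Vertex)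
      (flipOn (2 * (2 * M)) (e * flipOn (2 * M) e)) 1 := by
    intro e he
    obtain ⟨-, g, -, hg⟩ := h2 he
    have := hg.up (by omega)
    rw [map_one, mul_one, one_mul, hNN] at this
    exact ⟨g, this⟩
  have hJlen : (segJ (n + 1 + 1)).length = 2 * M - 1 := by
    have := (seg_length (n + 1)).2; omega
  have hIlen : (segI (n + 1 + 1)).length = 2 * M - 1 := by
    have := (seg_length (n + 1)).1; omega
  have hJ0 : segJ (n + 1 + 1) ≠ [] := (good_segs (n + 1)).2.2
  -- the first three-cycle
  have hfirst : ∃ x < 2 * M, c3 (2 * M) x (2 * M + 1) ∈ W := by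
    obtain ⟨h, x, y, hh, hbcd, hx, hxy, hy, hx', hy'⟩ := exists_label (n + 1 + 1)
    refine ⟨x, by omega, ?_⟩
    obtain ⟨σ, -, hσ⟩ := h1 (c3_mem_evenOn (a := 2 * M - 1) (b := x) (c := y) (by omega) (by omega)
      (by omega) (by omega) (by omega) (by omega))
    have hσ2 := hσ.up (by omega)
    rw [map_one, mul_one, hNN] at hσ2
    have hsupp : ∀ i, c3 (2 * M - 1) x y i ≠ i → i = 2 * M - 1 ∨ i = x ∨ i = y := by
      intro i hi
      by_contra! hcon
      exact hi (c3_apply_of_ne hcon.1 hcon.2.1 hcon.2.2)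
    have hswap : Equiv.swap (2 * M - 1) (2 * M) ∈ symOn (nv (n + 1 + 2)) :=
      swap_mem_symOn (by omega) (by omega)
    have hconj := hσ2.conj (g := genPerm h) (by omega) hswap hswap
      (fun φ i hi hsi => by
        let ψ : Copy (segJ (n + 1 + 1) ++ conn (n + 1 + 1) :: (segI (n + 1 + 1)).reverse) := φ
        rcases hsupp i hsi with rfl | rfl | rfl
        · have := ψ.genPerm_mid hJ0 hh
          rw [hJlen, show 2 * M - 1 + 1 = 2 * M by omega] at this
          rw [Equiv.swap_apply_left]
          exact this
        · rw [Equiv.swap_apply_of_ne_of_ne (by omega) (by omega)]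
          have := (genPerm_inner hbcd _).2 φ i (by omega) (by omega)
          rwa [hx'] at this
        · rw [Equiv.swap_apply_of_ne_of_ne (by omega) (by omega)]
          have := (genPerm_inner hbcd _).2 φ i (by omega) (by omega)
          rwa [hy'] at this)
      (fun φ i hi hsi => by
        let ψ : Copy (segJ (n + 1 + 1) ++ conn (n + 1 + 1) :: (segJ (n + 1 + 1)).reverse) := φ
        have hmid := ψ.genPerm_mid hJ0 hh
        rw [hJlen, show 2 * M - 1 + 1 = 2 * M by omega] at hmid
        rcases lt_or_ge i (2 * M) with hlt | hge
        · rw [Equiv.Perm.mul_apply, flipOn_of_lt (c3_mem_symOn (by omega) (by omega) (by omega))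
            hlt] at hsi
          rcases hsupp i hsi with rfl | rfl | rfl
          · rw [Equiv.swap_apply_left]
            exact hmid
          · rw [Equiv.swap_apply_of_ne_of_ne (by omega) (by omega)]
            have := (genPerm_inner hbcd _).1 φ i (by omega) (by omega)
            rwa [hx'] at this
          · rw [Equiv.swap_apply_of_ne_of_ne (by omega) (by omega)]
            have := (genPerm_inner hbcd _).1 φ i (by omega) (by omega)
            rwa [hy'] at this
        · have hi' : i < 2 * (2 * M) := hNN ▸ hi
          have hs : c3 (2 * M - 1) x y ∈ symOn (2 * M) :=
            c3_mem_symOn (by omega) (by omega) (by omega)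
          have hsi' : c3 (2 * M - 1) x y (2 * (2 * M) - 1 - i) ≠ 2 * (2 * M) - 1 - i := by
            intro h0
            apply hsi
            rw [Equiv.Perm.mul_apply, flipOn_of_ge hs hge hi', h0, hs _ (by omega)]
            omega
          have hr : ∀ j, 1 ≤ j → j ≤ 4 → innerPerm h j = j → i = 2 * (2 * M) - 1 - j →
              genPerm h (φ.vertex i) = φ.vertex i := by
            intro j h1 h2 h3 h4
            have := (genPerm_inner hbcd _).2 ψ.right j (by omega) (by omega)
            have e : (segJ (n + 1 + 1)).length + 1 + (segJ (n + 1 + 1)).length - j = i := by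
              rw [hJlen]; omega
            rwa [h3, ψ.right_vertex (by omega), e] at this
          rcases hsupp _ hsi' with h4 | h4 | h4
          · rw [show i = 2 * M by omega, Equiv.swap_apply_right]
            have : genPerm h (ψ.vertex (2 * M)) = ψ.vertex (2 * M - 1) := by
              rw [← hmid, genPerm_apply_apply]
            exact this
          · rw [Equiv.swap_apply_of_ne_of_ne (by omega) (by omega)]
            exact hr x (by omega) (by omega) hx' (by omega)
          · rw [Equiv.swap_apply_of_ne_of_ne (by omega) (by omega)]
            exact hr y (by omega) (by omega) hy' (by omega))
    have h012 : c3 0 1 2 ∈ evenOn M := c3_mem_evenOn (by omega) (by omega) (by omega) (by omega)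
      (by omega) (by omega)
    obtain ⟨τ, hτ⟩ := hright _ h012
    obtain ⟨t1, t2, -⟩ := flipOn_diag (evenOn_le_symOn _ h012)
    have t20 := t2 0 (by omega)
    rw [add_zero, c3_apply_left (by omega) (by omega)] at t20
    have hcomm := hconj.comm hτ
    have hone : ∀ u : Equiv.Perm ℕ, u * 1 * u⁻¹ * 1⁻¹ = 1 := by intro u; group
    rw [hone] at hcomm
    rw [conj_comm_eq (Equiv.swap _ _ * _ * _) (flipOn _ _), c3_conj, Equiv.swap_apply_left,
      Equiv.swap_apply_of_ne_of_ne (by omega) (by omega),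
      Equiv.swap_apply_of_ne_of_ne (by omega) (by omega), c3_conj, t1 x (by omega),
      t1 y (by omega), t20,
      c3_mul_inv (by omega) (by omega) (by omega) (by omega) (by omega) (by omega)] at hcomm
    refine ⟨gen h * σ * (gen h)⁻¹ * τ * (gen h * σ * (gen h)⁻¹)⁻¹ * τ⁻¹, trivial, ?_⟩
    exact hcomm
  obtain ⟨x₀, hx₀, hfirst⟩ := hfirst
  have hfull : FullOn W {z | z < 2 * M + 2} := by
    refine fullOn_of_star (x := 2 * M) (y := 2 * M + 1) (by omega) fun z hz hz1 hz2 => ?_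
    have hz' : z < 2 * M + 2 := hz
    obtain ⟨e, he, hez⟩ := exists_evenOn_apply (M := 2 * M) (z := z) (by omega) hx₀ (by omega)
    have := hleft e he _ hfirst
    rw [c3_conj, hez, evenOn_le_symOn _ he _ le_rfl, evenOn_le_symOn _ he _ (by omega)] at this
    exact c3_star (by omega) (by omega) (by omega) this
  obtain ⟨h, x, y, hh, hbcd, hx, hxy, hy, hx', hy'⟩ := exists_label (n + 1)
  -- the first quarter of the second half
  have hthird : ∀ j < M, c3 x y (2 * M + j) ∈ W := by
    intro j hj
    obtain ⟨e, he, hej⟩ := exists_evenOn_apply hM4 (show 0 < M by omega) hj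
    obtain ⟨g, hg⟩ := hright e he
    obtain ⟨t1, t2, -⟩ := flipOn_diag (evenOn_le_symOn _ he)
    have t20 := t2 0 (by omega)
    rw [add_zero, hej] at t20
    have := permsJ_conj_acts (htop g) (hfull x (by simp; omega) y (by simp; omega) (2 * M)
      (by simp) (by omega) (by omega) (by omega)) hg
    rwa [c3_conj, t1 x (by omega), t1 y (by omega), t20] at this
  -- the middle edge of the second half leads to its second half
  have hcross : c3 x y (3 * M) ∈ W := by
    have h3 := hthird (M - 1) (by omega)
    rw [show 2 * M + (M - 1) = 3 * M - 1 by omega] at h3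
    have := permsJ_conj (p := Equiv.swap (3 * M - 1) (3 * M)) (by omega) (htop (gen h)) h3
      (swap_mem_symOn (by omega) (by omega)) (fun φ i hi hsi => by
        let ψ : Copy (segJ (n + 1 + 1) ++ conn (n + 1 + 1) :: (segI (n + 1 + 1)).reverse) := φ
        have hi3 : i = x ∨ i = y ∨ i = 3 * M - 1 := by
          by_contra! hcon
          exact hsi (c3_apply_of_ne hcon.1 hcon.2.1 hcon.2.2)
        rw [coe_gen]
        rcases hi3 with rfl | rfl | rfl
        · rw [Equiv.swap_apply_of_ne_of_ne (by omega) (by omega)]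
          have := (genPerm_inner hbcd _).2 φ i (by omega) (by omega)
          rwa [hx'] at this
        · rw [Equiv.swap_apply_of_ne_of_ne (by omega) (by omega)]
          have := (genPerm_inner hbcd _).2 φ i (by omega) (by omega)
          rwa [hy'] at this
        · let χ : Copy (segJ (n + 1) ++ conn (n + 1) :: (segJ (n + 1)).reverse) := ψ.right
          have hmid := χ.genPerm_mid (good_segs n).2.2 hh
          have hlen : (segJ (n + 1)).length = M - 1 := by
            have := (seg_length n).2; omega
          rw [hlen] at hmid
          have e1 : χ.vertex (M - 1) = φ.vertex (3 * M) := by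
            refine (ψ.right_vertex (by omega)).trans ?_
            rw [hJlen, hIlen]
            congr 1; omega
          have e2 : χ.vertex (M - 1 + 1) = φ.vertex (3 * M - 1) := by
            refine (ψ.right_vertex (by omega)).trans ?_
            rw [hJlen, hIlen]
            congr 1; omega
          rw [e1, e2] at hmid
          rw [Equiv.swap_apply_left, ← hmid, genPerm_apply_apply])
    rwa [c3_conj, Equiv.swap_apply_left, Equiv.swap_apply_of_ne_of_ne (by omega) (by omega),
      Equiv.swap_apply_of_ne_of_ne (by omega) (by omega)] at this
  have hfourth : ∀ j < M, c3 x y (4 * M - 1 - j) ∈ W := by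
    intro j hj
    obtain ⟨e, he, hej⟩ := exists_evenOn_apply hM4 (show M - 1 < M by omega) hj
    obtain ⟨g, hg⟩ := hright e he
    obtain ⟨t1, -, t3⟩ := flipOn_diag (evenOn_le_symOn _ he)
    have := permsJ_conj_acts (htop g) hcross hg
    rwa [c3_conj, t1 x (by omega), t1 y (by omega), show 3 * M = 4 * M - 1 - (M - 1) by omega,
      t3 _ (by omega), hej] at this
  refine evenOn_le_of_fullOn (fullOn_of_star (x := x) (y := y) (by omega) fun z hz hzx hzy => ?_)
  have hz' : z < 2 * (2 * M) := hz
  rcases lt_or_ge z (2 * M) with h3 | h3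
  · exact hfull x (by simp; omega) y (by simp; omega) z (by simp; omega) (by omega) (Ne.symm hzx)
      (Ne.symm hzy)
  rcases lt_or_ge z (3 * M) with h4 | h4
  · have := hthird (z - 2 * M) (by omega)
    rwa [show 2 * M + (z - 2 * M) = z by omega] at this
  · have := hfourth (4 * M - 1 - z) (by omega)
    rwa [show 4 * M - 1 - (4 * M - 1 - z) = z by omega] at this

/-- The group contains all even permutations of the copies of `J_{n+2}`, and all even permutations
of the halves of the copies of `I_{n+2}`. -/
theorem evenOn_le_perms (n : ℕ) : evenOn (nv (n + 2)) ≤ permsJ (n + 2) ⊤ ∧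
    evenOn (nv (n + 1)) ≤ diagComap (nv (n + 1)) (permsI (n + 2) ⊤) := by
  induction n with
  | zero => exact ⟨evenOn_le_permsJ_two, evenOn_le_diagComap_two⟩
  | succ n ih =>
    have := evenOn_le_permsJ_succ (by omega) ih.1 ih.2
    exact ⟨this, evenOn_le_diagComap (by omega) ih.1 this⟩

/-! ### The sequences `J_∞⁻¹ e J_∞` -/

theorem segJ_prefix {m n : ℕ} (hm : 1 ≤ m) (h : m ≤ n) : segJ m <+: segJ n := by
  induction n, h using Nat.le_induction with
  | base => exact List.prefix_rfl
  | succ k hk ih =>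
    obtain ⟨k, rfl⟩ := Nat.exists_eq_add_of_le' (hm.trans hk)
    exact ih.trans (List.prefix_append _ _)

theorem segJ_prefix_segI {m n : ℕ} (hm : 1 ≤ m) (h : m < n) : segJ m <+: segI n := by
  obtain ⟨k, rfl⟩ := Nat.exists_eq_add_of_le' (show 2 ≤ n by omega)
  exact (segJ_prefix hm (by omega : m ≤ k + 1)).trans (List.prefix_append _ _)

theorem Jinf_eq {n v : ℕ} (hn : 1 ≤ n) (hv : v < (segJ n).length) : Jinf v = (segJ n)[v] := by
  have hlen := segJ_length (n := v + 1) (by omega)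
  have hlt := lt_nv (v + 1)
  have hv' : v < (segJ (v + 1)).length := by omega
  have h1 : Jinf v = (segJ (v + 1))[v] := by simp [Jinf, hv']
  rw [h1]
  rcases le_total n (v + 1) with h | h
  · exact ((segJ_prefix hn h).getElem hv).symm
  · exact (segJ_prefix (by omega) h).getElem hv'

/-- The two-sided sequence `J_∞⁻¹ e J_∞`; the label `e` is at the place `-1`. -/
def limSeq (e : Finset Gen) (k : ℤ) : Finset Gen :=
  if k = -1 then e else if 0 ≤ k then Jinf k.toNat else Jinf (-2 - k).toNat

theorem limSeq_neg_one (e : Finset Gen) : limSeq e (-1) = e := if_pos rfl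

theorem limSeq_natCast (e : Finset Gen) (v : ℕ) : limSeq e v = Jinf v := by
  unfold limSeq
  rw [if_neg (by omega), if_pos (by omega), Int.toNat_natCast]

theorem limSeq_neg (e : Finset Gen) (v : ℕ) : limSeq e (-2 - v) = Jinf v := by
  unfold limSeq
  rw [if_neg (by omega), if_neg (by omega)]
  congr 1; omega

theorem conn_add_three_mul (m k : ℕ) : conn (m + 3 * k) = conn m := by
  simp [conn]

theorem limSeq_mem (m₀ : ℕ) : limSeq (conn m₀) ∈ shiftS := by
  intro i k
  obtain ⟨n, hn⟩ : ∃ n : ℕ, n = i.natAbs + k + 2 := ⟨_, rfl⟩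
  have hn1 : 1 ≤ n := by omega
  have hlen := segJ_length hn1
  have hlt := lt_nv n
  -- the window is contained in `J_n⁻¹ e J_n`, and the latter in `J_{m+1}` if `e = e_m`, `m > n + 1`
  obtain ⟨m, hm⟩ : ∃ m, m = m₀ + 3 * (n + 3) := ⟨_, rfl⟩
  obtain ⟨l, rfl⟩ : ∃ l, m = l + 2 := ⟨m - 2, by omega⟩
  have hconn : conn (l + 2) = conn m₀ := by rw [hm, conn_add_three_mul]
  refine ⟨segJ (l + 3), ⟨l + 3, by omega, Or.inr rfl⟩, ?_⟩
  have hC : (segJ n).reverse ++ conn m₀ :: segJ n <:+: segJ (l + 3) := by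
    obtain ⟨Q, hQ⟩ := segJ_prefix_segI hn1 (show n < l + 2 by omega)
    obtain ⟨P, hP⟩ := segJ_prefix_segI hn1 (show n < l + 1 by omega)
    refine ⟨segJ (l + 1) ++ conn (l + 1) :: P.reverse, Q, ?_⟩
    rw [segJ_succ (l + 1), segI_reverse, segJ_succ l, ← hQ, ← hP, hconn]
    simp
  refine List.IsInfix.trans ?_ hC
  obtain ⟨p, hp⟩ := Int.eq_ofNat_of_zero_le (a := i + nv n) (by omega)
  have hCl : ((segJ n).reverse ++ conn m₀ :: segJ n).length = 2 * nv n - 1 := by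
    simp; omega
  have hCget : ∀ (t : ℕ) (ht : t < ((segJ n).reverse ++ conn m₀ :: segJ n).length),
      ((segJ n).reverse ++ conn m₀ :: segJ n)[t] = limSeq (conn m₀) ((t : ℤ) - nv n) := by
    intro t ht
    rcases lt_trichotomy (t + 1) (nv n) with h | h | h
    · rw [List.getElem_append_left (by simp; omega), List.getElem_reverse,
        ← Jinf_eq hn1, ← limSeq_neg (conn m₀)]
      congr 1
      omega
    · rw [List.getElem_append_right (by simp; omega)]
      have e1 : (t : ℤ) - nv n = -1 := by omega
      have e2 : t - (segJ n).reverse.length = 0 := by simp; omega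
      simp only [e1, e2, limSeq_neg_one, List.getElem_cons_zero]
    · rw [List.getElem_append_right (by simp; omega)]
      have e1 : (t : ℤ) - nv n = ((t - nv n : ℕ) : ℤ) := by omega
      have e2 : t - (segJ n).reverse.length = (t - nv n) + 1 := by simp; omega
      rw [e1, limSeq_natCast]
      simp only [e2, List.getElem_cons_succ]
      rw [Jinf_eq hn1]
  have : (List.ofFn fun j : Fin k => limSeq (conn m₀) (i + (j : ℤ)))
      = (((segJ n).reverse ++ conn m₀ :: segJ n).drop p).take k := by
    refine List.ext_getElem ?_ fun t h1 h2 => ?_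
    · simp only [List.length_ofFn, List.length_take, List.length_drop, hCl]
      omega
    · rw [List.getElem_take, List.getElem_drop, hCget, List.getElem_ofFn]
      congr 1
      push_cast
      omega
  rw [this]
  exact (List.take_prefix _ _).isInfix.trans (List.drop_suffix _ _).isInfix

/-- The beginning of the right half of `J_∞⁻¹ e J_∞`, as a copy of `J_n`. -/
def limCopy (m n : ℕ) (hn : 1 ≤ n) : Copy (segJ n) where
  w := ⟨limSeq (conn m), limSeq_mem m⟩
  start := 0
  sign := 1
  label := by
    have : Occ (limSeq (conn m)) (segJ n) 0 1 := by
      rw [occ_one_iff]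
      intro i hi
      rw [zero_add, limSeq_natCast, Jinf_eq hn hi]
    exact this

theorem limCopy_vertex (m n : ℕ) (hn : 1 ≤ n) (i : ℕ) :
    (limCopy m n hn).vertex i = (⟨limSeq (conn m), limSeq_mem m⟩, (i : ℤ)) := by
  simp [Copy.vertex, limCopy]

/-! ### The action of `H_n` on the tiles -/

theorem exists_perm_of_respects {g : Equiv.Perm Vertex} {X : List (Finset Gen)}
    (h : Respects g X) {N : ℕ} (hN : X.length + 1 = N) :
    ∃ s ∈ symOn N, ∀ φ : Copy X, ∀ i < N, g (φ.vertex i) = φ.vertex (s i) := by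
  by_cases hne : Nonempty (Copy X)
  · obtain ⟨φ₀⟩ := hne
    have h1 : ∀ i : {i // i ∈ Finset.range N}, ∃ j : {i // i ∈ Finset.range N},
        g (φ₀.vertex i) = φ₀.vertex j := by
      rintro ⟨i, hi⟩
      have hi := Finset.mem_range.1 hi
      have : g (φ₀.vertex i) ∈ φ₀.verts := by
        rw [← h.1 φ₀]
        exact ⟨_, ⟨i, ⟨Nat.zero_le _, by omega⟩, rfl⟩, rfl⟩
      obtain ⟨j, ⟨-, hj⟩, e⟩ := this
      exact ⟨⟨j, Finset.mem_range.2 (by omega)⟩, e.symm⟩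
    choose f hf using h1
    have hinj : Function.Injective f := by
      intro i j hij
      have := hf i
      rw [hij, ← hf j] at this
      exact Subtype.ext (φ₀.vertex_inj (g.injective this))
    let e := Equiv.ofBijective f (Finite.injective_iff_bijective.1 hinj)
    refine ⟨Equiv.Perm.ofSubtype e, fun i hi => Equiv.Perm.ofSubtype_apply_of_not_mem _ (by simpa),
      fun φ i hi => ?_⟩
    have hi' : i ∈ Finset.range N := Finset.mem_range.2 hi
    rw [Equiv.Perm.ofSubtype_apply_of_mem _ hi']
    have hlt := Finset.mem_range.1 (f ⟨i, hi'⟩).2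
    exact h.2 φ₀ φ i (by omega) (f ⟨i, hi'⟩) (by omega) (hf ⟨i, hi'⟩)
  · exact ⟨1, one_mem _, fun φ => absurd ⟨φ⟩ hne⟩

theorem exists_acts_of_mem_H {n : ℕ} (hn : 1 ≤ n) {g : Ghat} (hg : g ∈ H n) :
    ∃ s t, Acts n (g : Equiv.Perm Vertex) s t := by
  obtain ⟨s, hs, h1⟩ := exists_perm_of_respects hg.2.1 (segJ_length hn)
  obtain ⟨t, ht, h2⟩ := exists_perm_of_respects hg.1 (segI_length hn)
  exact ⟨s, t, hs, ht, h1, h2⟩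

theorem image_eq_of_fixed {g : Equiv.Perm Vertex} {S : Set Vertex} (h : ∀ v ∈ S, g v = v) :
    g '' S = S := by
  rw [Set.image_congr h, Set.image_id']

theorem mem_H_of_acts {n : ℕ} (hn : 1 ≤ n) {g : Ghat} {s : Equiv.Perm ℕ}
    (hg : Acts n (g : Equiv.Perm Vertex) s 1) : g ∈ H n := by
  have hI := segI_length hn
  have hJ := segJ_length hn
  have hfix : ∀ φ : Copy (segI n), ∀ k l, l ≤ (segI n).length →
      (g : Equiv.Perm Vertex) '' φ.part k l = φ.part k l := by
    intro φ k l hl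
    refine image_eq_of_fixed ?_
    rintro _ ⟨i, ⟨-, hi⟩, rfl⟩
    exact hg.actI φ i (by omega)
  refine ⟨⟨fun φ => hfix φ 0 _ le_rfl, fun φ ψ i hi j hj e => ?_⟩,
    ⟨fun φ => ?_, fun φ ψ i hi j hj e => ?_⟩, fun φ => ⟨hfix φ _ _ ?_, hfix φ _ _ le_rfl⟩⟩
  · have := φ.vertex_inj ((hg.actI φ i (by omega)).symm.trans e)
    rw [hg.actI ψ i (by omega), this]
  · ext v
    constructor
    · rintro ⟨_, ⟨i, ⟨-, hi⟩, rfl⟩, rfl⟩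
      rw [hg.actJ φ i (by omega)]
      have := symOn_lt hg.symJ (i := i) (by omega)
      exact ⟨_, ⟨Nat.zero_le _, by omega⟩, rfl⟩
    · rintro ⟨i, ⟨-, hi⟩, rfl⟩
      have := symOn_lt (inv_mem hg.symJ) (i := i) (by omega)
      refine ⟨_, ⟨s⁻¹ i, ⟨Nat.zero_le _, by omega⟩, rfl⟩, ?_⟩
      rw [hg.actJ φ _ this]
      simp
  · have := φ.vertex_inj ((hg.actJ φ i (by omega)).symm.trans e)
    rw [hg.actJ ψ i (by omega), this]
  · rcases Nat.eq_or_lt_of_le hn with rfl | hn2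
    · change 0 ≤ _; exact Nat.zero_le _
    · have := segJ_length (n := n - 1) (by omega)
      have := nv_mono (show n - 1 ≤ n by omega)
      omega

instance A_normal : A.Normal := Subgroup.normalClosure_normal

/-- The group `A` contains all even permutations of the copies of `J_n`: three-cycles are
commutators. -/
theorem evenOn_le_permsJ_A {n : ℕ} (hn : 2 ≤ n) : evenOn (nv n) ≤ permsJ n A := by
  have h8 := eight_le_nv hn
  refine evenOn_le_of_fullOn fun a ha b hb c hc hab hac hbc => ?_
  obtain ⟨m, rfl⟩ := Nat.exists_eq_add_of_le' hn
  obtain ⟨y, hy, hya, hyb, hyc, -⟩ := exists_notMem_four (N := nv (m + 2)) (by omega) a b c c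
  obtain ⟨w, hw, hwa, hwb, hwc, hwy⟩ := exists_notMem_four (N := nv (m + 2)) (by omega) a b c y
  obtain ⟨g, -, hg⟩ := (evenOn_le_perms m).1 (c3_mem_evenOn ha hb hy hab hya.symm hyb.symm)
  obtain ⟨k, -, hk⟩ := (evenOn_le_perms m).1 (c3_mem_evenOn ha hc hw hac hwa.symm hwc.symm)
  refine ⟨⁅g, k⁆, Subgroup.subset_normalClosure (Subgroup.commutator_mem_commutator
    ⟨m + 2, hn, mem_H_of_acts (by omega) hg⟩ ⟨m + 2, hn, mem_H_of_acts (by omega) hk⟩), ?_⟩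
  have := hg.comm hk
  rw [conj_comm_eq (c3 a b y), c3_conj, c3_apply_left hac hwa.symm,
    c3_apply_of_ne hab.symm hbc hwb.symm, c3_apply_of_ne hya hyc hwy.symm,
    c3_mul_inv hac hab hya.symm hbc.symm hyc.symm hyb.symm] at this
  simpa [commutatorElement_def] using this

/-- A subgroup that contains the even permutations of the copies of `J_n` and `J_{n+1}` contains
every element that acts by even permutations on the tiles of level `n`. -/
theorem mem_of_acts_even {n : ℕ} (hn : 1 ≤ n) {B : Subgroup Ghat}
    (h1 : evenOn (nv n) ≤ permsJ n B) (h2 : evenOn (nv (n + 1)) ≤ permsJ (n + 1) B) {g : Ghat}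
    {s t : Equiv.Perm ℕ} (hg : Acts n (g : Equiv.Perm Vertex) s t) (hs : s ∈ evenOn (nv n))
    (ht : t ∈ evenOn (nv n)) : g ∈ B := by
  have hle := evenOn_mono (nv_mono (show n ≤ n + 1 by omega))
  obtain ⟨k, hk, hk'⟩ := h2 (mul_mem (hle hs) (flipOn_mem_evenOn (hle ht)))
  obtain ⟨-, l, hl, hl'⟩ := evenOn_le_diagComap hn h1 h2 hs
  have h3 := hk'.mul hl'
  rw [mul_one, one_mul, ← nv_succ] at h3
  have h4 : g = k * l := Subtype.ext ((hg.up hn).unique (by omega) h3)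
  rw [h4]
  exact mul_mem hk hl

theorem mem_A_of_acts_even {n : ℕ} (hn : 2 ≤ n) {g : Ghat} {s t : Equiv.Perm ℕ}
    (hg : Acts n (g : Equiv.Perm Vertex) s t) (hs : s ∈ evenOn (nv n))
    (ht : t ∈ evenOn (nv n)) : g ∈ A :=
  mem_of_acts_even (by omega) (evenOn_le_permsJ_A hn) (evenOn_le_permsJ_A (by omega)) hg hs ht

/-! ### Simplicity -/

/-- Induction over words in the labels. -/
theorem Ghat_induction {p : Ghat → Prop} (one : p 1) (mul : ∀ s g, p g → p (gen s * g)) (g : Ghat) :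
    p g := by
  obtain ⟨g, hg⟩ := g
  refine Subgroup.closure_induction_left (p := fun g hg => p ⟨g, hg⟩) one ?_ ?_ hg
  · rintro _ ⟨s, rfl⟩ y hy h
    exact mul s ⟨y, hy⟩ h
  · rintro _ ⟨s, rfl⟩ y hy h
    exact mul s ⟨y, hy⟩ h

/-- The action of an element of the group on a vertex depends only on a neighborhood of bounded
radius. -/
theorem exists_radius (g : Ghat) : ∃ r : ℕ, ∀ (X : List (Finset Gen)) (i : ℕ), r ≤ i →
    i + r ≤ X.length → ∃ j, i ≤ j + r ∧ j ≤ i + r ∧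
      ∀ φ : Copy X, (g : Equiv.Perm Vertex) (φ.vertex i) = φ.vertex j := by
  induction g using Ghat_induction with
  | one => exact ⟨0, fun X i _ _ => ⟨i, by omega, by omega, fun φ => rfl⟩⟩
  | mul s g ih =>
    obtain ⟨r, hr⟩ := ih
    refine ⟨r + 1, fun X i h1 h2 => ?_⟩
    obtain ⟨j, hj1, hj2, hj⟩ := hr X i (by omega) (by omega)
    have hb : j ≤ chainStep X s j + 1 ∧ chainStep X s j ≤ j + 1 := by
      unfold chainStep; split_ifs <;> omega
    refine ⟨chainStep X s j, by omega, by omega, fun φ => ?_⟩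
    rw [Subgroup.coe_mul, Equiv.Perm.mul_apply, hj φ, coe_gen,
      φ.genPerm_vertex s (by omega) (by omega)]

/-- The copy of `X` in a copy of `L X M`. -/
def Copy.sub {L X M : List (Finset Gen)} (φ : Copy (L ++ X ++ M)) : Copy X where
  w := φ.w
  start := φ.start + φ.sign * (L.length : ℤ)
  sign := φ.sign
  label i hi := by
    have h := φ.label (L.length + i) (by simp; omega)
    rw [List.getElem_append_left (by simp; omega), List.getElem_append_right (by omega)] at h
    simp only [Nat.add_sub_cancel_left] at h
    rw [← h]
    push_cast
    ring_nf

theorem Copy.sub_vertex {L X M : List (Finset Gen)} (φ : Copy (L ++ X ++ M)) (i : ℕ) :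
    φ.sub.vertex i = φ.vertex (L.length + i) := by
  unfold Copy.vertex Copy.sub
  push_cast
  congr 1; ring

/-- A non-trivial element moves some vertex of `J_n` within `J_n`, in all copies in the same way,
if `n` is large. -/
theorem exists_moved {g : Ghat} (hg : g ≠ 1) : ∃ n p q, 2 ≤ n ∧ p < nv n ∧ q < nv n ∧ p ≠ q ∧
    ∀ φ : Copy (segJ n), (g : Equiv.Perm Vertex) (φ.vertex p) = φ.vertex q := by
  obtain ⟨⟨w, k⟩, hv⟩ : ∃ v, (g : Equiv.Perm Vertex) v ≠ v := by
    by_contra! h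
    exact hg (Subtype.ext (Equiv.ext h))
  obtain ⟨r, hr⟩ := exists_radius g
  obtain ⟨L, ⟨m, hm, hL⟩, P, Q, hPQ⟩ := w.2 (k - r) (2 * r)
  set X := List.ofFn fun j : Fin (2 * r) => w.1 (k - r + (j : ℤ)) with hX
  have hXl : X.length = 2 * r := by simp [hX]
  obtain ⟨j, hj1, hj2, hj⟩ := hr X r le_rfl (by omega)
  have hocc : Occ w.1 X (k - r) 1 := by
    rw [occ_one_iff]
    intro i hi
    simp [hX]
  let φ₀ : Copy X := ⟨w, k - r, 1, hocc⟩
  have hφ₀ : φ₀.vertex r = (w, k) := by simp [φ₀, Copy.vertex]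
  have hjr : j ≠ r := by
    rintro rfl
    have := hj φ₀
    rw [hφ₀] at this
    exact hv this
  have hlen : P.length + 2 * r + Q.length = L.length := by
    rw [← hPQ]; simp [hXl, add_assoc]
  have hJ := segJ_length hm
  have hI := segI_length hm
  obtain ⟨m, rfl⟩ := Nat.exists_eq_add_of_le' hm
  have hN : nv (m + 2) = 2 * nv (m + 1) := nv_succ _
  rcases hL with rfl | rfl
  · refine ⟨m + 2, 2 * nv (m + 1) - 1 - (P.length + r), 2 * nv (m + 1) - 1 - (P.length + j),
      by omega, by omega, by omega, by omega, fun φ => ?_⟩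
    let ψ : Copy (segJ (m + 1) ++ conn (m + 1) :: (segI (m + 1)).reverse) := φ
    have key : ∀ χ : Copy (P ++ X ++ Q), (g : Equiv.Perm Vertex) (χ.vertex (P.length + r))
        = χ.vertex (P.length + j) := fun χ => by
      rw [← χ.sub_vertex, ← χ.sub_vertex]; exact hj χ.sub
    rw [hPQ] at key
    have := key ψ.right
    have e : (segJ (m + 1)).length + 1 + (segI (m + 1)).length = 2 * nv (m + 1) - 1 := by omega
    rwa [ψ.right_vertex (by omega), ψ.right_vertex (by omega), e] at this
  · refine ⟨m + 2, P.length + r, P.length + j,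
      by omega, by omega, by omega, by omega, fun φ => ?_⟩
    let ψ : Copy (segJ (m + 1) ++ conn (m + 1) :: (segI (m + 1)).reverse) := φ
    have key : ∀ χ : Copy (P ++ X ++ Q), (g : Equiv.Perm Vertex) (χ.vertex (P.length + r))
        = χ.vertex (P.length + j) := fun χ => by
      rw [← χ.sub_vertex, ← χ.sub_vertex]; exact hj χ.sub
    rw [hPQ] at key
    exact key ψ.left

section Normalized
variable {B : Subgroup Ghat} (hB : ∀ x ∈ A, ∀ y ∈ B, x * y * x⁻¹ ∈ B)
include hB

theorem permsJ_normalized {n : ℕ} (hn : 2 ≤ n) :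
    ∀ e ∈ evenOn (nv n), ∀ s ∈ permsJ n B, e * s * e⁻¹ ∈ permsJ n B := by
  intro e he s hs
  obtain ⟨a, ha, ha'⟩ := evenOn_le_permsJ_A hn he
  exact permsJ_conj_acts (hB a ha) hs ha'

/-- A non-trivial subgroup normalized by `A` contains the even permutations of the copies of `J_n`
for some `n`. -/
theorem exists_evenOn_le_permsJ {g : Ghat} (hg : g ∈ B) (hg1 : g ≠ 1) :
    ∃ n, 2 ≤ n ∧ evenOn (nv n) ≤ permsJ n B := by
  obtain ⟨n, p, q, hn, hp, hq, hpq, hmove⟩ := exists_moved hg1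
  obtain ⟨n, rfl⟩ := Nat.exists_eq_add_of_le' (show 1 ≤ n by omega)
  obtain ⟨N, hN⟩ : ∃ N, nv (n + 1) = N := ⟨_, rfl⟩
  have hN4 : 4 ≤ N := hN ▸ four_le_nv (by omega)
  have hNN : nv (n + 3) = 4 * N := by rw [nv_succ, nv_succ, hN]; ring
  have hJ1 : (segJ (n + 1)).length = N - 1 := by
    have := (seg_length n).2; omega
  have hJ2 : (segJ (n + 2)).length = 2 * N - 1 := by
    have : (segJ (n + 2)).length + 1 = nv (n + 2) := (seg_length (n + 1)).2
    rw [nv_succ, hN] at this; omega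
  have hI2 : (segI (n + 2)).length = 2 * N - 1 := by
    have : (segI (n + 2)).length + 1 = nv (n + 2) := (seg_length (n + 1)).1
    rw [nv_succ, hN] at this; omega
  rw [hN] at hp hq
  -- three disjoint copies of `J_{n+1}` in `J_{n+3}`
  have hmove3 : ∀ φ : Copy (segJ (n + 3)),
      (g : Equiv.Perm Vertex) (φ.vertex p) = φ.vertex q ∧
      (g : Equiv.Perm Vertex) (φ.vertex (2 * N + p)) = φ.vertex (2 * N + q) ∧
      (g : Equiv.Perm Vertex) (φ.vertex (4 * N - 1 - p)) = φ.vertex (4 * N - 1 - q) := by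
    intro φ
    let ψ : Copy (segJ (n + 2) ++ conn (n + 2) :: (segI (n + 2)).reverse) := φ
    let χ : Copy (segJ (n + 1) ++ conn (n + 1) :: (segJ (n + 1)).reverse) := ψ.right
    let ω : Copy (segJ (n + 1) ++ conn (n + 1) :: (segI (n + 1)).reverse) := ψ.left
    have e1 : ∀ i, i < 2 * N → χ.vertex i = φ.vertex (4 * N - 1 - i) := by
      intro i hi
      refine (ψ.right_vertex (by omega)).trans ?_
      rw [hJ2, hI2]
      congr 1; omega
    have e2 : ∀ i, i < N → χ.right.vertex i = φ.vertex (2 * N + i) := by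
      intro i hi
      rw [χ.right_vertex (by omega), e1 _ (by omega), hJ1]
      congr 1; omega
    refine ⟨hmove ω.left, ?_, ?_⟩
    · rw [← e2 p hp, ← e2 q hq]; exact hmove χ.right
    · rw [← e1 p (by omega), ← e1 q (by omega)]; exact hmove χ.left
  refine ⟨n + 3, by omega, ?_⟩
  have hA := evenOn_le_permsJ_A (n := n + 3) (by omega)
  obtain ⟨α, hα, hα'⟩ := hA (c3_mem_evenOn (a := p) (b := 2 * N + p) (c := 4 * N - 1 - p) (by omega)
    (by omega) (by omega) (by omega) (by omega) (by omega))
  obtain ⟨k, hk, hk'⟩ := hA (c3_mem_evenOn (a := p) (b := N) (c := N + 1) (by omega)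
    (by omega) (by omega) (by omega) (by omega) (by omega))
  let π : Equiv.Perm ℕ := Equiv.swap p q * Equiv.swap (2 * N + p) (2 * N + q) *
    Equiv.swap (4 * N - 1 - p) (4 * N - 1 - q)
  have hπ : π ∈ symOn (nv (n + 3)) :=
    mul_mem (mul_mem (swap_mem_symOn (by omega) (by omega)) (swap_mem_symOn (by omega) (by omega)))
      (swap_mem_symOn (by omega) (by omega))
  have hsw : ∀ a b x : ℕ, x ≠ a → x ≠ b → Equiv.swap a b x = x :=
    fun _ _ _ => Equiv.swap_apply_of_ne_of_ne
  have π1 : π p = q := by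
    simp only [π, Equiv.Perm.mul_apply]
    rw [hsw (4 * N - 1 - p) _ _ (by omega) (by omega), hsw (2 * N + p) _ _ (by omega) (by omega),
      Equiv.swap_apply_left]
  have π2 : π (2 * N + p) = 2 * N + q := by
    simp only [π, Equiv.Perm.mul_apply]
    rw [hsw (4 * N - 1 - p) _ _ (by omega) (by omega), Equiv.swap_apply_left,
      hsw _ _ _ (by omega) (by omega)]
  have π3 : π (4 * N - 1 - p) = 4 * N - 1 - q := by
    simp only [π, Equiv.Perm.mul_apply]
    rw [Equiv.swap_apply_left, hsw (2 * N + p) _ _ (by omega) (by omega),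
      hsw _ _ _ (by omega) (by omega)]
  have hconj := hα'.conj (g := (g : Equiv.Perm Vertex)) (q := 1) (by omega) hπ (one_mem _)
    (fun φ i hi hsi => by
      have hi3 : i = p ∨ i = 2 * N + p ∨ i = 4 * N - 1 - p := by
        by_contra! hcon
        exact hsi (c3_apply_of_ne hcon.1 hcon.2.1 hcon.2.2)
      rcases hi3 with rfl | rfl | rfl
      · rw [π1]; exact (hmove3 φ).1
      · rw [π2]; exact (hmove3 φ).2.1
      · rw [π3]; exact (hmove3 φ).2.2)
    (fun _ _ _ h0 => absurd rfl h0)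
  rw [c3_conj, π1, π2, π3] at hconj
  have hν := hconj.mul hα'.inv
  have hνB : g * α * g⁻¹ * α⁻¹ ∈ B := by
    have := mul_mem hg (hB α hα _ (inv_mem hg))
    rwa [show g * (α * g⁻¹ * α⁻¹) = g * α * g⁻¹ * α⁻¹ by group] at this
  have hcomm := (hν.mul hk').mul hν.inv |>.mul hk'.inv
  rw [c3_conj] at hcomm
  simp only [Equiv.Perm.mul_apply] at hcomm
  rw [c3_inv p, c3_apply_right,
    c3_apply_of_ne (x := 4 * N - 1 - p) (by omega) (by omega) (by omega),
    c3_apply_of_ne (x := N) (by omega) (by omega) (by omega),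
    c3_apply_of_ne (x := N) (by omega) (by omega) (by omega),
    c3_apply_of_ne (x := N + 1) (by omega) (by omega) (by omega),
    c3_apply_of_ne (x := N + 1) (by omega) (by omega) (by omega),
    c3_mul_inv (by omega) (by omega) (by omega) (by omega) (by omega) (by omega)] at hcomm
  refine evenOn_le_of_c3_mem (by omega) (permsJ_normalized hB (by omega))
    (a := 4 * N - 1 - p) (b := N) (c := p) (by omega) (by omega) (by omega) (by omega)
    ⟨(g * α * g⁻¹ * α⁻¹) * k * (g * α * g⁻¹ * α⁻¹)⁻¹ * k⁻¹, ?_, ?_⟩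
  · have := mul_mem hνB (hB k hk _ (inv_mem hνB))
    rwa [show ∀ x : Ghat, x * (k * x⁻¹ * k⁻¹) = x * k * x⁻¹ * k⁻¹ from fun x => by group] at this
  · have hone : (1 * 1 * 1⁻¹ * 1⁻¹ * 1 * (1 * 1 * 1⁻¹ * 1⁻¹)⁻¹ * 1⁻¹ : Equiv.Perm ℕ) = 1 := by group
    rw [hone] at hcomm
    exact hcomm

theorem evenOn_le_permsJ_up {n : ℕ} (hn : 2 ≤ n) (h : evenOn (nv n) ≤ permsJ n B) :
    evenOn (nv (n + 1)) ≤ permsJ (n + 1) B := by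
  have h8 := eight_le_nv hn
  have h16 := nv_succ n
  obtain ⟨g, hg, hg'⟩ := h (c3_mem_evenOn (a := 0) (b := 1) (c := 2) (by omega) (by omega)
    (by omega) (by omega) (by omega) (by omega))
  obtain ⟨k, hk, hk'⟩ := evenOn_le_permsJ_A (n := n + 1) (by omega) (c3_mem_evenOn (a := 0) (b := 3)
    (c := 4) (by omega) (by omega) (by omega) (by omega) (by omega) (by omega))
  have hcomm := (hg'.up (by omega)).comm hk'
  rw [map_one, mul_one, c3_conj, c3_apply_left (by omega) (by omega),
    c3_apply_of_ne (x := 3) (by omega) (by omega) (by omega),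
    c3_apply_of_ne (x := 4) (by omega) (by omega) (by omega),
    c3_mul_inv (by omega) (by omega) (by omega) (by omega) (by omega) (by omega), mul_one,
    mul_inv_cancel, one_mul, inv_one] at hcomm
  refine evenOn_le_of_c3_mem (by omega) (permsJ_normalized hB (by omega))
    (a := 1) (b := 3) (c := 0) (by omega) (by omega) (by omega) (by omega)
    ⟨g * k * g⁻¹ * k⁻¹, ?_, hcomm⟩
  have := mul_mem hg (hB k hk _ (inv_mem hg))
  rwa [show g * (k * g⁻¹ * k⁻¹) = g * k * g⁻¹ * k⁻¹ by group] at this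

/-- A non-trivial subgroup normalized by `A` contains the derived subgroup of `H_∞`. -/
theorem commutator_Hinf_le {g : Ghat} (hg : g ∈ B) (hg1 : g ≠ 1) : ⁅Hinf, Hinf⁆ ≤ B := by
  obtain ⟨m, hm, hrich⟩ := exists_evenOn_le_permsJ hB hg hg1
  have hall : ∀ n, m ≤ n → evenOn (nv n) ≤ permsJ n B := by
    intro n hmn
    induction n, hmn using Nat.le_induction with
    | base => exact hrich
    | succ n hn ih => exact evenOn_le_permsJ_up hB (hm.trans hn) ih
  rw [Subgroup.commutator_le]
  rintro x ⟨i, hi, hx⟩ y ⟨j, hj, hy⟩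
  obtain ⟨n, hn⟩ : ∃ n, n = max m (max i j) := ⟨_, rfl⟩
  obtain ⟨s, t, hx'⟩ := exists_acts_of_mem_H (by omega)
    (H_mono (by omega) (show i ≤ n by omega) hx)
  obtain ⟨s', t', hy'⟩ := exists_acts_of_mem_H (by omega)
    (H_mono (by omega) (show j ≤ n by omega) hy)
  exact mem_of_acts_even (by omega) (hall n (by omega)) (hall (n + 1) (by omega))
    (g := ⁅x, y⁆) (hx'.comm hy') (commutator_mem_evenOn hx'.symJ hy'.symJ)
    (commutator_mem_evenOn hx'.symI hy'.symI)

/-- A non-trivial subgroup normalized by `A` contains `A`. -/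
theorem A_le {g : Ghat} (hg : g ∈ B) (hg1 : g ≠ 1) : A ≤ B := by
  rw [A, Subgroup.normalClosure, Subgroup.closure_le]
  intro x hx
  obtain ⟨s, hs, hsx⟩ := Group.mem_conjugatesOfSet_iff.1 hx
  obtain ⟨y, rfl⟩ := isConj_iff.1 hsx
  -- the subgroup `y⁻¹ B y` has the same properties as `B`
  have hle : ⁅Hinf, Hinf⁆ ≤ B.comap (MulAut.conj y).toMonoidHom := by
    refine commutator_Hinf_le (g := y⁻¹ * g * y) (fun u hu v hv => ?_) ?_ ?_
    · have h1 := hB _ (A_normal.conj_mem u hu y) _ hv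
      simp only [Subgroup.mem_comap, MulEquiv.toMonoidHom_eq_coe, MonoidHom.coe_coe,
        MulAut.conj_apply] at h1 ⊢
      convert h1 using 1
      group
    · simp only [Subgroup.mem_comap, MulEquiv.toMonoidHom_eq_coe, MonoidHom.coe_coe,
        MulAut.conj_apply]
      convert hg using 1
      group
    · intro h0
      apply hg1
      have : g = y * (y⁻¹ * g * y) * y⁻¹ := by group
      rw [this, h0]; group
  exact hle hs

end Normalized

theorem A_simple : IsSimpleGroup A := by
  refine { exists_pair_ne := ?_, eq_bot_or_eq_top_of_normal := fun N hN => ?_ }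
  · obtain ⟨g, hg, hg'⟩ := evenOn_le_permsJ_A (n := 2) le_rfl (c3_mem_evenOn (a := 0) (b := 1)
      (c := 2) (by decide) (by decide) (by decide) (by omega) (by omega) (by omega))
    refine ⟨⟨g, hg⟩, 1, fun h => ?_⟩
    have h1 : g = 1 := congrArg Subtype.val h
    rw [h1] at hg'
    have h2 := hg'.actJ (limCopy 0 2 (by omega)) 0 (by decide)
    rw [c3_apply_left (by omega) (by omega)] at h2
    have := Copy.vertex_inj _ h2
    omega
  · by_cases hbot : N = ⊥
    · exact Or.inl hbot
    · right
      obtain ⟨⟨g, hgA⟩, hg, hg1⟩ := N.bot_or_exists_ne_one.resolve_left hbot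
      have hle : A ≤ N.map A.subtype := by
        refine A_le (g := g) (fun x hx y hy => ?_) ⟨_, hg, rfl⟩ fun h => hg1 (Subtype.ext h)
        obtain ⟨y, hy, rfl⟩ := hy
        exact ⟨⟨x, hx⟩ * y * ⟨x, hx⟩⁻¹, hN.conj_mem y hy _, rfl⟩
      rw [eq_top_iff]
      rintro x -
      obtain ⟨y, hy, hyx⟩ := hle x.2
      rwa [← Subtype.ext hyx]

/-! ### Finiteness of the index -/

/-- The labels `b`, `c`, `d` commute, since they act on disjoint connecting edges. -/
theorem genPerm_comm_bcd {x y : Gen} (hx : x = b ∨ x = c ∨ x = d) (hy : y = b ∨ y = c ∨ y = d) :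
    genPerm x * genPerm y = genPerm y * genPerm x := by
  ext1 v
  obtain ⟨w, k⟩ := v
  have hA : ∀ {z : Gen}, (z = b ∨ z = c ∨ z = d) → ∀ {S : Finset Gen},
      (S = {a0} ∨ S = {a1} ∨ S = {a2}) → z ∉ S := by
    rintro z (rfl | rfl | rfl) S (rfl | rfl | rfl) <;> decide
  change (w, step w.1 x (step w.1 y k)) = (w, step w.1 y (step w.1 x k))
  congr 1
  have h1 := label_alternate w.2 (k - 1)
  rw [sub_add_cancel] at h1
  have hne : ∀ S : Finset Gen, (S = {a0} ∨ S = {a1} ∨ S = {a2}) → ∀ m, S ≠ conn m := by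
    rintro S hS m rfl
    have := conn_ne m
    tauto
  rcases h1 with ⟨h0, m, h1⟩ | ⟨⟨m, h0⟩, h1⟩
  · have h2 : w.1 (k + 1) = {a0} ∨ w.1 (k + 1) = {a1} ∨ w.1 (k + 1) = {a2} := by
      rcases label_alternate w.2 k with h | h
      · exact absurd h1 (hne _ h.1 m)
      · exact h.2
    have x0 := hA hx h0
    have y0 := hA hy h0
    have x2 := hA hx h2
    have y2 := hA hy h2
    by_cases hx1 : x ∈ w.1 k <;> by_cases hy1 : y ∈ w.1 k <;> simp [step, x0, y0, x2, y2, hx1, hy1]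
  · have h2 : w.1 (k - 1 - 1) = {a0} ∨ w.1 (k - 1 - 1) = {a1} ∨ w.1 (k - 1 - 1) = {a2} := by
      have := label_alternate w.2 (k - 1 - 1)
      rw [sub_add_cancel] at this
      rcases this with h | h
      · exact h.1
      · exact absurd h0 (hne _ h.2 m)
    have x0 := hA hx h1
    have y0 := hA hy h1
    have x2 := hA hx h2
    have y2 := hA hy h2
    by_cases hx1 : x ∈ w.1 (k - 1) <;> by_cases hy1 : y ∈ w.1 (k - 1) <;>
      simp [step, x0, y0, x2, y2, hx1, hy1]

theorem mk_comm_of_mem {g h : Ghat} (hgh : g * h * g⁻¹ * h⁻¹ ∈ A) :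
    (g : Ghat ⧸ A) * h = h * g := by
  rw [← QuotientGroup.eq_one_iff] at hgh
  have : ((g * h * g⁻¹ * h⁻¹ : Ghat) : Ghat ⧸ A)
      = (g : Ghat ⧸ A) * h * (g : Ghat ⧸ A)⁻¹ * (h : Ghat ⧸ A)⁻¹ := rfl
  rw [this] at hgh
  rwa [mul_inv_eq_one, mul_inv_eq_iff_eq_mul] at hgh

/-- Modulo `A`, the label `a₂` can be replaced by an element that moves no end of a tile. -/
theorem exists_eq_a2 : ∃ t : Ghat, (t : Ghat ⧸ A) = gen a2 ∧
    Acts 2 (t : Equiv.Perm Vertex) 1 (Equiv.swap 1 2 * Equiv.swap 5 6) := by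
  have hs {p q : ℕ} (hp : p < 8) (hq : q < 8) : Equiv.swap p q ∈ symOn 8 := swap_mem_symOn hp hq
  have hJ : Equiv.swap 0 1 * Equiv.swap 6 7 ∈ evenOn (nv 2) := by
    have h1 := commutator_mem_evenOn (hs (p := 0) (q := 1) (by omega) (by omega))
      (mul_mem (hs (p := 0) (q := 6) (by omega) (by omega))
        (hs (p := 1) (q := 7) (by omega) (by omega)))
    rwa [conj_comm_eq, ← Equiv.swap_apply_apply, Equiv.swap_inv,
      show (Equiv.swap 0 6 * Equiv.swap 1 7 : Equiv.Perm ℕ) 0 = 6 by decide,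
      show (Equiv.swap 0 6 * Equiv.swap 1 7 : Equiv.Perm ℕ) 1 = 7 by decide] at h1
  have hI : c3 0 1 2 ∈ evenOn (nv 1) := c3_mem_evenOn (by decide) (by decide) (by decide)
    (by omega) (by omega) (by omega)
  obtain ⟨g, -, hg⟩ := (evenOn_le_perms 0).1 hJ
  obtain ⟨-, k, -, hk⟩ := (evenOn_le_perms 0).2 hI
  have hgA : g ∈ A := mem_A_of_acts_even le_rfl hg hJ (one_mem _)
  have hI2 : c3 0 1 2 ∈ evenOn (nv 2) := evenOn_mono (nv_mono (by omega)) hI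
  have hkA : k ∈ A := mem_A_of_acts_even le_rfl hk (one_mem _)
    (mul_mem hI2 (by rw [zero_add, ← nv_succ]; exact flipOn_mem_evenOn hI2))
  refine ⟨gen a2 * (k * g), ?_, ?_⟩
  · rw [QuotientGroup.mk_mul, (QuotientGroup.eq_one_iff _).2 (mul_mem hkA hgA), mul_one]
  · have h1 := acts_a2.mul (hk.mul hg)
    have e1 : Equiv.swap 0 1 * Equiv.swap 6 7 * (1 * (Equiv.swap 0 1 * Equiv.swap 6 7)) = 1 :=
      symOn_ext h1.symJ (one_mem (symOn 8)) (by decide)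
    have e2 : flipOn (2 * nv (0 + 1)) (c3 0 1 2) = c3 7 6 5 :=
      flipOn_c3 (N := 2 * nv (0 + 1)) (by decide) (by decide) (by decide)
    have e3 : Equiv.swap 0 1 * Equiv.swap 6 7 * (c3 0 1 2 * flipOn (2 * nv (0 + 1)) (c3 0 1 2) * 1)
        = Equiv.swap 1 2 * Equiv.swap 5 6 := by
      refine symOn_ext h1.symI (mul_mem (hs (by omega) (by omega)) (hs (by omega) (by omega))) ?_
      rw [e2]
      decide
    rw [e1, e3] at h1
    exact h1

/-- The images of the labels in the quotient by `A` commute. -/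
theorem mk_gen_comm (x y : Gen) : (gen x : Ghat ⧸ A) * gen y = gen y * gen x := by
  have hcomm : ∀ {g h : Ghat} {s t s' t' : Equiv.Perm ℕ}, Acts 2 (g : Equiv.Perm Vertex) s t →
      Acts 2 (h : Equiv.Perm Vertex) s' t' → (g : Ghat ⧸ A) * h = h * g := fun hg hh =>
    mk_comm_of_mem (mem_A_of_acts_even le_rfl (hg.comm hh) (commutator_mem_evenOn hg.symJ hh.symJ)
      (commutator_mem_evenOn hg.symI hh.symI))
  have hcommK : ∀ {g : Ghat} {x : Gen} {s t : Equiv.Perm ℕ}, (x = b ∨ x = c ∨ x = d) →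
      Acts 2 (g : Equiv.Perm Vertex) s t → s 0 = 0 → s 7 = 7 → t 0 = 0 → t 7 = 7 →
      (g : Ghat ⧸ A) * gen x = gen x * g := by
    intro g x s t hx hg h0 h7 k0 k7
    exact mk_comm_of_mem (mem_A_of_acts_even le_rfl (acts_two_comm hx hg h0 h7 k0 k7)
      (commutator_mem_evenOn hg.symJ (innerPerm_mem_symOn x))
      (commutator_mem_evenOn hg.symI (innerPerm_mem_symOn x)))
  have hacts : ∀ x, (x = a0 ∨ x = a1 ∨ x = a2) → ∃ s t, Acts 2 (genPerm x) s t := by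
    rintro x (rfl | rfl | rfl)
    · exact ⟨_, _, acts_a0⟩
    · exact ⟨_, _, acts_a1⟩
    · exact ⟨_, _, acts_a2⟩
  have hmix : ∀ x y, (x = a0 ∨ x = a1 ∨ x = a2) → (y = b ∨ y = c ∨ y = d) →
      (gen x : Ghat ⧸ A) * gen y = gen y * gen x := by
    rintro x y (rfl | rfl | rfl) hy
    · exact hcommK (g := gen a0) hy acts_a0 (by decide) (by decide) (by decide) (by decide)
    · exact hcommK (g := gen a1) hy acts_a1 (by decide) (by decide) (by decide) (by decide)
    · obtain ⟨t, ht, ht'⟩ := exists_eq_a2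
      rw [← ht]
      exact hcommK hy ht' (by decide) (by decide) (by decide) (by decide)
  have hsplit : ∀ x : Gen, (x = a0 ∨ x = a1 ∨ x = a2) ∨ (x = b ∨ x = c ∨ x = d) := by
    intro x; cases x <;> simp
  rcases hsplit x with hx | hx <;> rcases hsplit y with hy | hy
  · obtain ⟨s, t, h1⟩ := hacts x hx
    obtain ⟨s', t', h2⟩ := hacts y hy
    exact hcomm (g := gen x) (h := gen y) h1 h2
  · exact hmix x y hx hy
  · exact (hmix y x hy hx).symm
  · have : gen x * gen y = gen y * gen x := Subtype.ext (genPerm_comm_bcd hx hy)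
    rw [← QuotientGroup.mk_mul, this, QuotientGroup.mk_mul]

theorem closure_range_gen : Subgroup.closure (Set.range gen) = ⊤ := by
  rw [eq_top_iff]
  rintro g -
  induction g using Ghat_induction with
  | one => exact one_mem _
  | mul s g ih => exact mul_mem (Subgroup.subset_closure ⟨s, rfl⟩) ih

instance : Fintype Gen := ⟨{a0, a1, a2, b, c, d}, fun x => by cases x <;> decide⟩

theorem A_finiteIndex : A.FiniteIndex := by
  have hcomm : ∀ x y : Ghat ⧸ A, x * y = y * x := by
    have h1 : ∀ (s : Gen) (g : Ghat), (gen s : Ghat ⧸ A) * g = g * gen s := by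
      intro s g
      induction g using Ghat_induction with
      | one => rw [QuotientGroup.mk_one, mul_one, one_mul]
      | mul t g ih => rw [QuotientGroup.mk_mul, ← mul_assoc, mk_gen_comm, mul_assoc, ih, mul_assoc]
    intro x y
    obtain ⟨g, rfl⟩ := QuotientGroup.mk_surjective x
    obtain ⟨h, rfl⟩ := QuotientGroup.mk_surjective y
    induction g using Ghat_induction with
    | one => rw [QuotientGroup.mk_one, mul_one, one_mul]
    | mul t g ih => rw [QuotientGroup.mk_mul, mul_assoc, ih, ← mul_assoc, h1, mul_assoc]
  let _ : CommGroup (Ghat ⧸ A) := { (inferInstance : Group (Ghat ⧸ A)) with mul_comm := hcomm }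
  have hfg : Group.FG Ghat := by
    rw [Group.fg_iff]
    exact ⟨Set.range gen, closure_range_gen, Set.finite_range _⟩
  have hfgQ : Group.FG (Ghat ⧸ A) := QuotientGroup.fg A
  have hsq : ∀ g : Ghat ⧸ A, g * g = 1 := by
    intro g
    obtain ⟨g, rfl⟩ := QuotientGroup.mk_surjective g
    induction g using Ghat_induction with
    | one => rw [QuotientGroup.mk_one, mul_one]
    | mul s g ih =>
      rw [QuotientGroup.mk_mul, mul_mul_mul_comm, ih, mul_one, ← QuotientGroup.mk_mul]
      have : gen s * gen s = 1 := Subtype.ext (Equiv.ext fun v => genPerm_apply_apply s v)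
      rw [this]; rfl
  have htors : IsMulTorsion (Ghat ⧸ A) := by
    intro g
    rw [isOfFinOrder_iff_pow_eq_one]
    exact ⟨2, by norm_num, by rw [pow_two, hsq]⟩
  have hfin : Finite (Ghat ⧸ A) := CommGroup.finite_of_fg_isMulTorsion _ htors
  exact Subgroup.finiteIndex_of_finite_quotient

/-! ### The action on `Ξ` and the homomorphism onto the Klein four-group -/

/-- The coordinates of the Klein four-group: the first one if `m = 1`, and the second one otherwise.
They are seen as characters `χ_m`; for `m = 1` and `m = 2`, the character `χ_m` is non-trivial on
exactly those of the labels `b`, `c`, `d` that belong to `conn m`. -/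
def side (m : ℕ) (x : Klein) : ZMod 2 := if m = 1 then x.toAdd.1 else x.toAdd.2

theorem side_mul (m : ℕ) (x y : Klein) : side m (x * y) = side m x + side m y := by
  unfold side; split_ifs <;> rfl

theorem side_klein {m : ℕ} (hm : m = 1 ∨ m = 2) (s : Gen) :
    side m (klein s) = if s ∈ conn m then 1 else 0 := by
  rcases hm with rfl | rfl <;> cases s <;> rfl

theorem eq_of_side {x y : Klein} (h : ∀ m, m = 1 ∨ m = 2 → side m x = side m y) : x = y :=
  Multiplicative.toAdd.injective (Prod.ext (h 1 (Or.inl rfl)) (h 2 (Or.inr rfl)))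

theorem zmod_two_eq (a : ZMod 2) : a = 0 ∨ a = 1 := by
  revert a; decide

/-- The map of `Ξ` onto the graph of the sequence `J_∞⁻¹ e J_∞`, `e = conn m`, that sends a copy
`(J_∞, x)` to the right or to the left half according to the value of the character `χ_m` at `x`. -/
def xiVertex (m : ℕ) (p : ℕ × Klein) : Vertex :=
  (⟨limSeq (conn m), limSeq_mem m⟩, if side m p.2 = 0 then (p.1 : ℤ) else -1 - p.1)

theorem xiVertex_inj {m : ℕ} {p q : ℕ × Klein} (h : xiVertex m p = xiVertex m q) :
    p.1 = q.1 ∧ side m p.2 = side m q.2 := by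
  obtain ⟨v, x⟩ := p
  obtain ⟨u, y⟩ := q
  have h : (if side m x = 0 then (v : ℤ) else -1 - v) = if side m y = 0 then (u : ℤ) else -1 - u :=
    congrArg Prod.snd h
  change v = u ∧ side m x = side m y
  rcases zmod_two_eq (side m x) with h1 | h1 <;> rcases zmod_two_eq (side m y) with h2 | h2 <;>
    rw [h1, h2] at h ⊢ <;> simp only [if_true, one_ne_zero, if_false] at h
  · exact ⟨by omega, rfl⟩
  · omega
  · omega
  · exact ⟨by omega, rfl⟩

/-- The two maps `xiVertex 1`, `xiVertex 2` together separate the vertices of `Ξ`. -/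
theorem eq_of_xiVertex {p q : ℕ × Klein} (h : ∀ m, m = 1 ∨ m = 2 → xiVertex m p = xiVertex m q) :
    p = q :=
  Prod.ext (xiVertex_inj (h 1 (Or.inl rfl))).1
    (eq_of_side fun m hm => (xiVertex_inj (h m hm)).2)

theorem genPerm_xiVertex {m : ℕ} (hm : m = 1 ∨ m = 2) (s : Gen) (p : ℕ × Klein) :
    genPerm s (xiVertex m p) = xiVertex m (xiStep s p) := by
  obtain ⟨v, x⟩ := p
  have hadm := admissible_of_mem (limSeq_mem m)
  have key : ∀ k : ℤ, genPerm s (⟨limSeq (conn m), limSeq_mem m⟩, k)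
      = (⟨limSeq (conn m), limSeq_mem m⟩, step (limSeq (conn m)) s k) := fun k => rfl
  have hdisj : ∀ k, s ∈ limSeq (conn m) k → s ∉ limSeq (conn m) (k + 1) := fun k h h' =>
    (Finset.disjoint_left.1 (hadm.2 k)) h h'
  unfold xiVertex
  rw [key]
  congr 1
  have h0 := limSeq_natCast (conn m) 0
  rw [Nat.cast_zero] at h0
  have h2 := limSeq_neg (conn m) 0
  rw [Nat.cast_zero, sub_zero] at h2
  have h1 := limSeq_neg_one (conn m)
  have hd := hdisj (-1)
  rw [h1, show (-1 : ℤ) + 1 = 0 by norm_num, h0] at hd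
  cases v with
  | zero =>
    rcases zmod_two_eq (side m x) with hx | hx
    · by_cases hs : s ∈ Jinf 0
      · simp [step, xiStep, hx, hs, h0]
      · by_cases hc : s ∈ conn m <;>
          simp [step, xiStep, hx, hs, h0, h1, hc, side_mul, side_klein hm]
    · by_cases hs : s ∈ Jinf 0
      · have hc : s ∉ conn m := fun h => hd h hs
        simp [step, xiStep, hx, hs, h2, h1, hc]
      · by_cases hc : s ∈ conn m
        · have h11 : (1 : ZMod 2) + 1 = 0 := by decide
          simp [step, xiStep, hx, hs, h1, hc, side_mul, side_klein hm, h11]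
        · simp [step, xiStep, hx, hs, h2, h1, hc, side_mul, side_klein hm]
  | succ v =>
    rcases zmod_two_eq (side m x) with hx | hx
    · have e1 := limSeq_natCast (conn m) (v + 1)
      have e2 := limSeq_natCast (conn m) v
      simp only [step, xiStep, hx, if_true, e1]
      rw [show ((v + 1 : ℕ) : ℤ) - 1 = v by push_cast; ring, e2]
      split_ifs with h h' <;> simp_all; ring
    · have e1 := limSeq_neg (conn m) (v + 1)
      have e2 := limSeq_neg (conn m) v
      have e3 : (-1 - ((v + 1 : ℕ) : ℤ)) = -2 - v := by push_cast; ring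
      have e4 : (-2 - (v : ℤ)) - 1 = -2 - ((v + 1 : ℕ) : ℤ) := by push_cast; ring
      have hd' := hdisj (-2 - ((v + 1 : ℕ) : ℤ))
      rw [← e4, sub_add_cancel, e4, e1, e2] at hd'
      simp only [step, xiStep, hx, one_ne_zero, if_false, e3, e4, e1, e2]
      by_cases h : s ∈ Jinf (v + 1)
      · simp [h, hd' h, hx]; ring
      · by_cases h' : s ∈ Jinf v
        · simp [h, h', hx]; ring
        · simp [h, h', hx]; ring

theorem xiStep_xiStep (s : Gen) (p : ℕ × Klein) : xiStep s (xiStep s p) = p :=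
  eq_of_xiVertex fun m hm => by
    rw [← genPerm_xiVertex hm, ← genPerm_xiVertex hm, genPerm_apply_apply]

theorem xiStep_mul (s : Gen) (v : ℕ) (x y : Klein) :
    xiStep s (v, x * y) = ((xiStep s (v, x)).1, (xiStep s (v, x)).2 * y) := by
  cases v <;> simp only [xiStep] <;> split_ifs <;> simp [mul_right_comm]

/-- Every element of the group acts on `Ξ`, compatibly with the two maps `xiVertex m`. -/
theorem exists_xiPerm (g : Ghat) : ∃ f : Equiv.Perm (ℕ × Klein),
    (∀ m, m = 1 ∨ m = 2 → ∀ p, xiVertex m (f p) = (g : Equiv.Perm Vertex) (xiVertex m p)) ∧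
    (∀ v x y, f (v, x * y) = ((f (v, x)).1, (f (v, x)).2 * y)) ∧
    {v : ℕ | (f (v, 1)).2 ≠ 1}.Finite := by
  induction g using Ghat_induction with
  | one => exact ⟨1, fun _ _ _ => rfl, fun _ _ _ => rfl, by simp⟩
  | mul s g ih =>
    obtain ⟨f, h1, h2, h3⟩ := ih
    let σ : Equiv.Perm (ℕ × Klein) := ⟨xiStep s, xiStep s, xiStep_xiStep s, xiStep_xiStep s⟩
    refine ⟨σ * f, fun m hm p => ?_, fun v x y => ?_, ?_⟩
    · rw [Subgroup.coe_mul, Equiv.Perm.mul_apply, Equiv.Perm.mul_apply, ← h1 m hm, coe_gen,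
        genPerm_xiVertex hm]
      rfl
    · change xiStep s (f (v, x * y)) = _
      rw [h2, xiStep_mul]
      rfl
    · -- the label changes the copy only at the left ends
      have h4 : {v : ℕ | (f (v, 1)).1 = 0}.Finite := by
        refine Set.Finite.of_finite_image
          (f := fun v => f (v, 1)) ((Set.finite_range fun x : Klein => ((0 : ℕ), x)).subset ?_) ?_
        · rintro _ ⟨v, hv, rfl⟩
          exact ⟨(f (v, 1)).2, Prod.ext (Eq.symm hv) rfl⟩
        · intro v _ v' _ h
          exact congrArg Prod.fst (f.injective h)
      refine (h3.union h4).subset fun v hv => ?_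
      by_contra hcon
      simp only [Set.mem_union, Set.mem_ofPred_eq, not_or, not_not] at hcon
      apply hv
      change (xiStep s (f (v, 1))).2 = 1
      obtain ⟨k, hk⟩ := Nat.exists_eq_succ_of_ne_zero hcon.2
      have : f (v, 1) = (k + 1, 1) := Prod.ext hk hcon.1
      rw [this]
      simp only [xiStep]
      split_ifs <;> rfl

/-- The action of the group on `Ξ`. -/
noncomputable def xiHom : Ghat →* Equiv.Perm (ℕ × Klein) :=
  MonoidHom.mk' (fun g => (exists_xiPerm g).choose) fun g h => Equiv.ext fun p =>
    eq_of_xiVertex fun m hm => by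
      rw [(exists_xiPerm _).choose_spec.1 m hm, Equiv.Perm.mul_apply,
        (exists_xiPerm g).choose_spec.1 m hm, (exists_xiPerm h).choose_spec.1 m hm]
      rfl

theorem xiVertex_xiHom {m : ℕ} (hm : m = 1 ∨ m = 2) (g : Ghat) (p : ℕ × Klein) :
    xiVertex m (xiHom g p) = (g : Equiv.Perm Vertex) (xiVertex m p) :=
  (exists_xiPerm g).choose_spec.1 m hm p

theorem xiHom_mk_mul (g : Ghat) (v : ℕ) (x y : Klein) :
    xiHom g (v, x * y) = ((xiHom g (v, x)).1, (xiHom g (v, x)).2 * y) :=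
  (exists_xiPerm g).choose_spec.2.1 v x y

theorem xiHom_mk (g : Ghat) (v : ℕ) (y : Klein) :
    xiHom g (v, y) = ((xiHom g (v, 1)).1, (xiHom g (v, 1)).2 * y) := by
  rw [← xiHom_mk_mul, one_mul]

theorem finite_xiHom (g : Ghat) : {v : ℕ | (xiHom g (v, 1)).2 ≠ 1}.Finite :=
  (exists_xiPerm g).choose_spec.2.2

theorem xiHom_gen (s : Gen) (p : ℕ × Klein) : xiHom (gen s) p = xiStep s p :=
  eq_of_xiVertex fun m hm => by rw [xiVertex_xiHom hm, coe_gen, genPerm_xiVertex hm]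

/-- The projection of the action on `Ξ` to `J_∞`. -/
theorem xiHom_mul_fst (g h : Ghat) (v : ℕ) :
    (xiHom (g * h) (v, 1)).1 = (xiHom g ((xiHom h (v, 1)).1, 1)).1 := by
  rw [map_mul, Equiv.Perm.mul_apply, ← Prod.mk.eta (p := xiHom h (v, 1)), xiHom_mk]

theorem xiHom_cocycle (g h : Ghat) (v : ℕ) : (xiHom (g * h) (v, 1)).2
    = (xiHom g ((xiHom h (v, 1)).1, 1)).2 * (xiHom h (v, 1)).2 := by
  rw [map_mul, Equiv.Perm.mul_apply, ← Prod.mk.eta (p := xiHom h (v, 1)), xiHom_mk]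

theorem bijective_xiHom_fst (g : Ghat) : Function.Bijective fun v : ℕ => (xiHom g (v, 1)).1 := by
  refine Function.bijective_iff_has_inverse.2
    ⟨fun v => (xiHom g⁻¹ (v, 1)).1, fun v => ?_, fun v => ?_⟩
  · change (xiHom g⁻¹ ((xiHom g (v, 1)).1, 1)).1 = v
    rw [← xiHom_mul_fst, inv_mul_cancel, map_one]; rfl
  · change (xiHom g ((xiHom g⁻¹ (v, 1)).1, 1)).1 = v
    rw [← xiHom_mul_fst, mul_inv_cancel, map_one]; rfl

/-- The product of the values of the cocycle. It is multiplicative because the values of the cocycle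
at `g h` are those at `g`, permuted by `h`, times those at `h`. -/
noncomputable def kleinHom : Ghat →* Klein :=
  MonoidHom.mk' (fun g => ∏ᶠ v : ℕ, (xiHom g (v, 1)).2) fun g h => by
    have hb := bijective_xiHom_fst h
    have hg : (Function.mulSupport fun v : ℕ => (xiHom g ((xiHom h (v, 1)).1, 1)).2).Finite :=
      (finite_xiHom g).preimage hb.injective.injOn
    simp only [xiHom_cocycle]
    rw [finprod_mul_distrib hg (finite_xiHom h)]
    congr 1
    exact finprod_comp (g := fun v => (xiHom g (v, 1)).2) _ hb

theorem kleinHom_apply (g : Ghat) : kleinHom g = ∏ᶠ v : ℕ, (xiHom g (v, 1)).2 := rfl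

theorem Jinf_zero : Jinf 0 = {a2} := rfl

theorem kleinHom_gen {s : Gen} (hs : s ≠ a2) : kleinHom (gen s) = klein s := by
  rw [kleinHom_apply, finprod_eq_single _ 0]
  · rw [xiHom_gen, xiStep, Jinf_zero, if_neg (by simpa using hs), one_mul]
  · intro v hv
    obtain ⟨k, rfl⟩ := Nat.exists_eq_succ_of_ne_zero hv
    rw [xiHom_gen]
    simp only [xiStep]
    split_ifs <;> rfl

theorem kleinHom_surjective : Function.Surjective kleinHom := by
  have h : ∀ x : Klein, x = 1 ∨ x = klein b ∨ x = klein c ∨ x = klein d := by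
    change ∀ x : ZMod 2 × ZMod 2, x = 0 ∨ x = (1, 0) ∨ x = (0, 1) ∨ x = (1, 1)
    decide
  intro x
  rcases h x with rfl | rfl | rfl | rfl
  · exact ⟨1, map_one _⟩
  · exact ⟨gen b, kleinHom_gen (by decide)⟩
  · exact ⟨gen c, kleinHom_gen (by decide)⟩
  · exact ⟨gen d, kleinHom_gen (by decide)⟩

/-- The elements of `H_∞` preserve the beginnings of the halves of `J_∞⁻¹ e J_∞`, so that the
cocycle is trivial on them. -/
theorem Hinf_le_ker : Hinf ≤ kleinHom.ker := by
  rintro g ⟨n, hn, hg⟩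
  rw [MonoidHom.mem_ker, kleinHom_apply]
  refine finprod_eq_one_of_forall_eq_one fun v => ?_
  obtain ⟨k, hk⟩ : ∃ k, k = max n v := ⟨_, rfl⟩
  have hk1 : 1 ≤ k := by omega
  have hlt := lt_nv k
  obtain ⟨s, t, hs⟩ := exists_acts_of_mem_H hk1 (H_mono (by omega) (show n ≤ k by omega) hg)
  refine eq_of_side fun m hm => ?_
  have h1 := hs.actJ (limCopy m k hk1) v (by omega)
  have hside : side m 1 = 0 := by unfold side; split_ifs <;> rfl
  have h2 : xiVertex m (xiHom g (v, 1)) = xiVertex m (s v, 1) := by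
    rw [xiVertex_xiHom hm]
    rw [limCopy_vertex, limCopy_vertex] at h1
    simpa [xiVertex, hside] using h1
  exact (xiVertex_inj h2).2

theorem A_le_ker : A ≤ kleinHom.ker := by
  refine Subgroup.normalClosure_le_normal fun x hx => Hinf_le_ker ?_
  have : ⁅Hinf, Hinf⁆ ≤ Hinf := by
    rw [Subgroup.commutator_le]
    exact fun x hx y hy => mul_mem (mul_mem (mul_mem hx hy) (inv_mem hx)) (inv_mem hy)
  exact this hx

end SegGroup

theorem mainTheorem3 :
    SegGroup.VirtuallySimple SegGroup.Ghat ∧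
    (IsSimpleGroup SegGroup.A ∧ SegGroup.A.FiniteIndex) ∧
    ∃ (ρ : SegGroup.Ghat →* Equiv.Perm (ℕ × SegGroup.Klein))
      (φ : SegGroup.Ghat →* SegGroup.Klein),
      (∀ s p, ρ (SegGroup.gen s) p = SegGroup.xiStep s p) ∧
      (∀ g, {v : ℕ | (ρ g (v, 1)).2 ≠ 1}.Finite) ∧
      (∀ g h v, (ρ (g * h) (v, 1)).2 = (ρ g ((ρ h (v, 1)).1, 1)).2 * (ρ h (v, 1)).2) ∧
      (∀ g, φ g = ∏ᶠ v : ℕ, (ρ g (v, 1)).2) ∧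
      (φ (SegGroup.gen .b) = SegGroup.klein .b ∧ φ (SegGroup.gen .c) = SegGroup.klein .c ∧
        φ (SegGroup.gen .d) = SegGroup.klein .d) ∧
      Function.Surjective φ ∧
      SegGroup.Hinf ≤ φ.ker ∧ SegGroup.A ≤ φ.ker := by
  open SegGroup in
  exact ⟨⟨A, A_finiteIndex, A_simple⟩, ⟨A_simple, A_finiteIndex⟩, xiHom, kleinHom, xiHom_gen,
    finite_xiHom, xiHom_cocycle, kleinHom_apply, ⟨kleinHom_gen (by decide),
    kleinHom_gen (by decide), kleinHom_gen (by decide)⟩, kleinHom_surjective, Hinf_le_ker, A_le_ker⟩
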